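/- Let $M$ be a smooth manifold, let $E\to M$ be an exact Courant algebroid with anchor $\pi$, scalar product $\langle\cdot,\cdot\rangle$ and Dorfman bracket $[\cdot,\cdot]$, and let $\mathcal G$ be a semi-Riemannian generalised metric on $E$, i.e. $\mathcal G(a,b)=\langle \mathcal G^{\mathrm{end}}a,b\rangle$ is a smooth symmetric form with $(\mathcal G^{\mathrm{end}})^2=1$ whose restriction to $T^*M\cong\ker\pi$ is nondegenerate. Let $E_\pm$ be the $\pm1$-eigenbundles of $\mathcal G^{\mathrm{end}}$; the anchor restricts to isomorphisms $E_\pm\cong TM$. Let $g$ be the semi-Riemannian metric on $M$ with $g(\pi a,\pi b)=\mathcal G(a,b)$ for $a,b\in E_+$. Identify $E\cong TM\oplus T^*M$ by the isotropic splitting for which $E_\pm=\{Y\pm gY\}$, so that $\langle Y+\eta,Z+\zeta\rangle=\tfrac12(\eta(Z)+\zeta(Y))$ and $[Y+\eta,Z+\zeta]=[Y,Z]+L_Y\zeta-\iota_Z d\eta+H(Y,Z,\cdot)$ with a closed three-form $H$. Let $\nabla$ be the Levi-Civita connection of $g$, let $\mathrm{Rc}$ be its Ricci tensor, put $H^2(Y,Z)=\mathrm{tr}_g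 H^{(2)}(Y,\cdot,Z,\cdot)$ with $H^{(2)}(Y,Y',Z,Z')=\mathrm{tr}_g\,H(Y,Y',\cdot)H(Z,Z',\cdot)$, $(d^*H)(Y,Z)=-\mathrm{tr}_g(\nabla_{\cdot}H)(\cdot,Y,Z)$ and $H(\xi)=H(g^{-1}\xi,\cdot,\cdot)$; the symmetric and antisymmetric parts of a $(0,2)$-tensor are taken with the factor $\tfrac12$, and $(\nabla\alpha)(Y,Z)=(\nabla_Y\alpha)(Z)$ for a one-form $\alpha$. A generalised connection $D$ on $E$ (by definition compatible with $\langle\cdot,\cdot\rangle$) is a generalised Levi-Civita connection of $\mathcal G$ if $D\mathcal G=0$ and $\langle D_uv-D_vu-[u,v],w\rangle+\langle D_wu,v\rangle=0$ for all sections $u,v,w$ of $E$. Its divergence is $\mathrm{div}_D(a)=\mathrm{tr}\,Da$, its generalised Riemann tensor is $$\mathcal{R}m^D(a,b,v,w)=\tfrac12\big\{\langle R^D(v,w)b,a\rangle+\langle R^D(b,a)v,w\rangle+\mathrm{tr}_E\langle Dv,w\rangle\langle Db,a\rangle\big\},\qquad R^D(v,w)=D_vD_w-D_wD_v-D_{[v,w]},$$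 and its generalised Ricci tensor is $\mathcal{R}c^D(a,b)=\mathrm{tr}_E\,\mathcal{R}m^D(\cdot,a,\cdot,b)$, with traces taken with respect to $\langle\cdot,\cdot\rangle$. Let $X$ be a smooth vector field and $\xi$ a smooth one-form on $M$, and let $\mathrm{div}=\mathrm{div}^{\mathcal G}-2\langle X+\xi,\cdot\rangle$, where $\mathrm{div}^{\mathcal G}(a)=\mathrm{div}_g(\pi a)$. Write $\mathcal{R}c(\mathcal G,\mathrm{div})|_{E_\mp\times E_\pm}=\mathcal{R}c^D|_{E_\mp\times E_\pm}$ for any generalised Levi-Civita connection $D$ of $\mathcal G$ with $\mathrm{div}_D=\mathrm{div}$. Then, for every such $D$ and for both choices of sign, $$4\,\mathcal{R}c(\mathcal G,\mathrm{div})|_{E_\mp\times E_\pm}=4\,\mathrm{Rc}-H^2\mp2\,d^*H+4[\nabla\xi]^{\mathrm{sym}}\pm4[\nabla gX]^{\mathrm{antisym}}\mp2H(\xi),$$ where the right-hand side is evaluated on $(\bar b,a)\in E_\mp\times E_\pm$ as on $(\pi\bar b,\pi a)$. -/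

import Mathlib

open Bundle Module Topology
open scoped Manifold ContDiff

noncomputable section

namespace GenGeom

/-! ### Linear algebra: traces and raising of indices

For a nondegenerate bilinear form `B` with Gram matrix `B_ij`, inverse `B^ij`, these are
`B^ij T(b_i, b_j)` and `B^ij φ(b_i) b_j`. -/

section LinearAlgebra

variable {W : Type*} [AddCommGroup W] [Module ℝ W] [FiniteDimensional ℝ W]

/-- The inverse Gram matrix `B^ij` in the standard basis chosen by Mathlib. -/
def invGram (B : LinearMap.BilinForm ℝ W) :
    Matrix (Fin (finrank ℝ W)) (Fin (finrank ℝ W)) ℝ :=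
  (Matrix.of fun i j => B (finBasis ℝ W i) (finBasis ℝ W j))⁻¹

/-- The trace `B^ij T(b_i, b_j)` of `T` with respect to `B`. -/
def trace (B : LinearMap.BilinForm ℝ W) (T : W → W → ℝ) : ℝ :=
  ∑ i, ∑ j, invGram B i j * T (finBasis ℝ W i) (finBasis ℝ W j)

/-- The vector `B⁻¹ φ = B^ij φ(b_i) b_j` dual to the linear form `φ` with respect to `B`. -/
def sharp (B : LinearMap.BilinForm ℝ W) (φ : W → ℝ) : W :=
  ∑ i, ∑ j, (invGram B i j * φ (finBasis ℝ W i)) • finBasis ℝ W j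

/-- Let `B` be nondegenerate, `ρ : W → T` surjective with kernel the image of `T^*` under the
`B`-dual of `ρ`, and `J` an involution with `B(J·,·)` nondegenerate on `ker ρ`. Then `ρ` maps both
eigenspaces of `J` bijectively onto `T`. -/
theorem existsUnique_eigen_lift {T : Type*} [AddCommGroup T] [Module ℝ T] [FiniteDimensional ℝ T]
    (B : LinearMap.BilinForm ℝ W) (ρ : W →ₗ[ℝ] T) (J : W →ₗ[ℝ] W)
    (hB : ∀ a, (∀ b, B a b = 0) → a = 0)
    (hρ : Function.Surjective ρ)
    (hker : ∀ a, ρ a = 0 ↔ ∃ ξ : Dual ℝ T, ∀ b, B a b = ξ (ρ b))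
    (hJ : ∀ a, J (J a) = a)
    (hnd : ∀ a, ρ a = 0 → (∀ b, ρ b = 0 → B (J a) b = 0) → a = 0)
    {s : ℝ} (hs : s = 1 ∨ s = -1) (u : T) : ∃! a, J a = s • a ∧ ρ a = u := by
  have hss : s * s = 1 := by rcases hs with rfl | rfl <;> norm_num
  have hiso : ∀ a b, ρ a = 0 → ρ b = 0 → B a b = 0 := by
    intro a b ha hb
    obtain ⟨ξ, hξ⟩ := (hker a).1 ha
    rw [hξ, hb, map_zero]
  -- the map `ker ρ → T` induced by `J` is injective, hence bijective for dimension reasons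
  let φ : LinearMap.ker ρ →ₗ[ℝ] T := ρ ∘ₗ J ∘ₗ (LinearMap.ker ρ).subtype
  have hφ : Function.Injective φ := by
    rw [← LinearMap.ker_eq_bot, LinearMap.ker_eq_bot']
    rintro ⟨a, ha⟩ h
    have h' : ρ (J a) = 0 := h
    have : a = 0 := hnd a ha fun b hb => hiso _ _ h' hb
    exact Subtype.ext this
  have hBinj : Function.Injective B := by
    rw [← LinearMap.ker_eq_bot, LinearMap.ker_eq_bot']
    intro a ha
    exact hB a fun b => by rw [ha]; rfl
  have hBsurj : Function.Surjective B :=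
    (LinearMap.injective_iff_surjective_of_finrank_eq_finrank
      (Subspace.dual_finrank_eq (K := ℝ) (V := W)).symm).1 hBinj
  have hdim : finrank ℝ T ≤ finrank ℝ (LinearMap.ker ρ) := by
    let e : W ≃ₗ[ℝ] Dual ℝ W := LinearEquiv.ofBijective B ⟨hBinj, hBsurj⟩
    have he : ∀ (ξ : Dual ℝ T) b, B (e.symm (ξ ∘ₗ ρ)) b = ξ (ρ b) := by
      intro ξ b
      have : e (e.symm (ξ ∘ₗ ρ)) = ξ ∘ₗ ρ := e.apply_symm_apply _
      exact congrArg (fun f : Dual ℝ W => f b) this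
    let ψ : Dual ℝ T →ₗ[ℝ] LinearMap.ker ρ :=
      LinearMap.codRestrict _ (e.symm.toLinearMap ∘ₗ (LinearMap.lcomp ℝ ℝ ρ))
        (fun ξ => (hker _).2 ⟨ξ, fun b => he ξ b⟩)
    have hψ : Function.Injective ψ := by
      rw [← LinearMap.ker_eq_bot, LinearMap.ker_eq_bot']
      intro ξ h
      have h0 : e.symm (ξ ∘ₗ ρ) = 0 := congrArg Subtype.val h
      ext t
      obtain ⟨b, rfl⟩ := hρ t
      rw [← he ξ b, h0]
      simp
    calc finrank ℝ T = finrank ℝ (Dual ℝ T) := Subspace.dual_finrank_eq.symm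
      _ ≤ _ := LinearMap.finrank_le_finrank_of_injective hψ
  have hφs : Function.Surjective φ :=
    (LinearMap.injective_iff_surjective_of_finrank_eq_finrank
      (le_antisymm (LinearMap.finrank_le_finrank_of_injective hφ) hdim)).1 hφ
  obtain ⟨⟨α, hα⟩, hα'⟩ := hφs u
  have hα0 : ρ α = 0 := hα
  have hα1 : ρ (J α) = u := hα'
  refine ⟨J α + s • α, ⟨?_, ?_⟩, ?_⟩
  · simp only [map_add, map_smul, hJ, smul_add, smul_smul, hss, one_smul]
    abel
  · simp [hα0, hα1]
  · rintro b ⟨hb1, hb2⟩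
    rw [← sub_eq_zero]
    have hd : ρ (b - (J α + s • α)) = 0 := by simp [hα0, hα1, hb2]
    have hJd : J (b - (J α + s • α)) = s • (b - (J α + s • α)) := by
      simp only [map_sub, map_add, map_smul, hJ, hb1, smul_add, smul_sub, smul_smul, hss, one_smul]
      abel
    refine hnd _ hd fun c hc => ?_
    rw [hJd, map_smul, LinearMap.smul_apply, hiso _ _ hd hc, smul_zero]

end LinearAlgebra

/-! ### Sections -/

section Sections

variable {d : ℕ} {M : Type*} [TopologicalSpace M] [ChartedSpace (EuclideanSpace ℝ (Fin d)) M]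

instance tangentSpace_finiteDimensional (x : M) :
    FiniteDimensional ℝ (TangentSpace (𝓡 d) x) :=
  inferInstanceAs (FiniteDimensional ℝ (EuclideanSpace ℝ (Fin d)))

/-- `Γ(V)`: the smooth sections of the vector bundle `V` over the `d`-dimensional manifold `M`. -/
abbrev Sec (d : ℕ) {M : Type*} [TopologicalSpace M] [ChartedSpace (EuclideanSpace ℝ (Fin d)) M]
    (F : Type*) [NormedAddCommGroup F] [NormedSpace ℝ F] (V : M → Type*)
    [TopologicalSpace (TotalSpace F V)] [∀ x, TopologicalSpace (V x)] [FiberBundle F V] :=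
  Cₛ^∞⟮𝓡 d; F, V⟯

/-- Smooth vector fields on `M`. -/
abbrev VecField (d : ℕ) (M : Type*) [TopologicalSpace M]
    [ChartedSpace (EuclideanSpace ℝ (Fin d)) M] [IsManifold (𝓡 d) ∞ M] :=
  Sec d (EuclideanSpace ℝ (Fin d)) (TangentSpace (𝓡 d) : M → Type)

/-- Smooth one-forms on `M`. -/
abbrev OneForm (d : ℕ) (M : Type*) [TopologicalSpace M]
    [ChartedSpace (EuclideanSpace ℝ (Fin d)) M] [IsManifold (𝓡 d) ∞ M] :=
  Sec d (EuclideanSpace ℝ (Fin d) →L[ℝ] ℝ)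
    (fun x : M => TangentSpace (𝓡 d) x →L[ℝ] Bundle.Trivial M ℝ x)

/-- The derivative `df_x(v)`. -/
abbrev dd (f : M → ℝ) (x : M) (v : TangentSpace (𝓡 d) x) : ℝ := mvfderiv (𝓡 d) f x v

variable {F : Type*} [NormedAddCommGroup F] [NormedSpace ℝ F] {V : M → Type*}
  [TopologicalSpace (TotalSpace F V)] [∀ x, TopologicalSpace (V x)] [FiberBundle F V]
  [∀ x, AddCommGroup (V x)] [∀ x, Module ℝ (V x)] [VectorBundle ℝ F V]

/-- The product of a smooth function and a section. -/
def fsmul (f : C^∞⟮𝓡 d, M; ℝ⟯) (a : Sec d F V) : Sec d F V :=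
  ⟨(f : M → ℝ) • (a : ∀ x, V x), f.contMDiff.smul_section a.contMDiff⟩

variable [IsManifold (𝓡 d) ∞ M] [T2Space M] [ContMDiffVectorBundle ∞ F V (𝓡 d)]

theorem exists_section {p : M} (v : V p) : ∃ a : Sec d F V, a p = v := by
  obtain ⟨s, hs, hsm⟩ := FiberBundle.exists_contMDiffOn_extend (𝓡 d) F (k := ∞) v
  obtain ⟨t, hts, hto, hpt⟩ := mem_nhds_iff.1 hs
  obtain ⟨f, -, hf⟩ := (SmoothBumpFunction.nhds_basis_tsupport (I := 𝓡 d) p).mem_iff.1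
    (hto.mem_nhds hpt)
  refine ⟨⟨(f : M → ℝ) • FiberBundle.extend F v,
    ContMDiffOn.smul_section_of_tsupport f.contMDiff.contMDiffOn hto hf (hsm.mono hts)⟩, ?_⟩
  change f p • FiberBundle.extend F v p = v
  rw [f.eq_one, one_smul, FiberBundle.extend_apply_self]

/-- A smooth section with prescribed value `v` at a point (used only in expressions that are
tensorial, i.e. do not depend on the choice of the extension). -/
def ext {p : M} (v : V p) : Sec d F V := (exists_section (d := d) (F := F) v).choose

@[simp] theorem ext_self {p : M} (v : V p) : ext (d := d) (F := F) v p = v :=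
  (exists_section (d := d) (F := F) v).choose_spec


theorem contMDiffAt_det {n : ℕ} {p : M} {A : M → Matrix (Fin n) (Fin n) ℝ}
    (hA : ∀ i j, ContMDiffAt (𝓡 d) 𝓘(ℝ, ℝ) ∞ (fun x => A x i j) p) :
    ContMDiffAt (𝓡 d) 𝓘(ℝ, ℝ) ∞ (fun x => (A x).det) p := by
  simp only [Matrix.det_apply']
  refine ContMDiffAt.sum fun σ _ => ?_
  exact contMDiffAt_const.mul (ContMDiffAt.prod fun i _ => hA _ _)

theorem contMDiffAt_matrix_inv {n : ℕ} {p : M} {A : M → Matrix (Fin n) (Fin n) ℝ}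
    (hA : ∀ i j, ContMDiffAt (𝓡 d) 𝓘(ℝ, ℝ) ∞ (fun x => A x i j) p) (hp : (A p).det ≠ 0) (i j) :
    ContMDiffAt (𝓡 d) 𝓘(ℝ, ℝ) ∞ (fun x => (A x)⁻¹ i j) p := by
  simp only [Matrix.inv_def, Ring.inverse_eq_inv', Matrix.smul_apply, smul_eq_mul,
    Matrix.adjugate_apply]
  refine ((contMDiffAt_det hA).inv₀ hp).mul (contMDiffAt_det fun k l => ?_)
  by_cases h : k = j
  · subst h
    simpa [Matrix.updateRow_self] using contMDiffAt_const
  · simpa [Matrix.updateRow_ne h] using hA k l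

/-- A fiberwise linear right inverse `L` of `ρ` is smooth as soon as through each vector `L w` there
is a smooth section `b` with values in the range of `L` and smooth image `ρ b`. -/
theorem contMDiff_lift_of_sections {ρ : ∀ x, V x →ₗ[ℝ] TangentSpace (𝓡 d) x}
    {L : ∀ x, TangentSpace (𝓡 d) x →ₗ[ℝ] V x}
    (hL : ∀ p (w : TangentSpace (𝓡 d) p), ∃ (b : Sec d F V) (y : VecField d M),
      (∀ x, y x = ρ x (b x)) ∧ (∀ x, L x (y x) = b x) ∧ y p = w)
    (X : VecField d M) :
    ContMDiff (𝓡 d) ((𝓡 d).prod 𝓘(ℝ, F)) ∞ fun x => TotalSpace.mk' F x (L x (X x)) := by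
  intro p
  let e := trivializationAt (EuclideanSpace ℝ (Fin d)) (TangentSpace (𝓡 d) : M → Type) p
  have hpe : p ∈ e.baseSet := FiberBundle.mem_baseSet_trivializationAt' p
  let bs := (EuclideanSpace.basisFun (Fin d) ℝ).toBasis
  let c := e.localFrameCoeff (𝓡 d) bs
  choose b y hyb hLy hyp using fun i => hL p (e.localFrame bs i p)
  let A : M → Matrix (Fin d) (Fin d) ℝ := fun x => Matrix.of fun i j => c j x (y i x)
  have hc : ∀ (Z : VecField d M) i, ContMDiffAt (𝓡 d) 𝓘(ℝ, ℝ) ∞ (fun x => c i x (Z x)) p :=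
    fun Z i => contMDiffAt_localFrameCoeff (k := ∞) bs hpe (Z.contMDiff p) i
  have hA : ∀ i j, ContMDiffAt (𝓡 d) 𝓘(ℝ, ℝ) ∞ (fun x => A x i j) p := fun i j => hc _ _
  have hAp : A p = 1 := by
    ext i j
    change c j p (y i p) = _
    rw [hyp]
    rw [e.localFrameCoeff_apply_of_mem_baseSet bs hpe (fun x => e.localFrame bs i x) j,
      e.localFrame_apply_of_mem_baseSet bs hpe, Basis.repr_self, Matrix.one_apply,
      Finsupp.single_apply]
  have hdet : (A p).det ≠ 0 := by rw [hAp]; simp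
  let f : Fin d → M → ℝ := fun i x => ∑ j, c j x (X x) * (A x)⁻¹ j i
  have hf : ∀ i, ContMDiffAt (𝓡 d) 𝓘(ℝ, ℝ) ∞ (f i) p := fun i =>
    ContMDiffAt.sum fun j _ => (hc X j).mul (contMDiffAt_matrix_inv hA hdet j i)
  have key : ContMDiffAt (𝓡 d) ((𝓡 d).prod 𝓘(ℝ, F)) ∞
      (fun x => TotalSpace.mk' F x (∑ i, f i x • b i x)) p :=
    ContMDiffAt.sum_section fun i _ => (hf i).smul_section ((b i).contMDiff p)
  refine key.congr_of_eventuallyEq ?_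
  have hne : ∀ᶠ x in 𝓝 p, (A x).det ≠ 0 := (contMDiffAt_det hA).continuousAt.eventually_ne hdet
  filter_upwards [hne, e.open_baseSet.mem_nhds hpe] with x hx hxe
  have h1 : ∀ i, y i x = ∑ j, A x i j • e.localFrame bs j x := fun i =>
    e.eq_sum_localFrameCoeff_smul (s := fun x => y i x) hxe
  have h2 : X x = ∑ j, c j x (X x) • e.localFrame bs j x :=
    e.eq_sum_localFrameCoeff_smul (s := fun x => X x) hxe
  have h3 : X x = ∑ i, f i x • y i x := by
    have h4 : ∀ k, c k x (X x) = ∑ i, f i x * A x i k := by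
      intro k
      have h5 : (A x)⁻¹ * A x = 1 := Matrix.nonsing_inv_mul _ (isUnit_iff_ne_zero.2 hx)
      simp only [f, Finset.sum_mul]
      rw [Finset.sum_comm]
      simp only [mul_assoc, ← Finset.mul_sum]
      simp only [← Matrix.mul_apply, h5, Matrix.one_apply]
      simp
    rw [h2]
    simp only [h1, Finset.smul_sum, smul_smul]
    rw [Finset.sum_comm]
    refine Finset.sum_congr rfl fun k _ => ?_
    rw [← Finset.sum_smul, ← h4 k]
  congr 1
  conv_lhs => rw [h3]
  simp only [map_sum, map_smul, hLy]

end Sections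

/-! ### Exact Courant algebroids -/

section Courant

variable {d : ℕ} {M : Type*} [TopologicalSpace M] [ChartedSpace (EuclideanSpace ℝ (Fin d)) M]
  [IsManifold (𝓡 d) ∞ M]

/-- An exact Courant algebroid structure on the smooth vector bundle `V → M` (with typical fibre
`F`): a smooth fibrewise nondegenerate symmetric scalar product `⟨·,·⟩`, a smooth anchor
`V → TM` and a Dorfman bracket on `Γ(V)`, such that `0 → T^*M → V → TM → 0` is exact. -/
structure ExactCourantAlgebroid (d : ℕ) {M : Type*} [TopologicalSpace M]
    [ChartedSpace (EuclideanSpace ℝ (Fin d)) M] [IsManifold (𝓡 d) ∞ M]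
    (F : Type*) [NormedAddCommGroup F] [NormedSpace ℝ F] (V : M → Type*)
    [TopologicalSpace (TotalSpace F V)] [∀ x, TopologicalSpace (V x)] [FiberBundle F V]
    [∀ x, AddCommGroup (V x)] [∀ x, Module ℝ (V x)] [VectorBundle ℝ F V] where
  /-- the scalar product `⟨·,·⟩` -/
  pairing : ∀ x, LinearMap.BilinForm ℝ (V x)
  pairing_symm : ∀ x a b, pairing x a b = pairing x b a
  pairing_nondeg : ∀ x a, (∀ b, pairing x a b = 0) → a = 0
  pairing_smooth : ∀ a b : Sec d F V,
    ContMDiff (𝓡 d) 𝓘(ℝ, ℝ) ∞ fun x => pairing x (a x) (b x)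
  /-- the anchor `V → TM` -/
  anchor : ∀ x, V x →ₗ[ℝ] TangentSpace (𝓡 d) x
  anchor_smooth : ∀ a : Sec d F V,
    ContMDiff (𝓡 d) ((𝓡 d).prod 𝓘(ℝ, EuclideanSpace ℝ (Fin d))) ∞ fun x =>
      TotalSpace.mk' (EuclideanSpace ℝ (Fin d)) (E := (TangentSpace (𝓡 d) : M → Type)) x
        (anchor x (a x))
  /-- the Dorfman bracket -/
  bracket : Sec d F V →ₗ[ℝ] Sec d F V →ₗ[ℝ] Sec d F V
  jacobi : ∀ a b c, bracket a (bracket b c) = bracket (bracket a b) c + bracket b (bracket a c)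
  anchor_bracket : ∀ (a b : Sec d F V) x, anchor x (bracket a b x) =
    VectorField.mlieBracket (𝓡 d) (fun y => anchor y (a y)) (fun y => anchor y (b y)) x
  leibniz : ∀ (f : C^∞⟮𝓡 d, M; ℝ⟯) (a b : Sec d F V) x,
    bracket a (fsmul f b) x = f x • bracket a b x + dd f x (anchor x (a x)) • b x
  pairing_bracket : ∀ (a b c : Sec d F V) x,
    dd (fun y => pairing y (b y) (c y)) x (anchor x (a x)) =
      pairing x (bracket a b x) (c x) + pairing x (b x) (bracket a c x)
  bracket_self : ∀ (a b : Sec d F V) x,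
    pairing x (bracket a a x) (b x) =
      (1 / 2) * dd (fun y => pairing y (a y) (a y)) x (anchor x (b x))
  anchor_surjective : ∀ x, Function.Surjective (anchor x)
  /-- The kernel of the anchor is the image of the dual `T^*M → V^* ≅ V` of the anchor (which is
  injective because the anchor is surjective). -/
  anchor_exact : ∀ x a, anchor x a = 0 ↔
    ∃ ξ : Dual ℝ (TangentSpace (𝓡 d) x), ∀ b, pairing x a b = ξ (anchor x b)

variable {F : Type*} [NormedAddCommGroup F] [NormedSpace ℝ F] {V : M → Type*}
  [TopologicalSpace (TotalSpace F V)] [∀ x, TopologicalSpace (V x)] [FiberBundle F V]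
  [∀ x, AddCommGroup (V x)] [∀ x, Module ℝ (V x)] [VectorBundle ℝ F V]

/-- The vector field `π a`, for the anchor `π` and a section `a`. -/
def ExactCourantAlgebroid.anchorSec (C : ExactCourantAlgebroid d F V) (a : Sec d F V) :
    VecField d M :=
  ⟨fun x => C.anchor x (a x), C.anchor_smooth a⟩

/-- A semi-Riemannian generalised metric `𝒢` on an exact Courant algebroid, given by its
endomorphism: `𝒢(a,b) = ⟨endo a, b⟩` is a smooth symmetric form, `endo` is an involution and `𝒢`
restricts to a nondegenerate form (of any signature) on `T^*M`, the kernel of the anchor.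
The eigenbundles of `endo` for the eigenvalues `±1` are `E_±`. -/
structure GeneralisedMetric (C : ExactCourantAlgebroid d F V) where
  endo : ∀ x, V x →ₗ[ℝ] V x
  endo_smooth : ∀ a : Sec d F V,
    ContMDiff (𝓡 d) ((𝓡 d).prod 𝓘(ℝ, F)) ∞ fun x => TotalSpace.mk' F x (endo x (a x))
  endo_endo : ∀ x a, endo x (endo x a) = a
  endo_symm : ∀ x a b, C.pairing x (endo x a) b = C.pairing x a (endo x b)
  nondeg : ∀ x a, C.anchor x a = 0 →
    (∀ b, C.anchor x b = 0 → C.pairing x (endo x a) b = 0) → a = 0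

end Courant

/-! ### The classical data of a generalised metric -/

namespace GeneralisedMetric

variable {d : ℕ} {M : Type*} [TopologicalSpace M] [ChartedSpace (EuclideanSpace ℝ (Fin d)) M]
  [IsManifold (𝓡 d) ∞ M] {F : Type*} [NormedAddCommGroup F] [NormedSpace ℝ F]
  [FiniteDimensional ℝ F] {V : M → Type*} [TopologicalSpace (TotalSpace F V)]
  [∀ x, TopologicalSpace (V x)] [FiberBundle F V] [∀ x, AddCommGroup (V x)]
  [∀ x, Module ℝ (V x)] [VectorBundle ℝ F V]
  {C : ExactCourantAlgebroid d F V} (G : GeneralisedMetric C)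

/-- The section `𝒢 a`. -/
def endoSec (a : Sec d F V) : Sec d F V := ⟨fun x => G.endo x (a x), G.endo_smooth a⟩

/-- The fibre of `E_s`, for `s = 1` or `s = -1`. -/
def eigen (s : ℝ) (x : M) : Submodule ℝ (V x) := LinearMap.ker (G.endo x - s • LinearMap.id)

theorem mem_eigen {s : ℝ} {x : M} {a : V x} : a ∈ G.eigen s x ↔ G.endo x a = s • a := by
  simp [eigen, sub_eq_zero]

theorem anchor_bijective {s : ℝ} (hs : s = 1 ∨ s = -1) (x : M) :
    Function.Bijective ((C.anchor x).domRestrict (G.eigen s x)) := by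
  haveI : FiniteDimensional ℝ (V x) := VectorBundle.finiteDimensional ℝ F V x
  have h := existsUnique_eigen_lift (C.pairing x) (C.anchor x) (G.endo x) (C.pairing_nondeg x)
    (C.anchor_surjective x) (C.anchor_exact x) (G.endo_endo x) (G.nondeg x) hs
  constructor
  · rintro ⟨a, ha⟩ ⟨b, hb⟩ hab
    have hab' : C.anchor x a = C.anchor x b := hab
    exact Subtype.ext ((h _).unique ⟨G.mem_eigen.1 ha, rfl⟩ ⟨G.mem_eigen.1 hb, hab'.symm⟩)
  · intro u
    obtain ⟨a, ⟨ha, hu⟩, -⟩ := h u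
    exact ⟨⟨a, G.mem_eigen.2 ha⟩, hu⟩

/-- The inverse `T_xM → E_s` of the restriction of the anchor to `E_s`. -/
def lift {s : ℝ} (hs : s = 1 ∨ s = -1) (x : M) : TangentSpace (𝓡 d) x →ₗ[ℝ] V x :=
  (G.eigen s x).subtype ∘ₗ
    (LinearEquiv.ofBijective _ (G.anchor_bijective hs x)).symm.toLinearMap

theorem lift_mem {s : ℝ} (hs : s = 1 ∨ s = -1) (x : M) (u : TangentSpace (𝓡 d) x) :
    G.lift hs x u ∈ G.eigen s x := Subtype.property _

theorem anchor_lift {s : ℝ} (hs : s = 1 ∨ s = -1) (x : M) (u : TangentSpace (𝓡 d) x) :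
    C.anchor x (G.lift hs x u) = u :=
  (LinearEquiv.ofBijective _ (G.anchor_bijective hs x)).apply_symm_apply u

theorem lift_anchor {s : ℝ} (hs : s = 1 ∨ s = -1) (x : M) {a : V x} (ha : a ∈ G.eigen s x) :
    G.lift hs x (C.anchor x a) = a :=
  congrArg Subtype.val
    ((LinearEquiv.ofBijective _ (G.anchor_bijective hs x)).symm_apply_apply ⟨a, ha⟩)

/-- The lift `T_xM → E_+`. -/
def liftPlus (x : M) : TangentSpace (𝓡 d) x →ₗ[ℝ] V x := G.lift (s := 1) (Or.inl rfl) x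

/-- The lift `T_xM → E_-`. -/
def liftMinus (x : M) : TangentSpace (𝓡 d) x →ₗ[ℝ] V x := G.lift (s := -1) (Or.inr rfl) x

/-- The semi-Riemannian metric `g` on `M`, obtained from `𝒢` on `E_+` by the isomorphism
`E_+ ≅ TM`. -/
def g (x : M) : LinearMap.BilinForm ℝ (TangentSpace (𝓡 d) x) :=
  (C.pairing x).compl₁₂ (G.liftPlus x) (G.liftPlus x)

/-- The isotropic splitting `σ : TM → V` of the anchor for which `E_± = {σ X ± g X}`. It identifies
`V` with `TM ⊕ T^*M`. -/
def splitting (x : M) : TangentSpace (𝓡 d) x →ₗ[ℝ] V x :=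
  (1 / 2 : ℝ) • (G.liftPlus x + G.liftMinus x)

/-- The scalar product `⟨X + ξ, a⟩`, where `X + ξ ∈ TM ⊕ T^*M ≅ V` and where
`⟨X + ξ, Y + η⟩ = (ξ(Y) + η(X)) / 2`. -/
def pairSum (X : VecField d M) (ξ : OneForm d M) (a : Sec d F V) (x : M) : ℝ :=
  C.pairing x (G.splitting x (X x)) (a x) + (1 / 2) * ξ x (C.anchor x (a x))

variable [T2Space M] [ContMDiffVectorBundle ∞ F V (𝓡 d)]

theorem contMDiff_lift {s : ℝ} (hs : s = 1 ∨ s = -1) (X : VecField d M) :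
    ContMDiff (𝓡 d) ((𝓡 d).prod 𝓘(ℝ, F)) ∞ fun x => TotalSpace.mk' F x (G.lift hs x (X x)) := by
  refine contMDiff_lift_of_sections (ρ := C.anchor) (fun p w => ?_) X
  have hss : s * s = 1 := by rcases hs with rfl | rfl <;> norm_num
  let c : Sec d F V := ext (G.lift hs p w)
  let b : Sec d F V := (1 / 2 : ℝ) • (c + s • G.endoSec c)
  have hb : ∀ x, b x = (1 / 2 : ℝ) • (c x + s • G.endo x (c x)) := fun x => rfl
  refine ⟨b, C.anchorSec b, fun x => rfl, fun x => G.lift_anchor hs x (G.mem_eigen.2 ?_), ?_⟩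
  · rw [hb]
    simp only [map_smul, map_add, G.endo_endo, smul_add, smul_smul]
    rw [show s * (1 / 2 * s) = 1 / 2 by linear_combination (1 / 2) * hss, add_comm, mul_comm]
  · change C.anchor p (b p) = w
    have hc : c p = G.lift hs p w := ext_self _
    rw [hb, hc, G.mem_eigen.1 (G.lift_mem hs p w), smul_smul, hss, one_smul, map_smul, map_add,
      G.anchor_lift, ← two_smul ℝ w, smul_smul]
    norm_num

/-- The section `σ X`. -/
def splittingSec (X : VecField d M) : Sec d F V :=
  ⟨fun x => G.splitting x (X x),
    ((G.contMDiff_lift (Or.inl rfl) X).add_section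
      (G.contMDiff_lift (Or.inr rfl) X)).const_smul_section (a := (1 / 2 : ℝ))⟩

/-- The closed three-form `H(u,v,w) = 2⟨[σ u, σ v], σ w⟩` of the splitting, so that the bracket
becomes `[X + ξ, Y + η] = [X, Y] + L_X η - ι_Y dξ + H(X, Y, ·)`. -/
def H (x : M) (u v w : TangentSpace (𝓡 d) x) : ℝ :=
  2 * C.pairing x (C.bracket (G.splittingSec (ext u)) (G.splittingSec (ext v)) x)
    (G.splitting x w)

/-- The expression in Koszul's formula for `2 g(∇_X Y, Z)`. -/
def koszul (X Y Z : ∀ x : M, TangentSpace (𝓡 d) x) (x : M) : ℝ :=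
  dd (fun y => G.g y (Y y) (Z y)) x (X x) + dd (fun y => G.g y (X y) (Z y)) x (Y x)
    - dd (fun y => G.g y (X y) (Y y)) x (Z x)
    + G.g x (VectorField.mlieBracket (𝓡 d) X Y x) (Z x)
    - G.g x (VectorField.mlieBracket (𝓡 d) X Z x) (Y x)
    - G.g x (VectorField.mlieBracket (𝓡 d) Y Z x) (X x)

/-- The Levi-Civita connection of `g`: `(∇_X Y)_x` is the vector with
`2 g(∇_X Y, w) = koszul X Y w` for all `w ∈ T_xM`. -/
def nabla (X Y : ∀ x : M, TangentSpace (𝓡 d) x) (x : M) : TangentSpace (𝓡 d) x :=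
  sharp (G.g x) fun w => (1 / 2) * G.koszul X Y (ext w : VecField d M) x

/-- The curvature `R(X,Y)Z = ∇_X ∇_Y Z - ∇_Y ∇_X Z - ∇_[X,Y] Z`. -/
def riem (X Y Z : ∀ x : M, TangentSpace (𝓡 d) x) (x : M) : TangentSpace (𝓡 d) x :=
  G.nabla X (G.nabla Y Z) x - G.nabla Y (G.nabla X Z) x
    - G.nabla (VectorField.mlieBracket (𝓡 d) X Y) Z x

/-- The Ricci tensor `Rc(u,v) = tr_g g(R(·,u)v, ·)` of `g`. -/
def ricci (x : M) (u v : TangentSpace (𝓡 d) x) : ℝ :=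
  trace (G.g x) fun p q =>
    G.g x (G.riem (ext p : VecField d M) (ext u : VecField d M) (ext v : VecField d M) x) q

/-- `H^{(2)}(u,v,w,z) = tr_g H(u,v,·) H(w,z,·)`. -/
def Htwo (x : M) (u v w z : TangentSpace (𝓡 d) x) : ℝ :=
  trace (G.g x) fun p q => G.H x u v p * G.H x w z q

/-- `H²(u,v) = tr_g H^{(2)}(u,·,v,·)`. -/
def Hsq (x : M) (u v : TangentSpace (𝓡 d) x) : ℝ :=
  trace (G.g x) fun p q => G.Htwo x u p v q

/-- The covariant derivative `(∇_X H)(Y,Z,W)`. -/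
def nablaH (X Y Z W : ∀ x : M, TangentSpace (𝓡 d) x) (x : M) : ℝ :=
  dd (fun y => G.H y (Y y) (Z y) (W y)) x (X x)
    - G.H x (G.nabla X Y x) (Z x) (W x) - G.H x (Y x) (G.nabla X Z x) (W x)
    - G.H x (Y x) (Z x) (G.nabla X W x)

/-- The codifferential `(d^* H)(u,v) = - tr_g (∇_· H)(·,u,v)`. -/
def codiffH (x : M) (u v : TangentSpace (𝓡 d) x) : ℝ :=
  - trace (G.g x) fun p q =>
    G.nablaH (ext p : VecField d M) (ext q : VecField d M) (ext u : VecField d M)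
      (ext v : VecField d M) x

/-- The covariant derivative `(u,v) ↦ (∇_u α)(v)` of a one-form `α`. -/
def nablaForm (α : ∀ x : M, TangentSpace (𝓡 d) x → ℝ) (x : M) (u v : TangentSpace (𝓡 d) x) : ℝ :=
  dd (fun y => α y ((ext v : VecField d M) y)) x u
    - α x (G.nabla (ext u : VecField d M) (ext v : VecField d M) x)

/-- The two-form `H(ξ) = H(g⁻¹ξ, ·, ·)`. -/
def Hform (ξ : OneForm d M) (x : M) (u v : TangentSpace (𝓡 d) x) : ℝ :=
  G.H x (sharp (G.g x) fun w => ξ x w) u v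

/-- The metric divergence `div^𝒢(a) = div_g(π a) = tr ∇(π a)`. -/
def metricDiv (a : Sec d F V) (x : M) : ℝ :=
  trace (G.g x) fun p q => G.g x (G.nabla (ext p : VecField d M) (C.anchorSec a) x) q

/-- The divergence operator `div = div^𝒢 - 2⟨X + ξ, ·⟩`. -/
def divergence (X : VecField d M) (ξ : OneForm d M) (a : Sec d F V) (x : M) : ℝ :=
  G.metricDiv a x - 2 * G.pairSum X ξ a x

end GeneralisedMetric

/-- The symmetric part of a `(0,2)`-tensor. -/
def symPart {W : Type*} (T : W → W → ℝ) (u v : W) : ℝ := (T u v + T v u) / 2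

/-- The antisymmetric part of a `(0,2)`-tensor. -/
def antisymPart {W : Type*} (T : W → W → ℝ) (u v : W) : ℝ := (T u v - T v u) / 2

/-! ### Generalised connections and their curvature -/

section Connections

variable {d : ℕ} {M : Type*} [TopologicalSpace M] [ChartedSpace (EuclideanSpace ℝ (Fin d)) M]
  [IsManifold (𝓡 d) ∞ M] {F : Type*} [NormedAddCommGroup F] [NormedSpace ℝ F]
  {V : M → Type*} [TopologicalSpace (TotalSpace F V)]
  [∀ x, TopologicalSpace (V x)] [FiberBundle F V] [∀ x, AddCommGroup (V x)]
  [∀ x, Module ℝ (V x)] [VectorBundle ℝ F V]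

/-- A generalised connection `D` on a Courant algebroid, `D u v = D_u v`. -/
structure GeneralisedConnection (C : ExactCourantAlgebroid d F V) where
  D : Sec d F V →ₗ[ℝ] Sec d F V →ₗ[ℝ] Sec d F V
  smul_left : ∀ (f : C^∞⟮𝓡 d, M; ℝ⟯) (u v : Sec d F V), D (fsmul f u) v = fsmul f (D u v)
  leibniz : ∀ (f : C^∞⟮𝓡 d, M; ℝ⟯) (u v : Sec d F V) x,
    D u (fsmul f v) x = f x • D u v x + dd f x (C.anchor x (u x)) • v x
  metric : ∀ (u v w : Sec d F V) x,
    dd (fun y => C.pairing y (v y) (w y)) x (C.anchor x (u x)) =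
      C.pairing x (D u v x) (w x) + C.pairing x (v x) (D u w x)

namespace GeneralisedConnection

variable {C : ExactCourantAlgebroid d F V} (D : GeneralisedConnection C)

/-- The torsion `T(u,v,w) = ⟨D_u v - D_v u - [u,v], w⟩ + ⟨D_w u, v⟩`. -/
def torsion (u v w : Sec d F V) (x : M) : ℝ :=
  C.pairing x ((D.D u v - D.D v u - C.bracket u v) x) (w x) + C.pairing x (D.D w u x) (v x)

/-- `D` is a generalised Levi-Civita connection of `𝒢`: it is torsion-free and `D𝒢 = 0`. -/
structure IsLeviCivita (G : GeneralisedMetric C) : Prop where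
  parallel : ∀ u v : Sec d F V, D.D u (G.endoSec v) = G.endoSec (D.D u v)
  torsion_free : ∀ (u v w : Sec d F V) x, D.torsion u v w x = 0

/-- The naive curvature `⟨D_v D_w b - D_w D_v b - D_[v,w] b, a⟩`. -/
def naiveCurv (a b v w : Sec d F V) (x : M) : ℝ :=
  C.pairing x ((D.D v (D.D w b) - D.D w (D.D v b) - D.D (C.bracket v w) b) x) (a x)

variable [T2Space M] [FiniteDimensional ℝ F] [ContMDiffVectorBundle ∞ F V (𝓡 d)]

/-- The trace over the fibre `V x` with respect to the scalar product `⟨·,·⟩`. -/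
def traceE (C : ExactCourantAlgebroid d F V) (x : M) (T : V x → V x → ℝ) : ℝ :=
  haveI : FiniteDimensional ℝ (V x) := VectorBundle.finiteDimensional ℝ F V x
  trace (C.pairing x) T

/-- The generalised Riemann tensor
`Rm(a,b,v,w) = (⟨R(v,w)b, a⟩ + ⟨R(b,a)v, w⟩ + tr ⟨D_· v, w⟩⟨D_· b, a⟩) / 2`,
with `R` the naive curvature. -/
def genRiem (a b v w : Sec d F V) (x : M) : ℝ :=
  (1 / 2) * (D.naiveCurv a b v w x + D.naiveCurv w v b a x
    + traceE C x fun p q =>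
        C.pairing x (D.D (ext p) v x) (w x) * C.pairing x (D.D (ext q) b x) (a x))

/-- The generalised Ricci tensor `Rc(a,b) = tr Rm(·,a,·,b)`. -/
def genRicci (a b : Sec d F V) (x : M) : ℝ :=
  traceE C x fun p q => D.genRiem (ext p) a (ext q) b x

/-- The divergence operator `div_D(a) = tr D a` of a generalised connection. -/
def divergence (a : Sec d F V) (x : M) : ℝ :=
  traceE C x fun p q => C.pairing x (D.D (ext p) a x) q

end GeneralisedConnection

end Connections

end GenGeom

end

noncomputable section

namespace GenGeom

/-! ### Traces and raising of indices -/

section Traces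

variable {W : Type*} [AddCommGroup W] [Module ℝ W] [FiniteDimensional ℝ W]
  {B : LinearMap.BilinForm ℝ W}

/-! Write Y_t for the lift of a vector field Y to E_t, t = ±1. A generalised Levi-Civita connection
D preserves E_+ and E_-, and vanishing torsion forces D_{Y_{-t}} Z_t to be the E_t-part of [Y_{-t},
Z_t] (`D_liftSec_neg`). Under the anchor this part is ∇^t_Y Z, where ∇^t = ∇ + (t/2) T is a Bismut
connection and T = g⁻¹H (`bismut_apply`, `nabla_eq`, `H_apply`). The pure operators A(Z) : W ↦ π
D_{W_t} Z_t are not determined by the metric, but the mixed Ricci tensor sees only their traces, and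
these are values of the divergence.

Splitting the trace over E into its E_+ and E_- halves, Rc(Y_{-t}, Z_t) becomes half the sum of tr(W
↦ R(W_t, Y_{-t}) Z_t) and of the same expression with (t, Y, Z) replaced by (-t, Z, Y)
(`genRicci_liftSec`). Since [W_t, Y_{-t}] = (∇^{-t}_W Y)_{-t} - (∇^t_Y W)_t, the endomorphism under
the trace is A(∇^t_Y Z) - ∇^t_Y(A(Z)) - (∇^t Z) ∘ (∇^{-t} Y) (`curvAt_apply`). A metric connection
commutes with traces (`der_endoTrace`), so its trace is div(∇^t_Y Z) - Y div(Z) - tr(∇^t Z ∘ ∇^{-t}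
Y), with div evaluated on lifts to E_t.

For the divergence of g this equals Rc - H²/4 - (t/2) d^*H (`bismut_ricci`), because the classical
Ricci tensor is the same expression formed with ∇. The given divergence differs by the one-form α =
ξ + t gX, which contributes (∇α)(Y, Z) - (t/2) α(T(Y, Z)) (`trace_curvAt`). In the final average Rc
and H² survive by symmetry; d^*H and ξ(T) are skew but carry a factor t, so they survive too; ∇ξ is
symmetrised, ∇gX antisymmetrised, and the term g(X, T), skew with coefficient t² = 1, cancels.

The tensors of the statement are defined through arbitrary extensions `ext`; the tensoriality lemmas
remove that choice. -/

theorem isUnit_det_gram (hB : ∀ a, (∀ b, B a b = 0) → a = 0) :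
    IsUnit (Matrix.of fun i j => B (finBasis ℝ W i) (finBasis ℝ W j)).det := by
  rw [isUnit_iff_ne_zero]
  intro h
  obtain ⟨v, hv, hv0⟩ := Matrix.exists_vecMul_eq_zero_iff.2 h
  have h1 : ∑ i, v i • finBasis ℝ W i = 0 := by
    refine hB _ fun b => ?_
    have h2 : B (∑ i, v i • finBasis ℝ W i) = 0 := by
      refine (finBasis ℝ W).ext fun j => ?_
      have := congrFun hv0 j
      simpa [Matrix.vecMul, dotProduct] using this
    rw [h2, LinearMap.zero_apply]
  exact hv (funext fun i => Fintype.linearIndependent_iff.1 (finBasis ℝ W).linearIndependent v h1 i)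

theorem sum_invGram_mul (hB : ∀ a, (∀ b, B a b = 0) → a = 0) (i k) :
    ∑ j, invGram B i j * B (finBasis ℝ W j) (finBasis ℝ W k) = if i = k then 1 else 0 := by
  have := congrFun (congrFun (Matrix.nonsing_inv_mul _ (isUnit_det_gram hB)) i) k
  rwa [Matrix.mul_apply, Matrix.one_apply] at this

theorem invGram_symm (hs : ∀ a b, B a b = B b a) (i j) : invGram B i j = invGram B j i := by
  have h : (Matrix.of fun i j => B (finBasis ℝ W i) (finBasis ℝ W j)).transpose =
      Matrix.of fun i j => B (finBasis ℝ W i) (finBasis ℝ W j) := by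
    ext i j
    exact hs _ _
  have h2 := Matrix.transpose_nonsing_inv
    (Matrix.of fun i j => B (finBasis ℝ W i) (finBasis ℝ W j))
  rw [h] at h2
  exact (congrFun (congrFun h2 j) i)

theorem sharp_apply (hB : ∀ a, (∀ b, B a b = 0) → a = 0) (φ : W →ₗ[ℝ] ℝ) (w : W) :
    B (sharp B φ) w = φ w := by
  have h : B (sharp B φ) = φ := by
    refine (finBasis ℝ W).ext fun k => ?_
    simp only [sharp, map_sum, LinearMap.sum_apply, map_smul, LinearMap.smul_apply, smul_eq_mul]
    calc _ = ∑ i, φ (finBasis ℝ W i) *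
          ∑ j, invGram B i j * B (finBasis ℝ W j) (finBasis ℝ W k) := by
          refine Finset.sum_congr rfl fun i _ => ?_
          rw [Finset.mul_sum]
          exact Finset.sum_congr rfl fun j _ => by ring
      _ = _ := by simp [sum_invGram_mul hB]
  rw [h]

omit [FiniteDimensional ℝ W] in
theorem ext_form (hB : ∀ a, (∀ b, B a b = 0) → a = 0) {v w : W} (h : ∀ u, B v u = B w u) :
    v = w :=
  sub_eq_zero.1 (hB _ fun u => by rw [map_sub, LinearMap.sub_apply, h, sub_self])

/-- No linearity of φ is assumed: the representing vector supplies it. This matters for `nabla`,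
whose Koszul expression is evaluated on arbitrary extensions and is not visibly linear. -/
theorem sharp_eq (hB : ∀ a, (∀ b, B a b = 0) → a = 0) {φ : W → ℝ} {v : W}
    (h : ∀ w, B v w = φ w) : sharp B φ = v := by
  have : φ = (B v : W →ₗ[ℝ] ℝ) := funext fun w => (h w).symm
  rw [this]
  exact ext_form hB fun u => sharp_apply hB _ _

theorem trace_mul_left (c : ℝ) (T : W → W → ℝ) :
    trace B (fun p q => c * T p q) = c * trace B T := by
  simp only [trace, Finset.mul_sum, mul_left_comm]

theorem trace_sum {ι : Type*} [Fintype ι] (T : ι → W → W → ℝ) :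
    trace B (fun p q => ∑ i, T i p q) = ∑ i, trace B (T i) := by
  simp only [trace, Finset.mul_sum]
  conv_rhs => rw [Finset.sum_comm]
  refine Finset.sum_congr rfl fun k _ => ?_
  rw [Finset.sum_comm]

theorem trace_swap (hs : ∀ a b, B a b = B b a) (T : W → W → ℝ) :
    trace B (fun p q => T q p) = trace B T := by
  rw [trace, Finset.sum_comm]
  refine Finset.sum_congr rfl fun i _ => Finset.sum_congr rfl fun j _ => ?_
  rw [invGram_symm hs]

theorem trace_eq_zero_of_antisymm (hs : ∀ a b, B a b = B b a) {T : W → W → ℝ}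
    (h : ∀ p q, T p q = - T q p) : trace B T = 0 := by
  have h1 := trace_swap hs T
  have h2 : trace B (fun p q => T q p) = -1 * trace B T := by
    rw [← trace_mul_left]
    exact congrArg _ (funext₂ fun p q => by rw [h]; ring)
  linarith

/-- Turns index contractions into the basis-free trace, for which linearity and cyclicity are
available. All later computations take place there. -/
theorem trace_form_comp (hB : ∀ a, (∀ b, B a b = 0) → a = 0) (hs : ∀ a b, B a b = B b a)
    (A : W →ₗ[ℝ] W) : trace B (fun p q => B (A p) q) = LinearMap.trace ℝ W A := by
  rw [LinearMap.trace_eq_matrix_trace ℝ (finBasis ℝ W), Matrix.trace, trace]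
  refine Finset.sum_congr rfl fun k _ => ?_
  rw [Matrix.diag_apply, LinearMap.toMatrix_apply]
  conv_lhs => rw [← (finBasis ℝ W).sum_repr (A (finBasis ℝ W k))]
  simp only [map_sum, LinearMap.sum_apply, map_smul, LinearMap.smul_apply, smul_eq_mul,
    Finset.mul_sum]
  rw [Finset.sum_comm]
  calc _ = ∑ m, (finBasis ℝ W).repr (A (finBasis ℝ W k)) m *
        ∑ l, invGram B k l * B (finBasis ℝ W l) (finBasis ℝ W m) := by
        refine Finset.sum_congr rfl fun m _ => ?_
        rw [Finset.mul_sum]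
        exact Finset.sum_congr rfl fun l _ => by rw [hs (finBasis ℝ W m)]; ring
    _ = _ := by simp [sum_invGram_mul hB]

theorem trace_mul_linear (φ : W →ₗ[ℝ] ℝ) (ψ : W →ₗ[ℝ] ℝ) :
    trace B (fun p q => φ p * ψ q) = ψ (sharp B φ) := by
  simp only [trace, sharp, map_sum, map_smul, smul_eq_mul, mul_assoc]

/-- Expanding the first slot in the family e reduces T to a sum of products of linear forms, and the
B-dual of B(·, e'_i) is e'_i by symmetry. -/
theorem trace_eq_sum (hB : ∀ a, (∀ b, B a b = 0) → a = 0) (hs : ∀ a b, B a b = B b a)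
    {ι : Type*} [Fintype ι] {e e' : ι → W} (he : ∀ w, w = ∑ i, B w (e' i) • e i)
    (T : W →ₗ[ℝ] W →ₗ[ℝ] ℝ) : trace B (fun p q => T p q) = ∑ i, T (e i) (e' i) := by
  have h1 : ∀ p q, T p q = ∑ i, B.flip (e' i) p * T (e i) q := by
    intro p q
    conv_lhs => rw [he p]
    simp
  have h2 : trace B (fun p q => T p q) = ∑ i, trace B (fun p q => B.flip (e' i) p * T (e i) q) := by
    rw [← trace_sum]
    exact congrArg _ (funext₂ h1)
  rw [h2]
  refine Finset.sum_congr rfl fun i _ => ?_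
  rw [trace_mul_linear]
  congr 1
  exact sharp_eq hB fun w => hs _ _

/-- Biorthogonal families of the right cardinality are dual bases. -/
theorem eq_sum_of_biorthogonal {ι : Type*} [Fintype ι] [DecidableEq ι]
    (hcard : Fintype.card ι = finrank ℝ W) {e e' : ι → W}
    (h : ∀ i j, B (e i) (e' j) = if i = j then 1 else 0) (w : W) :
    w = ∑ i, B w (e' i) • e i := by
  have hli : LinearIndependent ℝ e := by
    rw [Fintype.linearIndependent_iff]
    intro c hc j
    have := congrArg (fun v => B v (e' j)) hc
    simpa [h] using this
  have hsp := hli.span_eq_top_of_card_eq_finrank' hcard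
  have hw : w ∈ Submodule.span ℝ (Set.range e) := by rw [hsp]; trivial
  obtain ⟨c, rfl⟩ := (Submodule.mem_span_range_iff_exists_fun ℝ).1 hw
  refine Finset.sum_congr rfl fun i _ => ?_
  congr 1
  simp [h]

end Traces

/-! ### Derivatives of smooth functions -/

section Derivative

variable {d : ℕ} {M : Type*} [TopologicalSpace M] [ChartedSpace (EuclideanSpace ℝ (Fin d)) M]

theorem dd_add (f g : C^∞⟮𝓡 d, M; ℝ⟯) (x : M) (v : TangentSpace (𝓡 d) x) :
    dd (f + g) x v = dd f x v + dd g x v := by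
  have := mvfderiv_add (I := 𝓡 d) (f.contMDiff.mdifferentiableAt (x := x) (by simp))
    (g.contMDiff.mdifferentiableAt (by simp))
  exact congrArg (fun L : TangentSpace (𝓡 d) x →L[ℝ] ℝ => L v) this

theorem dd_sub (f g : C^∞⟮𝓡 d, M; ℝ⟯) (x : M) (v : TangentSpace (𝓡 d) x) :
    dd (f - g) x v = dd f x v - dd g x v := by
  have := mvfderiv_sub (I := 𝓡 d) (f.contMDiff.mdifferentiableAt (x := x) (by simp))
    (g.contMDiff.mdifferentiableAt (by simp))
  exact congrArg (fun L : TangentSpace (𝓡 d) x →L[ℝ] ℝ => L v) this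

theorem dd_mul (f g : C^∞⟮𝓡 d, M; ℝ⟯) (x : M) (v : TangentSpace (𝓡 d) x) :
    dd (f * g) x v = f x * dd g x v + g x * dd f x v := by
  have := mvfderiv_mul (I := 𝓡 d) (f.contMDiff.mdifferentiableAt (x := x) (by simp))
    (g.contMDiff.mdifferentiableAt (by simp))
  have h := congrArg (fun L : TangentSpace (𝓡 d) x →L[ℝ] ℝ => L v) this
  simpa using h

theorem dd_const (c : ℝ) (x : M) (v : TangentSpace (𝓡 d) x) :
    dd (fun _ : M => c) x v = 0 := by
  rw [dd, mvfderiv_const]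
  rfl

theorem dd_congr {f g : M → ℝ} {x : M} (h : f =ᶠ[𝓝 x] g) (v : TangentSpace (𝓡 d) x) :
    dd f x v = dd g x v := by
  simp only [dd, mvfderiv]
  rw [h.mfderiv_eq]
  rfl

theorem dd_smul (c : ℝ) (f : C^∞⟮𝓡 d, M; ℝ⟯) (x : M) (v : TangentSpace (𝓡 d) x) :
    dd (c • f) x v = c * dd f x v := by
  let k : C^∞⟮𝓡 d, M; ℝ⟯ := ⟨fun _ => c, contMDiff_const⟩
  have h : dd (k * f) x v = c * dd f x v + f x * dd (fun _ => c) x v := dd_mul k f x v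
  rw [dd_const c x v, mul_zero, add_zero] at h
  exact h

variable [IsManifold (𝓡 d) ∞ M]

theorem contMDiff_dd (f : C^∞⟮𝓡 d, M; ℝ⟯) (Y : VecField d M) :
    ContMDiff (𝓡 d) 𝓘(ℝ, ℝ) ∞ fun x => dd f x (Y x) := by
  have h1 := (f.contMDiff.contMDiff_tangentMap (m := ∞) (by simp)).comp Y.contMDiff
  exact (contMDiff_snd_tangentBundle_modelSpace ℝ 𝓘(ℝ, ℝ)).comp h1

/-- The derivative `Y f` of a smooth function along a vector field. -/
def der (Y : VecField d M) (f : C^∞⟮𝓡 d, M; ℝ⟯) : C^∞⟮𝓡 d, M; ℝ⟯ :=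
  ⟨fun x => dd f x (Y x), contMDiff_dd f Y⟩

theorem der_apply (Y : VecField d M) (f : C^∞⟮𝓡 d, M; ℝ⟯) (x : M) :
    der Y f x = dd f x (Y x) := rfl

theorem der_add (Y : VecField d M) (f g : C^∞⟮𝓡 d, M; ℝ⟯) :
    der Y (f + g) = der Y f + der Y g :=
  ContMDiffMap.ext fun x => dd_add f g x _

theorem der_sub (Y : VecField d M) (f g : C^∞⟮𝓡 d, M; ℝ⟯) :
    der Y (f - g) = der Y f - der Y g :=
  ContMDiffMap.ext fun x => dd_sub f g x _

theorem der_mul (Y : VecField d M) (f g : C^∞⟮𝓡 d, M; ℝ⟯) :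
    der Y (f * g) = f * der Y g + g * der Y f :=
  ContMDiffMap.ext fun x => dd_mul f g x _

theorem der_smul (Y : VecField d M) (c : ℝ) (f : C^∞⟮𝓡 d, M; ℝ⟯) :
    der Y (c • f) = c • der Y f :=
  ContMDiffMap.ext fun x => dd_smul c f x _

theorem der_sum {ι : Type*} (s : Finset ι) (Y : VecField d M) (f : ι → C^∞⟮𝓡 d, M; ℝ⟯) :
    der Y (∑ i ∈ s, f i) = ∑ i ∈ s, der Y (f i) :=
  map_sum (⟨⟨der Y, ContMDiffMap.ext fun x => dd_const 0 x _⟩, der_add Y⟩ :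
    C^∞⟮𝓡 d, M; ℝ⟯ →+ C^∞⟮𝓡 d, M; ℝ⟯) f s

theorem der_congr {f g : C^∞⟮𝓡 d, M; ℝ⟯} {x : M} (h : ∀ᶠ y in 𝓝 x, f y = g y)
    (Y : VecField d M) : der Y f x = der Y g x := dd_congr h _

end Derivative

/-! ### Tensorial operations on sections -/

section Tensorial

variable {d : ℕ} {M : Type*} [TopologicalSpace M] [ChartedSpace (EuclideanSpace ℝ (Fin d)) M]
  {F : Type*} [NormedAddCommGroup F] [NormedSpace ℝ F] {V : M → Type*}
  [TopologicalSpace (TotalSpace F V)] [∀ x, TopologicalSpace (V x)] [FiberBundle F V]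
  [∀ x, AddCommGroup (V x)] [∀ x, Module ℝ (V x)] [VectorBundle ℝ F V]

@[simp] theorem fsmul_apply (f : C^∞⟮𝓡 d, M; ℝ⟯) (a : Sec d F V) (x : M) :
    fsmul f a x = f x • a x := rfl

@[simp] theorem sec_add_apply (a b : Sec d F V) (x : M) : (a + b) x = a x + b x := rfl

@[simp] theorem sec_sub_apply (a b : Sec d F V) (x : M) : (a - b) x = a x - b x := rfl

@[simp] theorem sec_neg_apply (a : Sec d F V) (x : M) : (-a) x = -a x := rfl

@[simp] theorem sec_smul_apply (c : ℝ) (a : Sec d F V) (x : M) : (c • a) x = c • a x := rfl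

theorem sec_sum_apply {ι : Type*} (s : Finset ι) (a : ι → Sec d F V) (x : M) :
    (∑ i ∈ s, a i) x = ∑ i ∈ s, a i x :=
  map_sum (⟨⟨fun b : Sec d F V => b x, rfl⟩, fun _ _ => rfl⟩ : Sec d F V →+ V x) a s

variable [IsManifold (𝓡 d) ∞ M] [T2Space M]

theorem exists_bump {x : M} {u : Set M} (hu : u ∈ 𝓝 x) :
    ∃ χ : C^∞⟮𝓡 d, M; ℝ⟯, (∀ᶠ y in 𝓝 x, χ y = 1) ∧ tsupport χ ⊆ u := by
  obtain ⟨f, -, hf⟩ := (SmoothBumpFunction.nhds_basis_tsupport (I := 𝓡 d) x).mem_iff.1 hu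
  exact ⟨⟨f, f.contMDiff⟩, f.eventuallyEq_one, hf⟩

/-- A bump function supported where f is smooth makes the product globally smooth and keeps the germ
at x. -/
theorem exists_function_eventuallyEq {x : M} {f : M → ℝ}
    (hf : ∀ᶠ y in 𝓝 x, ContMDiffAt (𝓡 d) 𝓘(ℝ, ℝ) ∞ f y) :
    ∃ g : C^∞⟮𝓡 d, M; ℝ⟯, ∀ᶠ y in 𝓝 x, g y = f y := by
  obtain ⟨χ, hχ, hsupp⟩ := exists_bump (d := d) hf
  refine ⟨⟨fun y => χ y * f y, contMDiff_of_tsupport fun y hy => ?_⟩, ?_⟩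
  · exact χ.contMDiff.contMDiffAt.mul (hsupp (tsupport_mul_subset_left hy))
  · filter_upwards [hχ] with y hy
    change χ y * f y = f y
    rw [hy, one_mul]

theorem exists_section_eventuallyEq {x : M} {s : ∀ y, V y} {u : Set M} (hu : IsOpen u)
    (hx : x ∈ u) (hs : ContMDiffOn (𝓡 d) ((𝓡 d).prod 𝓘(ℝ, F)) ∞
      (fun y => TotalSpace.mk' F y (s y)) u) :
    ∃ S : Sec d F V, ∀ᶠ y in 𝓝 x, S y = s y := by
  obtain ⟨χ, hχ, hsupp⟩ := exists_bump (d := d) (hu.mem_nhds hx)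
  refine ⟨⟨(χ : M → ℝ) • s, ContMDiffOn.smul_section_of_tsupport χ.contMDiff.contMDiffOn hu hsupp
    hs⟩, ?_⟩
  filter_upwards [hχ] with y hy
  change χ y • s y = s y
  rw [hy, one_smul]

variable {A : Type*} [AddCommGroup A] [Module ℝ A]

/-- An operation on smooth sections is tensorial at `x` if it is additive and multiplying the
section by a smooth function multiplies the result by the value of the function at `x`. -/
structure IsTensorialAt (x : M) (Φ : Sec d F V → A) : Prop where
  add : ∀ a b, Φ (a + b) = Φ a + Φ b
  smul : ∀ (f : C^∞⟮𝓡 d, M; ℝ⟯) a, Φ (fsmul f a) = f x • Φ a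

namespace IsTensorialAt

variable {x : M} {Φ : Sec d F V → A}

/-- Locality: for a bump function χ supported where a = b, the sections χa and χb coincide
everywhere, while χ(x) = 1. -/
theorem eq_of_eventuallyEq (h : IsTensorialAt x Φ) {a b : Sec d F V}
    (hab : ∀ᶠ y in 𝓝 x, a y = b y) : Φ a = Φ b := by
  obtain ⟨χ, hχ, hsupp⟩ := exists_bump (d := d) hab
  have h1 : fsmul χ a = fsmul χ b := by
    refine ContMDiffSection.ext fun y => ?_
    by_cases hy : y ∈ tsupport χ
    · simp only [fsmul_apply]
      rw [show a y = b y from hsupp hy]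
    · simp [image_eq_zero_of_notMem_tsupport hy]
  have h2 := h.smul χ a
  rw [h1, h.smul, hχ.self_of_nhds, one_smul, one_smul] at h2
  exact h2.symm

omit [IsManifold (𝓡 d) ∞ M] [T2Space M] in
theorem sum (h : IsTensorialAt x Φ) {ι : Type*} (s : Finset ι) (a : ι → Sec d F V) :
    Φ (∑ i ∈ s, a i) = ∑ i ∈ s, Φ (a i) :=
  map_sum (AddMonoidHom.mk' Φ h.add) a s

variable [FiniteDimensional ℝ F] [ContMDiffVectorBundle ∞ F V (𝓡 d)]

/-- Near x the section is a combination of a local frame with smooth coefficients, and these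
coefficients vanish at x. -/
theorem eq_zero_of_apply_eq_zero (h : IsTensorialAt x Φ) {a : Sec d F V} (ha : a x = 0) :
    Φ a = 0 := by
  let e := trivializationAt F V x
  have hx : x ∈ e.baseSet := FiberBundle.mem_baseSet_trivializationAt' x
  let bs := finBasis ℝ F
  have h1 : ∀ i, ∃ S : Sec d F V, ∀ᶠ y in 𝓝 x, S y = e.localFrame bs i y := fun i =>
    exists_section_eventuallyEq e.open_baseSet hx (e.contMDiffOn_localFrame_baseSet (I := 𝓡 d) ∞ bs i)
  have h2 : ∀ i, ∃ f : C^∞⟮𝓡 d, M; ℝ⟯, ∀ᶠ y in 𝓝 x, f y = e.localFrameCoeff (𝓡 d) bs i y (a y) :=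
    fun i => exists_function_eventuallyEq (by
      filter_upwards [e.open_baseSet.mem_nhds hx] with y hy
      exact contMDiffAt_localFrameCoeff (k := ∞) bs hy (a.contMDiff y) i)
  choose S hS using h1
  choose f hf using h2
  have h3 : Φ a = Φ (∑ i, fsmul (f i) (S i)) := by
    refine h.eq_of_eventuallyEq ?_
    filter_upwards [e.open_baseSet.mem_nhds hx, Filter.eventually_all.2 hS,
      Filter.eventually_all.2 hf] with y hy hSy hfy
    simp only [sec_sum_apply, fsmul_apply, hSy, hfy]
    exact e.eq_sum_localFrameCoeff_smul (I := 𝓡 d) (b := bs) (s := fun y => a y) hy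
  rw [h3, h.sum]
  refine Finset.sum_eq_zero fun i _ => ?_
  rw [h.smul, (hf i).self_of_nhds, ha, map_zero, zero_smul]

theorem eq_of_apply_eq (h : IsTensorialAt x Φ) {a b : Sec d F V} (hab : a x = b x) :
    Φ a = Φ b := by
  have h0 : (a - b) x = 0 := by rw [sec_sub_apply, hab, sub_self]
  have h1 := h.add (a - b) b
  rwa [sub_add_cancel, h.eq_zero_of_apply_eq_zero h0, zero_add] at h1

/-- The linear map on the fibre induced by a tensorial operation. -/
def toLinearMap (h : IsTensorialAt x Φ) : V x →ₗ[ℝ] A where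
  toFun v := Φ (ext v)
  map_add' v w := by
    rw [← h.add]
    exact h.eq_of_apply_eq (by simp)
  map_smul' c v := by
    rw [RingHom.id_apply]
    let k : C^∞⟮𝓡 d, M; ℝ⟯ := ⟨fun _ => c, contMDiff_const⟩
    refine Eq.trans (h.eq_of_apply_eq ?_) (h.smul k (ext v))
    rw [ext_self, fsmul_apply, ext_self]
    rfl

theorem toLinearMap_apply (h : IsTensorialAt x Φ) (a : Sec d F V) : h.toLinearMap (a x) = Φ a :=
  h.eq_of_apply_eq (by simp)

end IsTensorialAt

variable [FiniteDimensional ℝ F] [ContMDiffVectorBundle ∞ F V (𝓡 d)]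

/-- The linear map induced in the second slot depends tensorially on the first argument, so the
one-variable construction applies again with values in the linear maps. -/
theorem exists_bilinear_of_tensorial {x : M} {Φ : Sec d F V → Sec d F V → A}
    (h₁ : ∀ b, IsTensorialAt x fun a => Φ a b) (h₂ : ∀ a, IsTensorialAt x (Φ a)) :
    ∃ T : V x →ₗ[ℝ] V x →ₗ[ℝ] A, ∀ a b, T (a x) (b x) = Φ a b := by
  have h : IsTensorialAt x fun a => (h₂ a).toLinearMap := by
    constructor
    · intro a b
      ext v
      rw [← ext_self (d := d) (F := F) v]
      simp only [LinearMap.add_apply, IsTensorialAt.toLinearMap_apply, (h₁ _).add]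
    · intro f a
      ext v
      rw [← ext_self (d := d) (F := F) v]
      simp only [LinearMap.smul_apply, IsTensorialAt.toLinearMap_apply, (h₁ _).smul]
  exact ⟨h.toLinearMap, fun a b => by
    rw [h.toLinearMap_apply, IsTensorialAt.toLinearMap_apply]⟩

end Tensorial

/-! ### The Dorfman bracket -/

namespace ExactCourantAlgebroid

variable {d : ℕ} {M : Type*} [TopologicalSpace M] [ChartedSpace (EuclideanSpace ℝ (Fin d)) M]
  [IsManifold (𝓡 d) ∞ M] {F : Type*} [NormedAddCommGroup F] [NormedSpace ℝ F]
  {V : M → Type*} [TopologicalSpace (TotalSpace F V)] [∀ x, TopologicalSpace (V x)]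
  [FiberBundle F V] [∀ x, AddCommGroup (V x)] [∀ x, Module ℝ (V x)] [VectorBundle ℝ F V]
  (C : ExactCourantAlgebroid d F V)

/-- The smooth function `⟨a, b⟩`. -/
def pair (a b : Sec d F V) : C^∞⟮𝓡 d, M; ℝ⟯ :=
  ⟨fun x => C.pairing x (a x) (b x), C.pairing_smooth a b⟩

theorem pair_apply (a b : Sec d F V) (x : M) : C.pair a b x = C.pairing x (a x) (b x) := rfl

theorem pair_comm (a b : Sec d F V) : C.pair a b = C.pair b a :=
  ContMDiffMap.ext fun x => C.pairing_symm x _ _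

theorem pair_add_left (a b c : Sec d F V) : C.pair (a + b) c = C.pair a c + C.pair b c :=
  ContMDiffMap.ext fun x => by
    change C.pairing x (a x + b x) (c x) = _
    rw [map_add]
    rfl

theorem pair_add_right (a b c : Sec d F V) : C.pair a (b + c) = C.pair a b + C.pair a c := by
  rw [pair_comm, pair_add_left, pair_comm, C.pair_comm c]

theorem pair_fsmul_right (f : C^∞⟮𝓡 d, M; ℝ⟯) (a b : Sec d F V) :
    C.pair a (fsmul f b) = f * C.pair a b :=
  ContMDiffMap.ext fun x => map_smul (C.pairing x (a x)) _ _

@[simp] theorem anchorSec_apply (a : Sec d F V) (x : M) :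
    C.anchorSec a x = C.anchor x (a x) := rfl

theorem der_pair (a b c : Sec d F V) :
    der (C.anchorSec a) (C.pair b c) = C.pair (C.bracket a b) c + C.pair b (C.bracket a c) :=
  ContMDiffMap.ext fun x => C.pairing_bracket a b c x

/-- Polarisation of the axiom `bracket_self`. -/
theorem pairing_bracket_add_swap (a b c : Sec d F V) (x : M) :
    C.pairing x (C.bracket a b x) (c x) + C.pairing x (C.bracket b a x) (c x) =
      der (C.anchorSec c) (C.pair a b) x := by
  have h : ∀ a : Sec d F V, C.pairing x (C.bracket a a x) (c x) =
      (1 / 2) * der (C.anchorSec c) (C.pair a a) x := fun a => C.bracket_self a c x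
  have h1 := h (a + b)
  rw [pair_add_left, pair_add_right, pair_add_right, der_add, der_add, der_add,
    C.pair_comm b a] at h1
  simp only [map_add, LinearMap.add_apply, sec_add_apply, ContMDiffMap.coe_add, Pi.add_apply,
    h a, h b] at h1
  linarith

theorem pairing_ext {x : M} {v w : V x} (h : ∀ u, C.pairing x v u = C.pairing x w u) : v = w :=
  sub_eq_zero.1 (C.pairing_nondeg x _ fun u => by
    rw [map_sub, LinearMap.sub_apply, h, sub_self])

theorem anchor_bracket_apply (a b : Sec d F V) (x : M) : C.anchor x (C.bracket a b x) =
    VectorField.mlieBracket (𝓡 d) (C.anchorSec a) (C.anchorSec b) x := C.anchor_bracket a b x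

theorem pairing_eq_zero_of_anchor_eq_zero {x : M} {a b : V x} (ha : C.anchor x a = 0)
    (hb : C.anchor x b = 0) : C.pairing x a b = 0 := by
  obtain ⟨ξ, hξ⟩ := (C.anchor_exact x a).1 ha
  rw [hξ, hb, map_zero]

variable [T2Space M] [ContMDiffVectorBundle ∞ F V (𝓡 d)]

theorem sec_ext_of_pair {a b : Sec d F V} (h : ∀ c, C.pair a c = C.pair b c) : a = b :=
  ContMDiffSection.ext fun x => C.pairing_ext fun u => by
    have := congrArg (fun f => f x) (h (ext u))
    simpa [pair_apply] using this

/-- The Dorfman bracket fails to be skew only by the differential of the scalar product. Brackets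
between E_+ and E_- are therefore skew. -/
theorem bracket_swap_of_orthogonal {a b : Sec d F V} (h : C.pair a b = 0) :
    C.bracket a b = - C.bracket b a := by
  refine ContMDiffSection.ext fun x => C.pairing_ext fun u => ?_
  have := C.pairing_bracket_add_swap a b (ext u) x
  have h0 : der (C.anchorSec (ext u : Sec d F V)) (0 : C^∞⟮𝓡 d, M; ℝ⟯) x = 0 := dd_const 0 x _
  rw [h, h0, ext_self] at this
  rw [sec_neg_apply, map_neg, LinearMap.neg_apply]
  linarith

/-- In the invariance identity for ⟨b, c⟩ along a, the derivative vanishes because π a = 0, and ⟨b,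
[a, c]⟩ vanishes because both entries lie in the isotropic kernel of the anchor. -/
theorem bracket_eq_zero_of_anchor_eq_zero {a b : Sec d F V} (ha : C.anchorSec a = 0)
    (hb : C.anchorSec b = 0) : C.bracket a b = 0 := by
  refine C.sec_ext_of_pair fun c => ContMDiffMap.ext fun x => ?_
  have h1 := congrArg (fun f => f x) (C.der_pair a b c)
  have hb' : C.anchor x (b x) = 0 := congrArg (fun Y : VecField d M => Y x) hb
  have h2 : C.anchor x (C.bracket a c x) = 0 := by
    rw [anchor_bracket_apply, ha]
    exact congrFun (VectorField.mlieBracket_zero_left) x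
  have h3 : der (C.anchorSec a) (C.pair b c) x = 0 := by
    rw [ha]
    exact map_zero (mvfderiv (𝓡 d) (C.pair b c) x)
  have h4 : C.pair b (C.bracket a c) x = 0 := C.pairing_eq_zero_of_anchor_eq_zero hb' h2
  have h5 : der (C.anchorSec a) (C.pair b c) x =
    C.pair (C.bracket a b) c x + C.pair b (C.bracket a c) x := h1
  have h6 : C.pair (0 : Sec d F V) c x = 0 := by
    rw [pair_apply]
    change C.pairing x 0 (c x) = 0
    rw [map_zero, LinearMap.zero_apply]
  rw [h6]
  linarith

omit [T2Space M] [ContMDiffVectorBundle ∞ F V (𝓡 d)] in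
theorem bracket_fsmul_right (f : C^∞⟮𝓡 d, M; ℝ⟯) (a b : Sec d F V) :
    C.bracket a (fsmul f b) = fsmul f (C.bracket a b) + fsmul (der (C.anchorSec a) f) b :=
  ContMDiffSection.ext fun x => C.leibniz f a b x

/-- In the Jacobi identity for a, b and f c the terms with one derivative of f cancel, leaving
([a,b]f - a(bf) + b(af)) c = 0. A nonzero value of c at x gives the claim; if the fibre is zero, the
anchor and all three derivatives vanish. -/
theorem der_bracket (a b : Sec d F V) (f : C^∞⟮𝓡 d, M; ℝ⟯) :
    der (C.anchorSec (C.bracket a b)) f =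
      der (C.anchorSec a) (der (C.anchorSec b) f) - der (C.anchorSec b) (der (C.anchorSec a) f) := by
  refine ContMDiffMap.ext fun x => ?_
  by_cases hV : ∃ v : V x, v ≠ 0
  · obtain ⟨v, hv⟩ := hV
    have h := congrArg (fun s : Sec d F V => s x) (C.jacobi a b (fsmul f (ext v)))
    simp only [bracket_fsmul_right, map_add, sec_add_apply, fsmul_apply, ext_self] at h
    have h2 := congrArg (fun s : Sec d F V => s x) (C.jacobi a b (ext v))
    simp only [sec_add_apply] at h2
    rw [h2, smul_add] at h
    have h3 : (der (C.anchorSec (C.bracket a b)) f x - (der (C.anchorSec a) (der (C.anchorSec b) f) x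
      - der (C.anchorSec b) (der (C.anchorSec a) f) x)) • v = 0 := by
      rw [sub_smul, sub_smul, sub_eq_zero]
      linear_combination (norm := module) -h
    have h4 := (smul_eq_zero.1 h3).resolve_right hv
    exact sub_eq_zero.1 h4
  · push Not at hV
    have h0 : ∀ (a : Sec d F V) (f : C^∞⟮𝓡 d, M; ℝ⟯), der (C.anchorSec a) f x = 0 := by
      intro a f
      rw [der_apply, anchorSec_apply, hV (a x), map_zero]
      exact map_zero (mvfderiv (𝓡 d) f x)
    change _ = der (C.anchorSec a) (der (C.anchorSec b) f) x
      - der (C.anchorSec b) (der (C.anchorSec a) f) x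
    rw [h0, h0, h0, sub_zero]

end ExactCourantAlgebroid

theorem neg_sign {t : ℝ} (ht : t = 1 ∨ t = -1) : -t = 1 ∨ -t = -1 := by
  rcases ht with rfl | rfl <;> norm_num

theorem sign_mul_self {t : ℝ} (ht : t = 1 ∨ t = -1) : t * t = 1 := by
  rcases ht with rfl | rfl <;> norm_num

namespace GeneralisedMetric

variable {d : ℕ} {M : Type*} [TopologicalSpace M] [ChartedSpace (EuclideanSpace ℝ (Fin d)) M]
  [IsManifold (𝓡 d) ∞ M] {F : Type*} [NormedAddCommGroup F] [NormedSpace ℝ F]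
  [FiniteDimensional ℝ F] {V : M → Type*} [TopologicalSpace (TotalSpace F V)]
  [∀ x, TopologicalSpace (V x)] [FiberBundle F V] [∀ x, AddCommGroup (V x)]
  [∀ x, Module ℝ (V x)] [VectorBundle ℝ F V]
  {C : ExactCourantAlgebroid d F V} (G : GeneralisedMetric C)

/-! ### The eigenbundles -/

theorem pairing_eq_zero_of_mem_eigen {t : ℝ} (ht : t = 1 ∨ t = -1) {x : M} {a b : V x}
    (ha : a ∈ G.eigen t x) (hb : b ∈ G.eigen (-t) x) : C.pairing x a b = 0 := by
  have h := G.endo_symm x a b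
  rw [G.mem_eigen.1 ha, G.mem_eigen.1 hb, map_smul, map_smul, LinearMap.smul_apply, smul_eq_mul,
    smul_eq_mul] at h
  rcases ht with rfl | rfl <;> linarith

theorem pairing_lift_lift_neg {t : ℝ} (ht : t = 1 ∨ t = -1) (x : M) (u v : TangentSpace (𝓡 d) x) :
    C.pairing x (G.lift ht x u) (G.lift (neg_sign ht) x v) = 0 :=
  G.pairing_eq_zero_of_mem_eigen ht (G.lift_mem ht x u) (G.lift_mem _ x v)

theorem pairing_lift_neg_lift {t : ℝ} (ht : t = 1 ∨ t = -1) (x : M) (u v : TangentSpace (𝓡 d) x) :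
    C.pairing x (G.lift (neg_sign ht) x u) (G.lift ht x v) = 0 := by
  rw [C.pairing_symm, G.pairing_lift_lift_neg ht]

theorem g_apply (x : M) (u v : TangentSpace (𝓡 d) x) :
    G.g x u v = C.pairing x (G.liftPlus x u) (G.liftPlus x v) := rfl

theorem g_symm (x : M) (u v : TangentSpace (𝓡 d) x) : G.g x u v = G.g x v u :=
  C.pairing_symm x _ _

theorem pairing_plus_minus (x : M) (u v : TangentSpace (𝓡 d) x) :
    C.pairing x (G.liftPlus x u) (G.liftMinus x v) = 0 :=
  G.pairing_lift_lift_neg (Or.inl rfl) x u v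

theorem pairing_minus_plus (x : M) (u v : TangentSpace (𝓡 d) x) :
    C.pairing x (G.liftMinus x u) (G.liftPlus x v) = 0 := by
  rw [C.pairing_symm, pairing_plus_minus]

theorem anchor_liftPlus (x : M) (u : TangentSpace (𝓡 d) x) : C.anchor x (G.liftPlus x u) = u :=
  G.anchor_lift _ x u

theorem anchor_liftMinus (x : M) (u : TangentSpace (𝓡 d) x) : C.anchor x (G.liftMinus x u) = u :=
  G.anchor_lift _ x u

/-- The difference of the two lifts of a vector lies in the kernel of the anchor, which is
isotropic; the cross terms vanish because E_+ and E_- are orthogonal. -/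
theorem pairing_minus_minus (x : M) (u v : TangentSpace (𝓡 d) x) :
    C.pairing x (G.liftMinus x u) (G.liftMinus x v) = - G.g x u v := by
  have h := C.pairing_eq_zero_of_anchor_eq_zero (x := x) (a := G.liftPlus x u - G.liftMinus x u)
    (b := G.liftPlus x v - G.liftMinus x v) (by rw [map_sub, anchor_liftPlus, anchor_liftMinus,
      sub_self]) (by rw [map_sub, anchor_liftPlus, anchor_liftMinus, sub_self])
  simp only [map_sub, LinearMap.sub_apply, pairing_plus_minus, pairing_minus_plus, ← g_apply] at h
  linarith

theorem pairing_lift_lift {t : ℝ} (ht : t = 1 ∨ t = -1) (x : M) (u v : TangentSpace (𝓡 d) x) :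
    C.pairing x (G.lift ht x u) (G.lift ht x v) = t * G.g x u v := by
  rcases ht with rfl | rfl
  · rw [one_mul]
    rfl
  · rw [neg_one_mul]
    exact G.pairing_minus_minus x u v

theorem proj_mem {t : ℝ} (ht : t = 1 ∨ t = -1) {x : M} (v : V x) :
    (1 / 2 : ℝ) • (v + t • G.endo x v) ∈ G.eigen t x := by
  rw [mem_eigen, map_smul, map_add, map_smul, G.endo_endo, smul_comm t (1 / 2 : ℝ), smul_add t,
    smul_smul t t, sign_mul_self ht, one_smul, add_comm]

theorem eq_liftPlus_add_liftMinus {x : M} (v : V x) : ∃ u w : TangentSpace (𝓡 d) x,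
    v = G.liftPlus x u + G.liftMinus x w := by
  have h1 := G.lift_anchor (Or.inl rfl) x (G.proj_mem (Or.inl rfl) v)
  have h2 := G.lift_anchor (Or.inr rfl) x (G.proj_mem (Or.inr rfl) v)
  refine ⟨C.anchor x ((1 / 2 : ℝ) • (v + (1 : ℝ) • G.endo x v)),
    C.anchor x ((1 / 2 : ℝ) • (v + (-1 : ℝ) • G.endo x v)), ?_⟩
  change v = G.lift _ x _ + G.lift _ x _
  rw [h1, h2]
  module

theorem g_nondeg (x : M) (u : TangentSpace (𝓡 d) x) (h : ∀ v, G.g x u v = 0) : u = 0 := by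
  have h1 : G.liftPlus x u = 0 := by
    refine C.pairing_nondeg x _ fun b => ?_
    obtain ⟨v, w, rfl⟩ := G.eq_liftPlus_add_liftMinus b
    rw [map_add, pairing_plus_minus, ← g_apply, h, add_zero]
  rw [← G.anchor_liftPlus x u, h1, map_zero]

theorem g_ext {x : M} {u v : TangentSpace (𝓡 d) x} (h : ∀ w, G.g x u w = G.g x v w) : u = v :=
  ext_form (G.g_nondeg x) h

/-- The component of a section in the eigenbundle `E_t`. -/
def projSec (t : ℝ) (a : Sec d F V) : Sec d F V := (1 / 2 : ℝ) • (a + t • G.endoSec a)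

omit [FiniteDimensional ℝ F] in
theorem projSec_apply (t : ℝ) (a : Sec d F V) (x : M) :
    G.projSec t a x = (1 / 2 : ℝ) • (a x + t • G.endo x (a x)) := rfl

theorem pairing_projSec {t : ℝ} (ht : t = 1 ∨ t = -1) (a : Sec d F V) {x : M} {b : V x}
    (hb : b ∈ G.eigen t x) : C.pairing x (G.projSec t a x) b = C.pairing x (a x) b := by
  have h := G.endo_symm x (a x) b
  rw [G.mem_eigen.1 hb, map_smul, smul_eq_mul] at h
  rw [projSec_apply, map_smul, LinearMap.smul_apply, map_add, LinearMap.add_apply, map_smul,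
    LinearMap.smul_apply, h, smul_eq_mul, smul_eq_mul, ← mul_assoc t t, sign_mul_self ht]
  ring

variable [T2Space M] [ContMDiffVectorBundle ∞ F V (𝓡 d)]

/-- The section of `E_t` over a vector field. -/
def liftSec {t : ℝ} (ht : t = 1 ∨ t = -1) (Y : VecField d M) : Sec d F V :=
  ⟨fun x => G.lift ht x (Y x), G.contMDiff_lift ht Y⟩

theorem liftSec_apply {t : ℝ} (ht : t = 1 ∨ t = -1) (Y : VecField d M) (x : M) :
    G.liftSec ht Y x = G.lift ht x (Y x) := rfl

@[simp] theorem anchorSec_liftSec {t : ℝ} (ht : t = 1 ∨ t = -1) (Y : VecField d M) :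
    C.anchorSec (G.liftSec ht Y) = Y :=
  ContMDiffSection.ext fun x => G.anchor_lift ht x _

theorem liftSec_anchorSec {t : ℝ} (ht : t = 1 ∨ t = -1) {a : Sec d F V}
    (ha : ∀ x, a x ∈ G.eigen t x) : G.liftSec ht (C.anchorSec a) = a :=
  ContMDiffSection.ext fun x => G.lift_anchor ht x (ha x)

theorem liftSec_add {t : ℝ} (ht : t = 1 ∨ t = -1) (Y Z : VecField d M) :
    G.liftSec ht (Y + Z) = G.liftSec ht Y + G.liftSec ht Z :=
  ContMDiffSection.ext fun x => map_add (G.lift ht x) _ _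

theorem liftSec_fsmul {t : ℝ} (ht : t = 1 ∨ t = -1) (f : C^∞⟮𝓡 d, M; ℝ⟯) (Y : VecField d M) :
    G.liftSec ht (fsmul f Y) = fsmul f (G.liftSec ht Y) :=
  ContMDiffSection.ext fun x => map_smul (G.lift ht x) _ _

theorem pair_liftSec_neg {t : ℝ} (ht : t = 1 ∨ t = -1) (Y Z : VecField d M) :
    C.pair (G.liftSec (neg_sign ht) Y) (G.liftSec ht Z) = 0 :=
  ContMDiffMap.ext fun x => G.pairing_lift_neg_lift ht x _ _

theorem pair_liftSec_liftSec_neg {t : ℝ} (ht : t = 1 ∨ t = -1) (Y Z : VecField d M) :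
    C.pair (G.liftSec ht Y) (G.liftSec (neg_sign ht) Z) = 0 :=
  ContMDiffMap.ext fun x => G.pairing_lift_lift_neg ht x _ _

/-- The smooth function `g(Y, Z)`. -/
def gfun (Y Z : VecField d M) : C^∞⟮𝓡 d, M; ℝ⟯ :=
  C.pair (G.liftSec (Or.inl rfl) Y) (G.liftSec (Or.inl rfl) Z)

theorem gfun_apply (Y Z : VecField d M) (x : M) : G.gfun Y Z x = G.g x (Y x) (Z x) := rfl

theorem gfun_comm (Y Z : VecField d M) : G.gfun Y Z = G.gfun Z Y := C.pair_comm _ _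

theorem pair_liftSec {t : ℝ} (ht : t = 1 ∨ t = -1) (Y Z : VecField d M) :
    C.pair (G.liftSec ht Y) (G.liftSec ht Z) = t • G.gfun Y Z :=
  ContMDiffMap.ext fun x => G.pairing_lift_lift ht x _ _

/-- The Lie bracket of smooth vector fields. -/
def lieBracket (Y Z : VecField d M) : VecField d M :=
  C.anchorSec (C.bracket (G.liftSec (Or.inl rfl) Y) (G.liftSec (Or.inl rfl) Z))

/-- Defining `lieBracket` by the Dorfman bracket of lifts gives its smoothness and its Jacobi
identity without separate proof; here it is matched with the analytic bracket. -/
theorem lieBracket_apply (Y Z : VecField d M) (x : M) :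
    G.lieBracket Y Z x = VectorField.mlieBracket (𝓡 d) Y Z x := by
  rw [lieBracket, ExactCourantAlgebroid.anchorSec_apply, C.anchor_bracket_apply]
  simp only [anchorSec_liftSec]

theorem anchorSec_bracket (a b : Sec d F V) :
    C.anchorSec (C.bracket a b) = G.lieBracket (C.anchorSec a) (C.anchorSec b) :=
  ContMDiffSection.ext fun x => by
    rw [lieBracket_apply, ExactCourantAlgebroid.anchorSec_apply, C.anchor_bracket_apply]

theorem lieBracket_swap (Y Z : VecField d M) : G.lieBracket Y Z = - G.lieBracket Z Y :=
  ContMDiffSection.ext fun x => by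
    rw [sec_neg_apply, lieBracket_apply, lieBracket_apply, VectorField.mlieBracket_swap_apply]

omit [FiniteDimensional ℝ F] [T2Space M] [ContMDiffVectorBundle ∞ F V (𝓡 d)] in
theorem anchorSec_add (a b : Sec d F V) : C.anchorSec (a + b) = C.anchorSec a + C.anchorSec b :=
  ContMDiffSection.ext fun x => map_add (C.anchor x) _ _

theorem jacobi_lieBracket (X Y Z : VecField d M) :
    G.lieBracket X (G.lieBracket Y Z) =
      G.lieBracket (G.lieBracket X Y) Z + G.lieBracket Y (G.lieBracket X Z) := by
  have h := congrArg C.anchorSec (C.jacobi (G.liftSec (Or.inl rfl) X) (G.liftSec (Or.inl rfl) Y)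
    (G.liftSec (Or.inl rfl) Z))
  simpa only [anchorSec_add, G.anchorSec_bracket, anchorSec_liftSec] using h

theorem der_lieBracket (Y Z : VecField d M) (f : C^∞⟮𝓡 d, M; ℝ⟯) :
    der (G.lieBracket Y Z) f = der Y (der Z f) - der Z (der Y f) := by
  rw [lieBracket, C.der_bracket, anchorSec_liftSec, anchorSec_liftSec]

/-! ### The Bismut connections -/

/-- The connections `∇^±`: `(∇^±_Y Z)` is the image under the anchor of the `E_±`-component of the
bracket of the lift of `Y` to `E_∓` with the lift of `Z` to `E_±`. -/
def bismut {t : ℝ} (ht : t = 1 ∨ t = -1) (Y Z : VecField d M) : VecField d M :=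
  C.anchorSec (G.projSec t (C.bracket (G.liftSec (neg_sign ht) Y) (G.liftSec ht Z)))

theorem lift_bismut {t : ℝ} (ht : t = 1 ∨ t = -1) (Y Z : VecField d M) :
    G.liftSec ht (G.bismut ht Y Z) =
      G.projSec t (C.bracket (G.liftSec (neg_sign ht) Y) (G.liftSec ht Z)) :=
  G.liftSec_anchorSec ht fun _ => G.proj_mem ht _

theorem gfun_bismut {t : ℝ} (ht : t = 1 ∨ t = -1) (Y Z W : VecField d M) :
    C.pair (C.bracket (G.liftSec (neg_sign ht) Y) (G.liftSec ht Z)) (G.liftSec ht W) =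
      t • G.gfun (G.bismut ht Y Z) W := by
  rw [← G.pair_liftSec ht, lift_bismut]
  exact ContMDiffMap.ext fun x => (G.pairing_projSec ht _ (G.lift_mem ht x _)).symm

theorem gfun_bismut_neg {t : ℝ} (ht : t = 1 ∨ t = -1) (Y Z W : VecField d M) :
    C.pair (C.bracket (G.liftSec ht Y) (G.liftSec (neg_sign ht) Z)) (G.liftSec (neg_sign ht) W) =
      -t • G.gfun (G.bismut (neg_sign ht) Y Z) W := by
  -- With t' in place of -t one can substitute t = -t' and apply `gfun_bismut` directly; otherwise a
  -- lift with sign -(-t) would appear in place of sign t.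
  have key : ∀ (t' : ℝ) (ht' : t' = 1 ∨ t' = -1), t = -t' →
      C.pair (C.bracket (G.liftSec ht Y) (G.liftSec ht' Z)) (G.liftSec ht' W) =
        t' • G.gfun (G.bismut ht' Y Z) W := by
    rintro t' ht' rfl
    exact G.gfun_bismut ht' Y Z W
  exact key (-t) _ (neg_neg t).symm

theorem sec_ext_of_gfun {Y Z : VecField d M} (h : ∀ W, G.gfun Y W = G.gfun Z W) : Y = Z :=
  ContMDiffSection.ext fun x => G.g_ext fun w => by
    have := congrArg (fun f => f x) (h (ext w))
    simpa [gfun_apply] using this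

end GeneralisedMetric

namespace GeneralisedMetric

variable {d : ℕ} {M : Type*} [TopologicalSpace M] [ChartedSpace (EuclideanSpace ℝ (Fin d)) M]
  [IsManifold (𝓡 d) ∞ M] {F : Type*} [NormedAddCommGroup F] [NormedSpace ℝ F]
  [FiniteDimensional ℝ F] {V : M → Type*} [TopologicalSpace (TotalSpace F V)]
  [∀ x, TopologicalSpace (V x)] [FiberBundle F V] [∀ x, AddCommGroup (V x)]
  [∀ x, Module ℝ (V x)] [VectorBundle ℝ F V]
  {C : ExactCourantAlgebroid d F V} (G : GeneralisedMetric C)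
  [T2Space M] [ContMDiffVectorBundle ∞ F V (𝓡 d)]

theorem gfun_add_left (Y Y' Z : VecField d M) : G.gfun (Y + Y') Z = G.gfun Y Z + G.gfun Y' Z :=
  ContMDiffMap.ext fun x => by
    change G.g x (Y x + Y' x) (Z x) = _
    rw [map_add]
    rfl

theorem gfun_fsmul_left (f : C^∞⟮𝓡 d, M; ℝ⟯) (Y Z : VecField d M) :
    G.gfun (fsmul f Y) Z = f * G.gfun Y Z :=
  ContMDiffMap.ext fun x => by
    change G.g x (f x • Y x) (Z x) = _
    rw [map_smul]
    rfl

theorem sec_ext_of_smul_gfun {t : ℝ} (ht : t = 1 ∨ t = -1) {Y Z : VecField d M}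
    (h : ∀ W, t • G.gfun Y W = t • G.gfun Z W) : Y = Z :=
  G.sec_ext_of_gfun fun W => by
    have := congrArg (fun f => t • f) (h W)
    simpa only [smul_smul, sign_mul_self ht, one_smul] using this

/-! ### Metric connections on the tangent bundle -/

/-- A connection on the tangent bundle for which `g` is parallel. -/
structure IsMetricConnection (N : VecField d M → VecField d M → VecField d M) : Prop where
  add_left : ∀ Y Y' Z, N (Y + Y') Z = N Y Z + N Y' Z
  smul_left : ∀ (f : C^∞⟮𝓡 d, M; ℝ⟯) Y Z, N (fsmul f Y) Z = fsmul f (N Y Z)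
  metric : ∀ Y Z W, der Y (G.gfun Z W) = G.gfun (N Y Z) W + G.gfun Z (N Y W)

namespace IsMetricConnection

variable {G} {N : VecField d M → VecField d M → VecField d M}

/-- Additivity and the Leibniz rule in the differentiated argument need not be axioms: nondegeneracy
of g and the metric identity, tested against all W, force them. -/
theorem add_right (h : G.IsMetricConnection N) (Y Z Z' : VecField d M) :
    N Y (Z + Z') = N Y Z + N Y Z' :=
  G.sec_ext_of_gfun fun W => by
    have h1 := h.metric Y (Z + Z') W
    rw [gfun_add_left, gfun_add_left, der_add, h.metric, h.metric] at h1
    rw [gfun_add_left]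
    linear_combination -h1

theorem leibniz (h : G.IsMetricConnection N) (f : C^∞⟮𝓡 d, M; ℝ⟯) (Y Z : VecField d M) :
    N Y (fsmul f Z) = fsmul f (N Y Z) + fsmul (der Y f) Z :=
  G.sec_ext_of_gfun fun W => by
    have h1 := h.metric Y (fsmul f Z) W
    rw [gfun_fsmul_left, gfun_fsmul_left, der_mul, h.metric] at h1
    rw [gfun_add_left, gfun_fsmul_left, gfun_fsmul_left]
    linear_combination -h1

end IsMetricConnection

theorem liftSec_congr {t t' : ℝ} (h : t = t') (ht : t = 1 ∨ t = -1) (ht' : t' = 1 ∨ t' = -1)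
    (Y : VecField d M) : G.liftSec ht Y = G.liftSec ht' Y := by
  subst h
  rfl

omit [FiniteDimensional ℝ F] [T2Space M] [ContMDiffVectorBundle ∞ F V (𝓡 d)] in
theorem projSec_add_projSec_neg (t : ℝ) (a : Sec d F V) :
    G.projSec t a + G.projSec (-t) a = a :=
  ContMDiffSection.ext fun x => by
    rw [sec_add_apply, projSec_apply, projSec_apply]
    module

omit [FiniteDimensional ℝ F] [T2Space M] [ContMDiffVectorBundle ∞ F V (𝓡 d)] in
theorem projSec_neg (t : ℝ) (a : Sec d F V) : G.projSec t (-a) = - G.projSec t a :=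
  ContMDiffSection.ext fun x => by
    rw [sec_neg_apply, projSec_apply, projSec_apply, sec_neg_apply, map_neg]
    module

omit [FiniteDimensional ℝ F] [T2Space M] [ContMDiffVectorBundle ∞ F V (𝓡 d)] in
theorem anchorSec_neg (a : Sec d F V) : C.anchorSec (-a) = - C.anchorSec a :=
  ContMDiffSection.ext fun x => map_neg (C.anchor x) _

/-- The mixed torsion of the two Bismut connections vanishes. -/
theorem bismut_sub_bismut_neg {t : ℝ} (ht : t = 1 ∨ t = -1) (Y Z : VecField d M) :
    G.bismut ht Y Z - G.bismut (neg_sign ht) Z Y = G.lieBracket Y Z := by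
  have h1 : G.lieBracket Y Z =
      C.anchorSec (C.bracket (G.liftSec (neg_sign ht) Y) (G.liftSec ht Z)) := by
    rw [anchorSec_bracket, anchorSec_liftSec, anchorSec_liftSec]
  have h2 := C.bracket_swap_of_orthogonal (G.pair_liftSec_neg ht Y Z)
  -- The two components of [Y_{-t}, Z_t] are treated separately: the E_t-part is ∇^t_Y Z, and the
  -- E_{-t}-part is, after swapping the bracket, minus ∇^{-t}_Z Y.
  rw [h1, ← G.projSec_add_projSec_neg t (C.bracket _ _), anchorSec_add]
  conv_rhs => rw [h2]
  rw [projSec_neg (G := G) (-t), anchorSec_neg, ← sub_eq_add_neg, ← h2]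
  rw [bismut, bismut, G.liftSec_congr (neg_neg t) _ ht]

/-- Linearity over functions in Y holds because the mixed bracket can be swapped: the derivative of
f then multiplies Y_{-t}, which is orthogonal to E_t. Metricity is invariance of the scalar product
under the bracket. -/
theorem isMetricConnection_bismut {t : ℝ} (ht : t = 1 ∨ t = -1) :
    G.IsMetricConnection (G.bismut ht) where
  add_left Y Y' Z := G.sec_ext_of_smul_gfun ht fun W => by
    rw [gfun_add_left, smul_add, ← gfun_bismut, ← gfun_bismut, ← gfun_bismut, liftSec_add, map_add,
      LinearMap.add_apply, C.pair_add_left]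
  smul_left f Y Z := G.sec_ext_of_smul_gfun ht fun W => by
    rw [gfun_fsmul_left, ← mul_smul_comm, ← gfun_bismut, ← gfun_bismut, liftSec_fsmul]
    have h1 : C.pair (fsmul f (G.liftSec (neg_sign ht) Y)) (G.liftSec ht Z) = 0 := by
      rw [C.pair_comm, C.pair_fsmul_right, C.pair_comm, pair_liftSec_neg, mul_zero]
    rw [C.bracket_swap_of_orthogonal h1, C.bracket_fsmul_right,
      C.bracket_swap_of_orthogonal (G.pair_liftSec_neg ht Y Z)]
    refine ContMDiffMap.ext fun x => ?_
    have h2 := G.pairing_lift_neg_lift ht x (Y x) (W x)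
    simp only [C.pair_apply, ContMDiffMap.coe_mul, Pi.mul_apply, sec_neg_apply, sec_add_apply,
      fsmul_apply, map_neg, map_add, map_smul, LinearMap.neg_apply, LinearMap.add_apply,
      LinearMap.smul_apply, smul_eq_mul, liftSec_apply, h2]
    ring
  metric Y Z W := by
    have h1 := C.der_pair (G.liftSec (neg_sign ht) Y) (G.liftSec ht Z) (G.liftSec ht W)
    rw [anchorSec_liftSec, pair_liftSec, der_smul, gfun_bismut, C.pair_comm (G.liftSec ht Z),
      gfun_bismut] at h1
    have h2 := congrArg (fun f => t • f) h1
    simp only [smul_add, smul_smul, sign_mul_self ht, one_smul] at h2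
    rw [h2, G.gfun_comm Z]

/-! ### The Levi-Civita connection and the three-form -/

/-- The difference `∇^+ - ∇^-` of the Bismut connections, i.e. `g⁻¹H`. -/
def torsionTensor (Y Z : VecField d M) : VecField d M :=
  G.bismut (t := 1) (Or.inl rfl) Y Z - G.bismut (t := -1) (Or.inr rfl) Y Z

/-- The mean of the Bismut connections. -/
def leviCivita (Y Z : VecField d M) : VecField d M :=
  (1 / 2 : ℝ) • (G.bismut (t := 1) (Or.inl rfl) Y Z + G.bismut (t := -1) (Or.inr rfl) Y Z)

theorem bismut_apply {t : ℝ} (ht : t = 1 ∨ t = -1) (Y Z : VecField d M) (x : M) :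
    G.bismut ht Y Z x = G.leviCivita Y Z x + (t / 2) • G.torsionTensor Y Z x := by
  rw [leviCivita, torsionTensor, sec_smul_apply, sec_add_apply, sec_sub_apply]
  rcases ht with rfl | rfl <;> module

theorem gfun_leviCivita (Y Z W : VecField d M) : G.gfun (G.leviCivita Y Z) W = (1 / 2 : ℝ) •
    (G.gfun (G.bismut (t := 1) (Or.inl rfl) Y Z) W +
      G.gfun (G.bismut (t := -1) (Or.inr rfl) Y Z) W) := by
  refine ContMDiffMap.ext fun x => ?_
  rw [gfun_apply, leviCivita, sec_smul_apply, map_smul, sec_add_apply, map_add]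
  rfl

theorem gfun_torsionTensor (Y Z W : VecField d M) : G.gfun (G.torsionTensor Y Z) W =
    G.gfun (G.bismut (t := 1) (Or.inl rfl) Y Z) W -
      G.gfun (G.bismut (t := -1) (Or.inr rfl) Y Z) W := by
  refine ContMDiffMap.ext fun x => ?_
  rw [gfun_apply, torsionTensor, sec_sub_apply, map_sub]
  rfl

theorem isMetricConnection_leviCivita : G.IsMetricConnection G.leviCivita where
  add_left Y Y' Z := by
    simp only [leviCivita, (G.isMetricConnection_bismut _).add_left]
    module
  smul_left f Y Z := ContMDiffSection.ext fun x => by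
    simp only [leviCivita, (G.isMetricConnection_bismut _).smul_left, sec_smul_apply,
      sec_add_apply, fsmul_apply]
    module
  metric Y Z W := by
    have h1 := (G.isMetricConnection_bismut (t := 1) (Or.inl rfl)).metric Y Z W
    have h2 := (G.isMetricConnection_bismut (t := -1) (Or.inr rfl)).metric Y Z W
    rw [gfun_leviCivita, G.gfun_comm Z (G.leviCivita Y W), gfun_leviCivita, G.gfun_comm _ Z, G.gfun_comm _ Z]
    refine ContMDiffMap.ext fun x => ?_
    have h1' := congrArg (fun f => f x) h1
    have h2' := congrArg (fun f => f x) h2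
    simp only [ContMDiffMap.coe_add, ContMDiffMap.coe_smul, Pi.add_apply, Pi.smul_apply,
      smul_eq_mul] at h1' h2' ⊢
    linarith

/-- Compare the mixed torsion identity for (Y, Z) and (Z, Y) and use skewness of the Lie bracket. -/
theorem torsionTensor_swap (Y Z : VecField d M) :
    G.torsionTensor Y Z = - G.torsionTensor Z Y := by
  have h1 := G.bismut_sub_bismut_neg (t := 1) (Or.inl rfl) Y Z
  have h2 := G.bismut_sub_bismut_neg (t := 1) (Or.inl rfl) Z Y
  rw [G.lieBracket_swap, ← h1] at h2
  rw [torsionTensor, torsionTensor]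
  rw [← sub_eq_zero] at h2 ⊢
  rw [← h2]
  abel

theorem leviCivita_sub_swap (Y Z : VecField d M) :
    G.leviCivita Y Z - G.leviCivita Z Y = G.lieBracket Y Z := by
  have h1 := G.bismut_sub_bismut_neg (t := 1) (Or.inl rfl) Y Z
  have h2 := G.bismut_sub_bismut_neg (t := 1) (Or.inl rfl) Z Y
  rw [G.lieBracket_swap] at h2
  rw [leviCivita, leviCivita]
  linear_combination (norm := module) (1 / 2 : ℝ) • h1 - (1 / 2 : ℝ) • h2

/-- A difference of two metric connections is skew in its last two arguments. Together with
`torsionTensor_swap` this makes g(T(Y, Z), W) totally skew. -/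
theorem gfun_torsionTensor_swap (Y Z W : VecField d M) :
    G.gfun (G.torsionTensor Y Z) W = - G.gfun (G.torsionTensor Y W) Z := by
  have h1 := (G.isMetricConnection_bismut (t := 1) (Or.inl rfl)).metric Y Z W
  have h2 := (G.isMetricConnection_bismut (t := -1) (Or.inr rfl)).metric Y Z W
  rw [gfun_torsionTensor, gfun_torsionTensor]
  rw [G.gfun_comm Z (G.bismut _ Y W)] at h1 h2
  linear_combination h2 - h1

theorem torsionTensor_add_left (Y Y' Z : VecField d M) :
    G.torsionTensor (Y + Y') Z = G.torsionTensor Y Z + G.torsionTensor Y' Z := by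
  simp only [torsionTensor, (G.isMetricConnection_bismut _).add_left]
  abel

theorem torsionTensor_fsmul_left (f : C^∞⟮𝓡 d, M; ℝ⟯) (Y Z : VecField d M) :
    G.torsionTensor (fsmul f Y) Z = fsmul f (G.torsionTensor Y Z) :=
  ContMDiffSection.ext fun x => by
    simp only [torsionTensor, (G.isMetricConnection_bismut _).smul_left, sec_sub_apply,
      fsmul_apply, smul_sub]

theorem torsionTensor_add_right (Y Z Z' : VecField d M) :
    G.torsionTensor Y (Z + Z') = G.torsionTensor Y Z + G.torsionTensor Y Z' := by
  rw [torsionTensor_swap, torsionTensor_add_left, torsionTensor_swap, G.torsionTensor_swap Z']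
  abel

theorem torsionTensor_fsmul_right (f : C^∞⟮𝓡 d, M; ℝ⟯) (Y Z : VecField d M) :
    G.torsionTensor Y (fsmul f Z) = fsmul f (G.torsionTensor Y Z) := by
  rw [torsionTensor_swap, torsionTensor_fsmul_left, G.torsionTensor_swap Y]
  exact ContMDiffSection.ext fun x => by simp

theorem exists_torsion_bilinear (x : M) :
    ∃ T : TangentSpace (𝓡 d) x →ₗ[ℝ] TangentSpace (𝓡 d) x →ₗ[ℝ] TangentSpace (𝓡 d) x,
      ∀ Y Z : VecField d M, T (Y x) (Z x) = G.torsionTensor Y Z x :=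
  exists_bilinear_of_tensorial (Φ := fun Y Z : VecField d M => G.torsionTensor Y Z x)
    (fun Z => ⟨fun Y Y' => by rw [torsionTensor_add_left]; rfl,
      fun f Y => by rw [torsionTensor_fsmul_left]; rfl⟩)
    (fun Y => ⟨fun Z Z' => by rw [torsionTensor_add_right]; rfl,
      fun f Z => by rw [torsionTensor_fsmul_right]; rfl⟩)

/-- The tensor `g⁻¹H` at a point. -/
def torsionAt (x : M) :
    TangentSpace (𝓡 d) x →ₗ[ℝ] TangentSpace (𝓡 d) x →ₗ[ℝ] TangentSpace (𝓡 d) x :=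
  (G.exists_torsion_bilinear x).choose

theorem torsionAt_apply (x : M) (Y Z : VecField d M) :
    G.torsionAt x (Y x) (Z x) = G.torsionTensor Y Z x :=
  (G.exists_torsion_bilinear x).choose_spec Y Z

theorem torsionAt_swap (x : M) (u v : TangentSpace (𝓡 d) x) :
    G.torsionAt x u v = - G.torsionAt x v u := by
  rw [← ext_self (d := d) (F := EuclideanSpace ℝ (Fin d)) u,
    ← ext_self (d := d) (F := EuclideanSpace ℝ (Fin d)) v, torsionAt_apply, torsionAt_apply,
    torsionTensor_swap]
  rfl

theorem g_torsionAt_swap (x : M) (u v w : TangentSpace (𝓡 d) x) :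
    G.g x (G.torsionAt x u v) w = - G.g x (G.torsionAt x u w) v := by
  rw [← ext_self (d := d) (F := EuclideanSpace ℝ (Fin d)) u,
    ← ext_self (d := d) (F := EuclideanSpace ℝ (Fin d)) v,
    ← ext_self (d := d) (F := EuclideanSpace ℝ (Fin d)) w, torsionAt_apply, torsionAt_apply]
  exact congrArg (fun f => f x) (G.gfun_torsionTensor_swap (ext u) (ext v) (ext w))

/-- Identifies the three-form of the splitting with the difference of the Bismut connections.
Expanding σ = (P + Q)/2, with P and Q the lifts to E_+ and E_-, gives eight pairings; those
involving both eigenbundles reduce to Bismut terms. -/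
theorem H_ext_apply (x : M) (Y Z W : VecField d M) :
    2 * C.pairing x (C.bracket (G.splittingSec Y) (G.splittingSec Z) x) (G.splitting x (W x)) =
      G.gfun (G.torsionTensor Y Z) W x := by
  let P : VecField d M → Sec d F V := G.liftSec (t := 1) (Or.inl rfl)
  let Q : VecField d M → Sec d F V := G.liftSec (t := -1) (Or.inr rfl)
  let bp := G.bismut (t := 1) (Or.inl rfl)
  let bm := G.bismut (t := -1) (Or.inr rfl)
  have f1 : ∀ Y Z W, C.pair (C.bracket (Q Y) (P Z)) (P W) = G.gfun (bp Y Z) W := fun Y Z W => by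
    have := G.gfun_bismut (t := 1) (Or.inl rfl) Y Z W
    rwa [one_smul] at this
  have f2 : ∀ Y Z W, C.pair (C.bracket (P Y) (Q Z)) (Q W) = - G.gfun (bm Y Z) W := fun Y Z W => by
    have := G.gfun_bismut_neg (t := 1) (Or.inl rfl) Y Z W
    rwa [neg_one_smul] at this
  have f3 : ∀ Y Z, C.bracket (P Y) (Q Z) = - C.bracket (Q Z) (P Y) := fun Y Z =>
    C.bracket_swap_of_orthogonal (G.pair_liftSec_liftSec_neg (t := 1) (Or.inl rfl) Y Z)
  have hneg : ∀ a b : Sec d F V, C.pair (-a) b = - C.pair a b := fun a b =>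
    ContMDiffMap.ext fun x => by
      rw [C.pair_apply, sec_neg_apply, map_neg]
      rfl
  have hder : ∀ Y : VecField d M, der Y 0 = 0 := fun Y => ContMDiffMap.ext fun x => dd_const 0 x _
  have f4 : ∀ Y Z W, C.pair (C.bracket (Q Y) (Q Z)) (P W) = - G.gfun (bm W Y) Z := fun Y Z W => by
    have h := C.der_pair (Q Y) (Q Z) (P W)
    rw [show C.pair (Q Z) (P W) = 0 from G.pair_liftSec_neg (t := 1) (Or.inl rfl) Z W, hder,
      C.pair_comm (Q Z)] at h
    have h1 := f2 W Y Z
    rw [f3, hneg] at h1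
    linear_combination h1 - h
  have f5 : ∀ Y Z W, C.pair (C.bracket (P Y) (P Z)) (Q W) = G.gfun (bp W Y) Z := fun Y Z W => by
    have h := C.der_pair (P Y) (P Z) (Q W)
    rw [show C.pair (P Z) (Q W) = 0 from
      G.pair_liftSec_liftSec_neg (t := 1) (Or.inl rfl) Z W, hder, C.pair_comm (P Z), f3, hneg,
      f1] at h
    linear_combination -h
  -- The pure pairings ⟨[P,P],P⟩ and ⟨[Q,Q],Q⟩ are not Bismut terms. Since P - Q takes values in the
  -- kernel of the anchor, this bracket vanishes, and pairing it with P W and Q W expresses them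
  -- through the mixed ones.
  have f6 : C.bracket (P Y - Q Y) (P Z - Q Z) = 0 := by
    have : ∀ Y, C.anchorSec (P Y - Q Y) = 0 := fun Y => by
      rw [sub_eq_add_neg, anchorSec_add, anchorSec_neg, anchorSec_liftSec, anchorSec_liftSec,
        add_neg_cancel]
    exact C.bracket_eq_zero_of_anchor_eq_zero (this Y) (this Z)
  have hs : ∀ Y, G.splittingSec Y = (1 / 2 : ℝ) • (P Y + Q Y) := fun Y => rfl
  have hw : G.splitting x (W x) = (1 / 2 : ℝ) • (P W x + Q W x) := rfl
  have g1 := f1 Y Z W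
  have g2 := f1 Z Y W
  have g3 := f2 Y Z W
  have g4 := f2 Z Y W
  have g5 := f4 Y Z W
  have g6 := f5 Y Z W
  have s1 := f3 Y Z
  have s2 := f3 Z Y
  have k1 := G.gfun_torsionTensor Y Z W
  have k2 := G.gfun_torsionTensor Z Y W
  have k3 := G.gfun_torsionTensor W Y Z
  have k4 : G.gfun (G.torsionTensor Z Y) W = - G.gfun (G.torsionTensor Y Z) W := by
    rw [G.torsionTensor_swap Z Y]
    exact ContMDiffMap.ext fun x => by
      rw [gfun_apply, sec_neg_apply, map_neg]
      rfl
  have k5 : G.gfun (G.torsionTensor W Y) Z = G.gfun (G.torsionTensor Y Z) W := by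
    rw [G.torsionTensor_swap W Y, G.gfun_torsionTensor_swap Y Z W]
    exact ContMDiffMap.ext fun x => by
      rw [gfun_apply, sec_neg_apply, map_neg]
      rfl
  simp only [map_sub, LinearMap.sub_apply] at f6
  have f7 := congrArg (fun a => C.pair a (P W) x) f6
  have f8 := congrArg (fun a => C.pair a (Q W) x) f6
  have hz : ∀ a : Sec d F V, C.pair 0 a x = 0 := fun a => by
    change C.pairing x 0 (a x) = 0
    rw [map_zero, LinearMap.zero_apply]
  simp only [hz, C.pair_apply, sec_sub_apply, map_sub, LinearMap.sub_apply] at f7 f8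
  rw [s1] at g3 f7 f8
  have ev : ∀ {f g : C^∞⟮𝓡 d, M; ℝ⟯}, f = g → f x = g x := fun h => by rw [h]
  replace g1 := ev g1; replace g2 := ev g2; replace g3 := ev g3; replace g4 := ev g4
  replace g5 := ev g5; replace g6 := ev g6
  replace k1 := ev k1; replace k2 := ev k2; replace k3 := ev k3; replace k4 := ev k4
  replace k5 := ev k5
  rw [s2] at g4
  rw [hs, hs, hw]
  simp only [map_smul, map_add, LinearMap.smul_apply, LinearMap.add_apply, sec_smul_apply,
    sec_add_apply, sec_neg_apply, map_neg, LinearMap.neg_apply, smul_eq_mul, s1, C.pair_apply,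
    ContMDiffMap.coe_neg, Pi.neg_apply, ContMDiffMap.coe_sub, Pi.sub_apply] at *
  linarith

theorem H_apply (x : M) (u v w : TangentSpace (𝓡 d) x) :
    G.H x u v w = G.g x (G.torsionAt x u v) w := by
  have h := G.H_ext_apply x (ext u) (ext v) (ext w)
  rw [gfun_apply, ← torsionAt_apply, ext_self, ext_self, ext_self] at h
  exact h

/-- Koszul's computation, valid because `leviCivita` is metric and torsion-free. -/
theorem koszul_eq (X Y Z : VecField d M) (x : M) :
    G.koszul X Y Z x = 2 * G.g x (G.leviCivita X Y x) (Z x) := by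
  have m := G.isMetricConnection_leviCivita
  have h1 := congrArg (fun f => f x) (m.metric X Y Z)
  have h2 := congrArg (fun f => f x) (m.metric Y X Z)
  have h3 := congrArg (fun f => f x) (m.metric Z X Y)
  have e1 : G.koszul X Y Z x = der X (G.gfun Y Z) x + der Y (G.gfun X Z) x - der Z (G.gfun X Y) x
      + G.g x (G.lieBracket X Y x) (Z x) - G.g x (G.lieBracket X Z x) (Y x)
      - G.g x (G.lieBracket Y Z x) (X x) := by
    rw [lieBracket_apply, lieBracket_apply, lieBracket_apply]
    rfl
  rw [e1, ← leviCivita_sub_swap, ← leviCivita_sub_swap, ← leviCivita_sub_swap]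
  simp only [ContMDiffMap.coe_add, Pi.add_apply, gfun_apply] at h1 h2 h3
  rw [h1, h2, h3]
  simp only [sec_sub_apply, map_sub, LinearMap.sub_apply]
  rw [G.g_symm x (X x) (G.leviCivita Y Z x), G.g_symm x (Y x) (G.leviCivita X Z x),
    G.g_symm x (X x) (G.leviCivita Z Y x)]
  ring

theorem nabla_eq (X Y : VecField d M) : G.nabla X Y = G.leviCivita X Y :=
  funext fun x => sharp_eq (G.g_nondeg x) fun w => by
    rw [koszul_eq, ext_self]
    ring

end GeneralisedMetric

/-! ### Endomorphisms of the tangent bundle -/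

/-- A smooth endomorphism of the tangent bundle, as an operation on vector fields. -/
structure TangentEndo (d : ℕ) (M : Type*) [TopologicalSpace M]
    [ChartedSpace (EuclideanSpace ℝ (Fin d)) M] [IsManifold (𝓡 d) ∞ M] where
  toFun : VecField d M → VecField d M
  map_add : ∀ Y Z, toFun (Y + Z) = toFun Y + toFun Z
  map_fsmul : ∀ (f : C^∞⟮𝓡 d, M; ℝ⟯) Y, toFun (fsmul f Y) = fsmul f (toFun Y)

namespace TangentEndo

variable {d : ℕ} {M : Type*} [TopologicalSpace M] [ChartedSpace (EuclideanSpace ℝ (Fin d)) M]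
  [IsManifold (𝓡 d) ∞ M] (Θ : TangentEndo d M)

theorem tensorial (x : M) : IsTensorialAt x fun Y => Θ.toFun Y x :=
  ⟨fun Y Z => by rw [Θ.map_add, sec_add_apply], fun f Y => by rw [Θ.map_fsmul, fsmul_apply]⟩

variable [T2Space M]

/-- The value of an endomorphism of the tangent bundle at a point. -/
def atPoint (x : M) : TangentSpace (𝓡 d) x →ₗ[ℝ] TangentSpace (𝓡 d) x :=
  (Θ.tensorial x).toLinearMap

theorem atPoint_apply (x : M) (Y : VecField d M) : Θ.atPoint x (Y x) = Θ.toFun Y x :=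
  (Θ.tensorial x).toLinearMap_apply Y

end TangentEndo

theorem sum_function_apply {d : ℕ} {M : Type*} [TopologicalSpace M]
    [ChartedSpace (EuclideanSpace ℝ (Fin d)) M] {ι : Type*} (s : Finset ι)
    (f : ι → C^∞⟮𝓡 d, M; ℝ⟯) (x : M) : (∑ i ∈ s, f i) x = ∑ i ∈ s, f i x :=
  map_sum (⟨⟨fun g : C^∞⟮𝓡 d, M; ℝ⟯ => g x, rfl⟩, fun _ _ => rfl⟩ : C^∞⟮𝓡 d, M; ℝ⟯ →+ ℝ) f s

theorem linearMap_ext_of_sections {d : ℕ} {M : Type*} [TopologicalSpace M]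
    [ChartedSpace (EuclideanSpace ℝ (Fin d)) M] [IsManifold (𝓡 d) ∞ M] [T2Space M] {x : M}
    {A : Type*} [AddCommGroup A] [Module ℝ A] {L L' : TangentSpace (𝓡 d) x →ₗ[ℝ] A}
    (h : ∀ Y : VecField d M, L (Y x) = L' (Y x)) : L = L' := by
  ext v
  rw [← ext_self (d := d) (F := EuclideanSpace ℝ (Fin d)) v, h]

namespace GeneralisedMetric

variable {d : ℕ} {M : Type*} [TopologicalSpace M] [ChartedSpace (EuclideanSpace ℝ (Fin d)) M]
  [IsManifold (𝓡 d) ∞ M] {F : Type*} [NormedAddCommGroup F] [NormedSpace ℝ F]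
  [FiniteDimensional ℝ F] {V : M → Type*} [TopologicalSpace (TotalSpace F V)]
  [∀ x, TopologicalSpace (V x)] [FiberBundle F V] [∀ x, AddCommGroup (V x)]
  [∀ x, Module ℝ (V x)] [VectorBundle ℝ F V]
  {C : ExactCourantAlgebroid d F V} (G : GeneralisedMetric C)
  [T2Space M] [ContMDiffVectorBundle ∞ F V (𝓡 d)]

/-! ### Dual frames -/

/-- The dual frame comes from the inverse Gram matrix, so no orthonormalisation is needed and any
signature is allowed. Duality on a whole neighbourhood, not only at x, is what permits
differentiating traces. -/
theorem exists_dual_frames (x : M) : ∃ e e' : Fin d → VecField d M,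
    ∀ᶠ y in 𝓝 x, ∀ i j, G.g y (e i y) (e' j y) = if i = j then 1 else 0 := by
  let τ := trivializationAt (EuclideanSpace ℝ (Fin d)) (TangentSpace (𝓡 d) : M → Type) x
  have hx : x ∈ τ.baseSet := FiberBundle.mem_baseSet_trivializationAt' x
  let bs := (EuclideanSpace.basisFun (Fin d) ℝ).toBasis
  have h1 : ∀ i, ∃ S : VecField d M, ∀ᶠ y in 𝓝 x, S y = τ.localFrame bs i y := fun i =>
    exists_section_eventuallyEq τ.open_baseSet hx
      (τ.contMDiffOn_localFrame_baseSet (I := 𝓡 d) ∞ bs i)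
  choose e he using h1
  let A : M → Matrix (Fin d) (Fin d) ℝ := fun y => Matrix.of fun i j => G.gfun (e i) (e j) y
  have hA : ∀ y i j, ContMDiffAt (𝓡 d) 𝓘(ℝ, ℝ) ∞ (fun y => A y i j) y := fun y i j =>
    (G.gfun (e i) (e j)).contMDiff y
  have hdet : (A x).det ≠ 0 := by
    intro h
    obtain ⟨v, hv, hv0⟩ := Matrix.exists_vecMul_eq_zero_iff.2 h
    have hb : ∀ i, e i x = τ.basisAt bs hx i := fun i => by
      rw [(he i).self_of_nhds, τ.localFrame_apply_of_mem_baseSet bs hx]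
    have h2 : ∑ i, v i • e i x = 0 := by
      refine G.g_nondeg x _ fun w => ?_
      have h3 : G.g x (∑ i, v i • e i x) = 0 := by
        refine (τ.basisAt bs hx).ext fun j => ?_
        have := congrFun hv0 j
        rw [← hb]
        simpa [Matrix.vecMul, dotProduct, A, gfun_apply] using this
      rw [h3, LinearMap.zero_apply]
    simp only [hb] at h2
    exact hv (funext fun i =>
      Fintype.linearIndependent_iff.1 (τ.basisAt bs hx).linearIndependent v h2 i)
  have hne : ∀ᶠ y in 𝓝 x, (A y).det ≠ 0 :=
    (contMDiffAt_det (hA x)).continuousAt.eventually_ne hdet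
  have h2 : ∀ i j, ∃ f : C^∞⟮𝓡 d, M; ℝ⟯, ∀ᶠ y in 𝓝 x, f y = (A y)⁻¹ i j := fun i j =>
    exists_function_eventuallyEq (by
      filter_upwards [hne] with y hy
      exact contMDiffAt_matrix_inv (hA y) hy i j)
  choose f hf using h2
  refine ⟨e, fun j => ∑ k, fsmul (f k j) (e k), ?_⟩
  filter_upwards [hne, Filter.eventually_all.2 fun i => Filter.eventually_all.2 (hf i)]
    with y hy hfy i j
  have h3 := congrFun (congrFun (Matrix.mul_nonsing_inv (A y) (isUnit_iff_ne_zero.2 hy)) i) j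
  rw [Matrix.mul_apply, Matrix.one_apply] at h3
  rw [← h3, sec_sum_apply, map_sum]
  refine Finset.sum_congr rfl fun k _ => ?_
  rw [fsmul_apply, map_smul, hfy, smul_eq_mul, mul_comm]
  rfl

omit [T2Space M] [ContMDiffVectorBundle ∞ F V (𝓡 d)] in
theorem eq_sum_dual_frame {y : M} {e e' : Fin d → TangentSpace (𝓡 d) y}
    (h : ∀ i j, G.g y (e i) (e' j) = if i = j then 1 else 0) (w : TangentSpace (𝓡 d) y) :
    w = ∑ i, G.g y w (e' i) • e i :=
  eq_sum_of_biorthogonal (B := G.g y) (by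
    rw [Fintype.card_fin]
    exact finrank_euclideanSpace_fin.symm) h w

omit [T2Space M] [ContMDiffVectorBundle ∞ F V (𝓡 d)] in
theorem trace_eq_sum_dual_frame {y : M} {e e' : Fin d → TangentSpace (𝓡 d) y}
    (h : ∀ i j, G.g y (e i) (e' j) = if i = j then 1 else 0)
    (L : TangentSpace (𝓡 d) y →ₗ[ℝ] TangentSpace (𝓡 d) y) :
    LinearMap.trace ℝ _ L = ∑ i, G.g y (L (e i)) (e' i) := by
  rw [← trace_form_comp (G.g_nondeg y) (G.g_symm y) L]
  exact trace_eq_sum (G.g_nondeg y) (G.g_symm y) (G.eq_sum_dual_frame h) (LinearMap.comp (G.g y) L)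

-- The metric serves only to provide dual frames, in which the trace is locally a finite sum of
-- smooth functions.
include G in
theorem contMDiff_trace (Θ : TangentEndo d M) :
    ContMDiff (𝓡 d) 𝓘(ℝ, ℝ) ∞ fun y => LinearMap.trace ℝ _ (Θ.atPoint y) := by
  intro x
  obtain ⟨e, e', he⟩ := G.exists_dual_frames x
  refine (∑ i, G.gfun (Θ.toFun (e i)) (e' i)).contMDiff x |>.congr_of_eventuallyEq ?_
  filter_upwards [he] with y hy
  rw [G.trace_eq_sum_dual_frame hy, sum_function_apply]
  exact Finset.sum_congr rfl fun i _ => by rw [Θ.atPoint_apply, gfun_apply]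

/-- The trace of an endomorphism of the tangent bundle, as a smooth function. -/
def endoTrace (Θ : TangentEndo d M) : C^∞⟮𝓡 d, M; ℝ⟯ :=
  ⟨fun y => LinearMap.trace ℝ _ (Θ.atPoint y), G.contMDiff_trace Θ⟩

theorem endoTrace_apply (Θ : TangentEndo d M) (x : M) :
    G.endoTrace Θ x = LinearMap.trace ℝ _ (Θ.atPoint x) := rfl

namespace IsMetricConnection

variable {G} {N : VecField d M → VecField d M → VecField d M}

/-- The endomorphism `Y ↦ ∇_Y Z`. -/
def endo (h : G.IsMetricConnection N) (Z : VecField d M) : TangentEndo d M where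
  toFun Y := N Y Z
  map_add Y Y' := h.add_left Y Y' Z
  map_fsmul f Y := h.smul_left f Y Z

/-- The covariant derivative `∇_Y Θ` of an endomorphism. -/
def derEndo (h : G.IsMetricConnection N) (Y : VecField d M) (Θ : TangentEndo d M) :
    TangentEndo d M where
  toFun P := N Y (Θ.toFun P) - Θ.toFun (N Y P)
  map_add P Q := by
    simp only [Θ.map_add, h.add_right]
    abel
  map_fsmul f P := by
    simp only [Θ.map_fsmul, h.leibniz, Θ.map_add]
    exact ContMDiffSection.ext fun x => by
      simp only [sec_add_apply, sec_sub_apply, fsmul_apply]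
      module

/-- Covariant derivatives commute with contraction: in a dual frame the trace is Σ g(Θ e_i, e'_i),
and differentiating the constants g(e_i, e'_j) relates the derivatives of the two frames. -/
theorem der_endoTrace (h : G.IsMetricConnection N) (Y : VecField d M) (Θ : TangentEndo d M) :
    der Y (G.endoTrace Θ) = G.endoTrace (h.derEndo Y Θ) := by
  refine ContMDiffMap.ext fun x => ?_
  obtain ⟨e, e', he⟩ := G.exists_dual_frames x
  have hx := he.self_of_nhds
  have h1 : der Y (G.endoTrace Θ) x = der Y (∑ i, G.gfun (Θ.toFun (e i)) (e' i)) x := by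
    refine der_congr ?_ Y
    filter_upwards [he] with y hy
    rw [endoTrace_apply, G.trace_eq_sum_dual_frame hy, sum_function_apply]
    exact Finset.sum_congr rfl fun i _ => by rw [Θ.atPoint_apply, gfun_apply]
  have h2 : ∀ i j, G.g x (N Y (e i) x) (e' j x) = - G.g x (e i x) (N Y (e' j) x) := by
    intro i j
    have h3 : der Y (G.gfun (e i) (e' j)) x = 0 := by
      refine Eq.trans (dd_congr (g := fun _ => if i = j then 1 else 0) ?_ (Y x)) (dd_const _ x _)
      filter_upwards [he] with y hy
      exact hy i j
    have h4 := congrArg (fun f => f x) (h.metric Y (e i) (e' j))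
    have h5 : der Y (G.gfun (e i) (e' j)) x =
      G.g x (N Y (e i) x) (e' j x) + G.g x (e i x) (N Y (e' j) x) := h4
    linarith
  have h6 : ∀ i, G.g x (Θ.toFun (e i) x) (N Y (e' i) x) =
      ∑ j, G.g x (Θ.toFun (e i) x) (e' j x) * G.g x (e j x) (N Y (e' i) x) := by
    intro i
    conv_lhs => rw [G.eq_sum_dual_frame hx (Θ.toFun (e i) x)]
    simp
  have h7 : ∀ i, G.g x (Θ.toFun (N Y (e i)) x) (e' i x) =
      ∑ j, G.g x (N Y (e i) x) (e' j x) * G.g x (Θ.toFun (e j) x) (e' i x) := by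
    intro i
    rw [← Θ.atPoint_apply]
    conv_lhs => rw [G.eq_sum_dual_frame hx (N Y (e i) x)]
    simp [Θ.atPoint_apply]
  rw [h1, endoTrace_apply, G.trace_eq_sum_dual_frame hx, der_sum, sum_function_apply]
  simp only [TangentEndo.atPoint_apply]
  -- The derivative falling on e'_i is traded for one falling on e_i, by expanding both sides in the
  -- frame and using `h2`.
  have h8 : ∑ i, G.g x (Θ.toFun (e i) x) (N Y (e' i) x) =
      - ∑ i, G.g x (Θ.toFun (N Y (e i)) x) (e' i x) := by
    simp only [h6, h7]
    rw [Finset.sum_comm, ← Finset.sum_neg_distrib]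
    refine Finset.sum_congr rfl fun i _ => ?_
    rw [← Finset.sum_neg_distrib]
    refine Finset.sum_congr rfl fun j _ => ?_
    rw [h2]
    ring
  have h9 : ∀ i, der Y (G.gfun (Θ.toFun (e i)) (e' i)) x =
      G.g x (N Y (Θ.toFun (e i)) x) (e' i x) + G.g x (Θ.toFun (e i) x) (N Y (e' i) x) := fun i =>
    congrArg (fun f => f x) (h.metric Y (Θ.toFun (e i)) (e' i))
  simp only [h9, derEndo, sec_sub_apply, map_sub, LinearMap.sub_apply, Finset.sum_add_distrib,
    Finset.sum_sub_distrib, h8]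
  ring

end IsMetricConnection

/-! ### The Ricci tensor -/

/-- The curvature of the Levi-Civita connection. -/
def curvature (X Y Z : VecField d M) : VecField d M :=
  G.leviCivita X (G.leviCivita Y Z) - G.leviCivita Y (G.leviCivita X Z)
    - G.leviCivita (G.lieBracket X Y) Z

theorem riem_eq (X Y Z : VecField d M) (x : M) : G.riem X Y Z x = G.curvature X Y Z x := by
  have h : VectorField.mlieBracket (𝓡 d) X Y = G.lieBracket X Y :=
    funext fun y => (G.lieBracket_apply X Y y).symm
  rw [riem, h]
  simp only [nabla_eq]
  rfl

theorem leviCivita_sub_right (X Y Z : VecField d M) :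
    G.leviCivita X (Y - Z) = G.leviCivita X Y - G.leviCivita X Z := by
  have := G.isMetricConnection_leviCivita.add_right X (Y - Z) Z
  rw [sub_add_cancel] at this
  rw [this, add_sub_cancel_right]

theorem curvature_swap (X Y Z : VecField d M) : G.curvature X Y Z = - G.curvature Y X Z := by
  have h := G.isMetricConnection_leviCivita.add_left (G.lieBracket X Y) (G.lieBracket Y X) Z
  have h0 := G.isMetricConnection_leviCivita.add_left 0 0 Z
  rw [G.lieBracket_swap X Y, neg_add_cancel, ← G.lieBracket_swap] at h
  rw [add_zero, left_eq_add] at h0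
  rw [h0] at h
  rw [curvature, curvature]
  linear_combination (norm := module) h

/-- Vanishing torsion turns the cyclic sum into the Jacobi identity for vector fields. -/
theorem bianchi (X Y Z : VecField d M) :
    G.curvature X Y Z + G.curvature Y Z X + G.curvature Z X Y = 0 := by
  have h : ∀ X Y Z : VecField d M, G.leviCivita X (G.leviCivita Y Z) -
      G.leviCivita X (G.leviCivita Z Y) - G.leviCivita (G.lieBracket Y Z) X =
        G.lieBracket X (G.lieBracket Y Z) := fun X Y Z => by
    rw [← G.leviCivita_sub_swap X, ← leviCivita_sub_right, leviCivita_sub_swap]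
  have h1 := h X Y Z
  have h2 := h Y Z X
  have h3 := h Z X Y
  have hn : ∀ X Y : VecField d M, G.lieBracket X (-Y) = - G.lieBracket X Y := fun X Y => by
    have e1 := G.leviCivita_sub_right X 0 Y
    have e0 := G.leviCivita_sub_right X 0 0
    have e2 := G.isMetricConnection_leviCivita.add_left Y (-Y) X
    have e3 := G.isMetricConnection_leviCivita.add_left 0 0 X
    rw [sub_zero, sub_self] at e0
    rw [e0, zero_sub, zero_sub] at e1
    rw [add_zero, left_eq_add] at e3
    rw [add_neg_cancel, e3] at e2
    rw [← leviCivita_sub_swap, ← leviCivita_sub_swap, e1]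
    linear_combination (norm := module) e2
  have hj := G.jacobi_lieBracket X Y Z
  rw [G.lieBracket_swap (G.lieBracket X Y) Z, G.lieBracket_swap X Z, hn] at hj
  rw [curvature, curvature, curvature]
  linear_combination (norm := module) h1 + h2 + h3 + hj

theorem gfun_curvature_swap (X Y Z W : VecField d M) :
    G.gfun (G.curvature X Y Z) W = - G.gfun (G.curvature X Y W) Z := by
  have m := G.isMetricConnection_leviCivita
  have h := G.der_lieBracket X Y (G.gfun Z W)
  rw [m.metric, m.metric, m.metric, der_add, der_add, m.metric, m.metric, m.metric, m.metric] at h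
  have hsub : ∀ A B D W : VecField d M,
      G.gfun (A - B - D) W = G.gfun A W - G.gfun B W - G.gfun D W := fun A B D W =>
    ContMDiffMap.ext fun x => by
      rw [gfun_apply, sec_sub_apply, sec_sub_apply, map_sub, map_sub]
      rfl
  rw [curvature, curvature, hsub, hsub]
  simp only [G.gfun_comm Z] at h
  linear_combination -h

end GeneralisedMetric

namespace GeneralisedMetric

variable {d : ℕ} {M : Type*} [TopologicalSpace M] [ChartedSpace (EuclideanSpace ℝ (Fin d)) M]
  [IsManifold (𝓡 d) ∞ M] {F : Type*} [NormedAddCommGroup F] [NormedSpace ℝ F]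
  [FiniteDimensional ℝ F] {V : M → Type*} [TopologicalSpace (TotalSpace F V)]
  [∀ x, TopologicalSpace (V x)] [FiberBundle F V] [∀ x, AddCommGroup (V x)]
  [∀ x, Module ℝ (V x)] [VectorBundle ℝ F V]
  {C : ExactCourantAlgebroid d F V} (G : GeneralisedMetric C)
  [T2Space M] [ContMDiffVectorBundle ∞ F V (𝓡 d)]

/-- The endomorphism `P ↦ ∇_P Z` of a tangent space. -/
def nablaAt (Z : VecField d M) (x : M) : TangentSpace (𝓡 d) x →ₗ[ℝ] TangentSpace (𝓡 d) x :=
  (G.isMetricConnection_leviCivita.endo Z).atPoint x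

theorem nablaAt_apply (Z : VecField d M) (x : M) (P : VecField d M) :
    G.nablaAt Z x (P x) = G.leviCivita P Z x :=
  (G.isMetricConnection_leviCivita.endo Z).atPoint_apply x P

/-- The divergence of a vector field. -/
def vecDiv (Z : VecField d M) : C^∞⟮𝓡 d, M; ℝ⟯ :=
  G.endoTrace (G.isMetricConnection_leviCivita.endo Z)

theorem vecDiv_apply (Z : VecField d M) (x : M) :
    G.vecDiv Z x = LinearMap.trace ℝ _ (G.nablaAt Z x) := rfl

theorem metricDiv_eq (a : Sec d F V) (x : M) : G.metricDiv a x = G.vecDiv (C.anchorSec a) x := by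
  rw [vecDiv_apply, ← trace_form_comp (G.g_nondeg x) (G.g_symm x), metricDiv]
  refine congrArg _ (funext₂ fun p q => ?_)
  rw [nabla_eq, ← nablaAt_apply, ext_self]

/-- The endomorphism `P ↦ R(P,Y)Z` of a tangent space. -/
def curvatureAt (Y Z : VecField d M) (x : M) :
    TangentSpace (𝓡 d) x →ₗ[ℝ] TangentSpace (𝓡 d) x :=
  G.nablaAt (G.leviCivita Y Z) x
    - (G.isMetricConnection_leviCivita.derEndo Y
        (G.isMetricConnection_leviCivita.endo Z)).atPoint x
    - G.nablaAt Z x ∘ₗ G.nablaAt Y x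

/-- Substituting [P,Y] = ∇_P Y - ∇_Y P makes each term an endomorphism in P: R(P,Y)Z = ∇_P(∇_Y Z) -
(∇_Y(∇Z))(P) - ∇_{∇_P Y} Z. The mixed curvature of D has the same shape. -/
theorem curvatureAt_apply (Y Z P : VecField d M) (x : M) :
    G.curvatureAt Y Z x (P x) = G.curvature P Y Z x := by
  have h : G.leviCivita (G.leviCivita P Y) Z =
      G.leviCivita (G.lieBracket P Y) Z + G.leviCivita (G.leviCivita Y P) Z := by
    rw [← G.isMetricConnection_leviCivita.add_left, ← leviCivita_sub_swap, sub_add_cancel]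
  have h' := congrArg (fun W : VecField d M => W x) h
  simp only [sec_add_apply] at h'
  simp only [curvatureAt, LinearMap.sub_apply, LinearMap.comp_apply, nablaAt_apply,
    TangentEndo.atPoint_apply, h']
  simp only [curvature, IsMetricConnection.derEndo, IsMetricConnection.endo, sec_sub_apply]
  abel

theorem trace_curvatureAt (Y Z : VecField d M) (x : M) :
    LinearMap.trace ℝ _ (G.curvatureAt Y Z x) = G.vecDiv (G.leviCivita Y Z) x
      - der Y (G.vecDiv Z) x - LinearMap.trace ℝ _ (G.nablaAt Z x ∘ₗ G.nablaAt Y x) := by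
  rw [vecDiv, vecDiv, IsMetricConnection.der_endoTrace (G := G) G.isMetricConnection_leviCivita,
    curvatureAt, map_sub, map_sub]
  rfl

/-- By the Bianchi identity the difference of the two endomorphisms is P ↦ -R(Y,Z)P, which is skew
for g and hence traceless. -/
theorem trace_curvatureAt_symm (Y Z : VecField d M) (x : M) :
    LinearMap.trace ℝ _ (G.curvatureAt Y Z x) = LinearMap.trace ℝ _ (G.curvatureAt Z Y x) := by
  rw [← sub_eq_zero, ← map_sub, ← trace_form_comp (G.g_nondeg x) (G.g_symm x)]
  refine trace_eq_zero_of_antisymm (G.g_symm x) fun p q => ?_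
  have h : ∀ P : VecField d M, (G.curvatureAt Y Z x - G.curvatureAt Z Y x) (P x) =
      - G.curvature Y Z P x := by
    intro P
    have h1 := congrArg (fun W : VecField d M => W x) (G.bianchi P Y Z)
    have h2 := congrArg (fun W : VecField d M => W x) (G.curvature_swap Z P Y)
    simp only [sec_add_apply, sec_neg_apply] at h1 h2
    rw [h2] at h1
    rw [LinearMap.sub_apply, curvatureAt_apply, curvatureAt_apply]
    have h3 : (0 : VecField d M) x = 0 := rfl
    rw [h3] at h1
    linear_combination (norm := module) h1
  have h4 := congrArg (fun f => f x) (G.gfun_curvature_swap Y Z (ext p) (ext q))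
  have h5 : G.g x (G.curvature Y Z (ext p) x) ((ext q : VecField d M) x) =
    - G.g x (G.curvature Y Z (ext q) x) ((ext p : VecField d M) x) := h4
  rw [← ext_self (d := d) (F := EuclideanSpace ℝ (Fin d)) p,
    ← ext_self (d := d) (F := EuclideanSpace ℝ (Fin d)) q, h, h, map_neg, map_neg,
    LinearMap.neg_apply, LinearMap.neg_apply, h5]

theorem curvatureAt_congr {Y Y' : VecField d M} {x : M} (h : Y x = Y' x) (Z : VecField d M) :
    G.curvatureAt Y Z x = G.curvatureAt Y' Z x :=
  linearMap_ext_of_sections fun P => by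
    rw [curvatureAt_apply, curvatureAt_apply, curvature_swap, G.curvature_swap P, sec_neg_apply,
      sec_neg_apply, ← curvatureAt_apply, ← curvatureAt_apply, h]

/-- Independence of the extension is known directly for Y; symmetry of the trace carries it over to
Z. -/
theorem ricci_eq (Y Z : VecField d M) (x : M) :
    G.ricci x (Y x) (Z x) = LinearMap.trace ℝ _ (G.curvatureAt Y Z x) := by
  have h : LinearMap.trace ℝ _ (G.curvatureAt Y Z x) =
      LinearMap.trace ℝ _ (G.curvatureAt (ext (Y x)) (ext (Z x)) x) := by
    rw [G.curvatureAt_congr (ext_self (Y x)).symm, trace_curvatureAt_symm,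
      G.curvatureAt_congr (ext_self (Z x)).symm, trace_curvatureAt_symm]
  rw [h, ← trace_form_comp (G.g_nondeg x) (G.g_symm x), ricci]
  refine congrArg _ (funext₂ fun p q => ?_)
  rw [riem_eq, ← curvatureAt_apply, ext_self]

theorem ricci_symm (x : M) (u v : TangentSpace (𝓡 d) x) : G.ricci x u v = G.ricci x v u := by
  have := G.trace_curvatureAt_symm (ext u) (ext v) x
  rwa [← ricci_eq, ← ricci_eq, ext_self, ext_self] at this

/-! ### Tensors built from the three-form -/

theorem Htwo_eq (x : M) (u p v q : TangentSpace (𝓡 d) x) :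
    G.Htwo x u p v q = - G.g x (G.torsionAt x v (G.torsionAt x u p)) q := by
  have h : G.Htwo x u p v q = trace (G.g x)
      fun r t => G.g x (G.torsionAt x u p) r * G.g x (G.torsionAt x v q) t :=
    congrArg _ (funext₂ fun r t => by rw [H_apply, H_apply])
  rw [h, trace_mul_linear, sharp_eq (G.g_nondeg x) (v := G.torsionAt x u p) fun w => rfl,
    g_torsionAt_swap]

theorem Hsq_eq (x : M) (u v : TangentSpace (𝓡 d) x) :
    G.Hsq x u v = - LinearMap.trace ℝ _ (G.torsionAt x v ∘ₗ G.torsionAt x u) := by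
  rw [← map_neg, ← trace_form_comp (G.g_nondeg x) (G.g_symm x), Hsq]
  refine congrArg _ (funext₂ fun p q => ?_)
  rw [Htwo_eq, LinearMap.neg_apply, map_neg, LinearMap.neg_apply, LinearMap.comp_apply]

theorem Hsq_symm (x : M) (u v : TangentSpace (𝓡 d) x) : G.Hsq x u v = G.Hsq x v u := by
  rw [Hsq_eq, Hsq_eq, LinearMap.trace_comp_comm']

theorem H_apply_cyclic (x : M) (u v w : TangentSpace (𝓡 d) x) :
    G.H x u v w = G.g x (G.torsionAt x v w) u := by
  rw [H_apply, torsionAt_swap, map_neg, LinearMap.neg_apply, g_torsionAt_swap, neg_neg]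

theorem Hform_eq (ξ : OneForm d M) (x : M) (u v : TangentSpace (𝓡 d) x) :
    G.Hform ξ x u v = ξ x (G.torsionAt x u v) := by
  rw [Hform, H_apply_cyclic, g_symm]
  exact sharp_apply (G.g_nondeg x) (ξ x : TangentSpace (𝓡 d) x →ₗ[ℝ] ℝ) _

/-- The endomorphism `P ↦ (∇_P g⁻¹H)(Y,Z)` of a tangent space. -/
def nablaTorsionAt (Y Z : VecField d M) (x : M) :
    TangentSpace (𝓡 d) x →ₗ[ℝ] TangentSpace (𝓡 d) x :=
  G.nablaAt (G.torsionTensor Y Z) x + G.torsionAt x (Z x) ∘ₗ G.nablaAt Y x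
    - G.torsionAt x (Y x) ∘ₗ G.nablaAt Z x

theorem nablaTorsionAt_apply (Y Z P : VecField d M) (x : M) :
    G.nablaTorsionAt Y Z x (P x) = G.leviCivita P (G.torsionTensor Y Z) x
      - G.torsionTensor (G.leviCivita P Y) Z x - G.torsionTensor Y (G.leviCivita P Z) x := by
  rw [G.torsionTensor_swap (G.leviCivita P Y) Z]
  simp only [nablaTorsionAt, LinearMap.sub_apply, LinearMap.add_apply, LinearMap.comp_apply,
    nablaAt_apply, torsionAt_apply, sec_neg_apply, sub_neg_eq_add]

theorem nablaTorsionAt_swap (Y Z : VecField d M) (x : M) :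
    G.nablaTorsionAt Y Z x = - G.nablaTorsionAt Z Y x := by
  have h : G.nablaAt (G.torsionTensor Y Z) x = - G.nablaAt (G.torsionTensor Z Y) x :=
    linearMap_ext_of_sections fun P => by
      have := G.leviCivita_sub_right P 0 (G.torsionTensor Z Y)
      have h0 := G.leviCivita_sub_right P 0 0
      rw [sub_zero, sub_self] at h0
      rw [h0, zero_sub, zero_sub, ← torsionTensor_swap] at this
      rw [LinearMap.neg_apply, nablaAt_apply, nablaAt_apply, this, sec_neg_apply]
  rw [nablaTorsionAt, nablaTorsionAt, h]
  abel

/-- The derivatives of a factor f in ∇_P(T(fY, Z)) and T(∇_P(fY), Z) cancel. With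
`nablaTorsionAt_swap` the same holds in Z. -/
theorem nablaTorsionAt_congr {Y Y' : VecField d M} {x : M} (h : Y x = Y' x) (Z : VecField d M) :
    G.nablaTorsionAt Y Z x = G.nablaTorsionAt Y' Z x :=
  linearMap_ext_of_sections fun P => by
    have m := G.isMetricConnection_leviCivita
    have ht : IsTensorialAt x fun Y => G.nablaTorsionAt Y Z x (P x) := by
      constructor
      · intro a b
        simp only [nablaTorsionAt_apply, torsionTensor_add_left, m.add_right, sec_add_apply]
        abel
      · intro f a
        simp only [nablaTorsionAt_apply, torsionTensor_add_left, torsionTensor_fsmul_left,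
          m.leibniz, sec_add_apply, fsmul_apply]
        module
    exact ht.eq_of_apply_eq h

theorem nablaH_eq (P Q Y Z : VecField d M) (x : M) :
    G.nablaH P Q Y Z x = G.g x (G.nablaTorsionAt Y Z x (P x)) (Q x) := by
  have h1 : (fun y => G.H y (Q y) (Y y) (Z y)) = G.gfun (G.torsionTensor Y Z) Q :=
    funext fun y => by rw [H_apply_cyclic, torsionAt_apply, gfun_apply]
  have h2 : dd (G.gfun (G.torsionTensor Y Z) Q) x (P x) =
      G.g x (G.leviCivita P (G.torsionTensor Y Z) x) (Q x)
        + G.g x (G.torsionTensor Y Z x) (G.leviCivita P Q x) :=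
    congrArg (fun f => f x) (G.isMetricConnection_leviCivita.metric P (G.torsionTensor Y Z) Q)
  rw [nablaH, h1, h2]
  simp only [nabla_eq, H_apply_cyclic, torsionAt_apply, nablaTorsionAt_apply, map_sub,
    LinearMap.sub_apply]
  ring

theorem codiffH_eq (Y Z : VecField d M) (x : M) :
    G.codiffH x (Y x) (Z x) = - LinearMap.trace ℝ _ (G.nablaTorsionAt Y Z x) := by
  rw [G.nablaTorsionAt_congr (ext_self (d := d) (Y x)).symm, nablaTorsionAt_swap,
    G.nablaTorsionAt_congr (ext_self (d := d) (Z x)).symm, ← nablaTorsionAt_swap,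
    ← trace_form_comp (G.g_nondeg x) (G.g_symm x), codiffH]
  refine congrArg _ (congrArg _ (funext₂ fun p q => ?_))
  rw [nablaH_eq, ext_self, ext_self]

theorem codiffH_swap (x : M) (u v : TangentSpace (𝓡 d) x) :
    G.codiffH x u v = - G.codiffH x v u := by
  rw [← ext_self (d := d) (F := EuclideanSpace ℝ (Fin d)) u,
    ← ext_self (d := d) (F := EuclideanSpace ℝ (Fin d)) v, codiffH_eq, codiffH_eq,
    nablaTorsionAt_swap, map_neg]

/-! ### The Ricci tensor of the Bismut connections -/

theorem IsMetricConnection.smul_right {G : GeneralisedMetric C}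
    {N : VecField d M → VecField d M → VecField d M} (h : G.IsMetricConnection N) (c : ℝ)
    (Y Z : VecField d M) : N Y (c • Z) = c • N Y Z := by
  let k : C^∞⟮𝓡 d, M; ℝ⟯ := ⟨fun _ => c, contMDiff_const⟩
  have h1 : N Y (fsmul k Z) = fsmul k (N Y Z) + fsmul (der Y k) Z := h.leibniz k Y Z
  have h2 : der Y k = 0 := ContMDiffMap.ext fun x => dd_const c x _
  have h3 : fsmul (0 : C^∞⟮𝓡 d, M; ℝ⟯) Z = 0 := ContMDiffSection.ext fun x => zero_smul ℝ (Z x)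
  rw [h2, h3, add_zero] at h1
  exact h1

/-- The endomorphism `P ↦ ∇^±_P Z` of a tangent space. -/
def bismutAt {t : ℝ} (ht : t = 1 ∨ t = -1) (Z : VecField d M) (x : M) :
    TangentSpace (𝓡 d) x →ₗ[ℝ] TangentSpace (𝓡 d) x :=
  ((G.isMetricConnection_bismut ht).endo Z).atPoint x

theorem bismutAt_apply {t : ℝ} (ht : t = 1 ∨ t = -1) (Z P : VecField d M) (x : M) :
    G.bismutAt ht Z x (P x) = G.bismut ht P Z x :=
  ((G.isMetricConnection_bismut ht).endo Z).atPoint_apply x P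

theorem bismutAt_eq {t : ℝ} (ht : t = 1 ∨ t = -1) (Z : VecField d M) (x : M) :
    G.bismutAt ht Z x = G.nablaAt Z x - (t / 2) • G.torsionAt x (Z x) :=
  linearMap_ext_of_sections fun P => by
    rw [bismutAt_apply, bismut_apply, torsionTensor_swap, LinearMap.sub_apply, nablaAt_apply,
      LinearMap.smul_apply, torsionAt_apply, sec_neg_apply]
    module

theorem vecDiv_bismut {t : ℝ} (ht : t = 1 ∨ t = -1) (Y Z : VecField d M) (x : M) :
    G.vecDiv (G.bismut ht Y Z) x = G.vecDiv (G.leviCivita Y Z) x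
      + (t / 2) * G.vecDiv (G.torsionTensor Y Z) x := by
  have h1 : G.bismut ht Y Z = G.leviCivita Y Z + (t / 2) • G.torsionTensor Y Z :=
    ContMDiffSection.ext fun y => G.bismut_apply ht Y Z y
  have h2 : G.nablaAt (G.bismut ht Y Z) x = G.nablaAt (G.leviCivita Y Z) x
      + (t / 2) • G.nablaAt (G.torsionTensor Y Z) x :=
    linearMap_ext_of_sections fun P => by
      rw [nablaAt_apply, h1, G.isMetricConnection_leviCivita.add_right,
        G.isMetricConnection_leviCivita.smul_right]
      simp only [LinearMap.add_apply, LinearMap.smul_apply, nablaAt_apply, sec_add_apply,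
        sec_smul_apply]
  rw [vecDiv_apply, h2, map_add, map_smul]
  rfl

/-- Insert ∇^{±t} = ∇ ± (t/2) T. The terms without T form the Ricci tensor, those linear in T form
(t/2) tr(∇T) and thus the codifferential, and the quadratic one is (t²/4) tr(T_Z T_Y) = -H²/4. -/
theorem bismut_ricci {t : ℝ} (ht : t = 1 ∨ t = -1) (Y Z : VecField d M) (x : M) :
    G.vecDiv (G.bismut ht Y Z) x - der Y (G.vecDiv Z) x
      - LinearMap.trace ℝ _ (G.bismutAt ht Z x ∘ₗ G.bismutAt (neg_sign ht) Y x) =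
    G.ricci x (Y x) (Z x) - (1 / 4) * G.Hsq x (Y x) (Z x)
      - (t / 2) * G.codiffH x (Y x) (Z x) := by
  have htt := sign_mul_self ht
  rw [ricci_eq, trace_curvatureAt, vecDiv_bismut, Hsq_eq, codiffH_eq, nablaTorsionAt, map_sub,
    map_add, bismutAt_eq, bismutAt_eq]
  simp only [LinearMap.comp_sub, LinearMap.sub_comp, LinearMap.smul_comp, LinearMap.comp_smul,
    map_sub, map_smul, smul_eq_mul]
  rw [LinearMap.trace_comp_comm' (G.nablaAt Z x) (G.torsionAt x (Y x)), vecDiv_apply,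
    vecDiv_apply]
  linear_combination (1 / 4) * LinearMap.trace ℝ _ (G.torsionAt x (Z x) ∘ₗ G.torsionAt x (Y x)) * htt

/-! ### Covariant derivatives of one-forms -/

/-- Replacing the extension of Z is allowed because the derivatives of a factor f cancel between the
two terms; the connection term is already pointwise in Y. -/
theorem nablaForm_eq (α : ∀ x : M, TangentSpace (𝓡 d) x →ₗ[ℝ] ℝ)
    (hα : ∀ Z : VecField d M, ContMDiff (𝓡 d) 𝓘(ℝ, ℝ) ∞ fun x => α x (Z x)) (Y Z : VecField d M)
    (x : M) : G.nablaForm (fun y v => α y v) x (Y x) (Z x) =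
      dd (fun y => α y (Z y)) x (Y x) - α x (G.leviCivita Y Z x) := by
  have m := G.isMetricConnection_leviCivita
  let f : VecField d M → C^∞⟮𝓡 d, M; ℝ⟯ := fun Z => ⟨fun y => α y (Z y), hα Z⟩
  have ht : IsTensorialAt x fun Z : VecField d M => der Y (f Z) x - α x (G.leviCivita Y Z x) := by
    constructor
    · intro a b
      have h1 : f (a + b) = f a + f b := ContMDiffMap.ext fun y => map_add (α y) _ _
      simp only [h1, der_add, m.add_right, sec_add_apply, map_add, ContMDiffMap.coe_add,
        Pi.add_apply]
      ring
    · intro k a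
      have h1 : f (fsmul k a) = k * f a := ContMDiffMap.ext fun y => map_smul (α y) _ _
      have h2 : f a x = α x (a x) := rfl
      simp only [h1, der_mul, m.leibniz, sec_add_apply, fsmul_apply, map_add, map_smul,
        ContMDiffMap.coe_add, ContMDiffMap.coe_mul, Pi.add_apply, Pi.mul_apply, smul_eq_mul, h2]
      ring
  have h1 := ht.eq_of_apply_eq (ext_self (d := d) (Z x))
  rw [nablaForm, nabla_eq]
  have h2 : G.leviCivita (ext (Y x)) (ext (Z x)) x = G.leviCivita Y (ext (Z x)) x := by
    rw [← nablaAt_apply, ← nablaAt_apply, ext_self]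
  rw [h2]
  exact h1

end GeneralisedMetric

namespace GeneralisedConnection

variable {d : ℕ} {M : Type*} [TopologicalSpace M] [ChartedSpace (EuclideanSpace ℝ (Fin d)) M]
  [IsManifold (𝓡 d) ∞ M] {F : Type*} [NormedAddCommGroup F] [NormedSpace ℝ F]
  {V : M → Type*} [TopologicalSpace (TotalSpace F V)]
  [∀ x, TopologicalSpace (V x)] [FiberBundle F V] [∀ x, AddCommGroup (V x)]
  [∀ x, Module ℝ (V x)] [VectorBundle ℝ F V]
  {C : ExactCourantAlgebroid d F V} (D : GeneralisedConnection C)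

/-! ### The curvature operator of a generalised connection -/

theorem leibniz_sec (f : C^∞⟮𝓡 d, M; ℝ⟯) (u v : Sec d F V) :
    D.D u (fsmul f v) = fsmul f (D.D u v) + fsmul (der (C.anchorSec u) f) v :=
  ContMDiffSection.ext fun x => D.leibniz f u v x

theorem der_pair (u v w : Sec d F V) :
    der (C.anchorSec u) (C.pair v w) = C.pair (D.D u v) w + C.pair v (D.D u w) :=
  ContMDiffMap.ext fun x => D.metric u v w x

/-- The curvature operator `D_v D_w - D_w D_v - D_[v,w]`. -/
def curv (v w b : Sec d F V) : Sec d F V :=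
  D.D v (D.D w b) - D.D w (D.D v b) - D.D (C.bracket v w) b

theorem naiveCurv_eq (a b v w : Sec d F V) (x : M) :
    D.naiveCurv a b v w x = C.pairing x (D.curv v w b x) (a x) := rfl

theorem pair_sub_left (a b c : Sec d F V) : C.pair (a - b) c = C.pair a c - C.pair b c :=
  ContMDiffMap.ext fun x => by
    rw [C.pair_apply, sec_sub_apply, map_sub]
    rfl

variable [T2Space M] [ContMDiffVectorBundle ∞ F V (𝓡 d)]

theorem pair_curv_swap (v w b c : Sec d F V) :
    C.pair (D.curv v w b) c = - C.pair (D.curv v w c) b := by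
  have h := C.der_bracket v w (C.pair b c)
  simp only [D.der_pair, der_add] at h
  rw [curv, curv, pair_sub_left, pair_sub_left, pair_sub_left, pair_sub_left]
  simp only [C.pair_comm b] at h
  rw [C.pair_comm (D.D v b) (D.D w c), C.pair_comm (D.D w b) (D.D v c)] at h
  linear_combination -h

/-- Orthogonality is needed: only then is the Dorfman bracket in the curvature operator skew. -/
theorem curv_swap {v w : Sec d F V} (h : C.pair v w = 0) (b : Sec d F V) :
    D.curv v w b = - D.curv w v b := by
  rw [curv, curv, C.bracket_swap_of_orthogonal h, map_neg, LinearMap.neg_apply]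
  abel

variable [FiniteDimensional ℝ F]

omit [T2Space M] [ContMDiffVectorBundle ∞ F V (𝓡 d)] [FiniteDimensional ℝ F] in
theorem tensorial_left (v : Sec d F V) (x : M) : IsTensorialAt x fun u => D.D u v x :=
  ⟨fun a b => by rw [map_add]; rfl, fun f a => by rw [D.smul_left, fsmul_apply]⟩

/-- The endomorphism `u ↦ D_u v` of a fibre. -/
def endoAt (v : Sec d F V) (x : M) : V x →ₗ[ℝ] V x := (D.tensorial_left v x).toLinearMap

theorem endoAt_apply (v u : Sec d F V) (x : M) : D.endoAt v x (u x) = D.D u v x :=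
  (D.tensorial_left v x).toLinearMap_apply u

/-- The gradient of a smooth function with respect to the scalar product. -/
def grad (C : ExactCourantAlgebroid d F V) (f : C^∞⟮𝓡 d, M; ℝ⟯) (x : M) : V x :=
  haveI : FiniteDimensional ℝ (V x) := VectorBundle.finiteDimensional ℝ F V x
  sharp (C.pairing x) fun u => dd f x (C.anchor x u)

/-- The vector dual to `u ↦ ⟨D_u v, a⟩`. -/
def dualAt (v a : Sec d F V) (x : M) : V x :=
  haveI : FiniteDimensional ℝ (V x) := VectorBundle.finiteDimensional ℝ F V x
  sharp (C.pairing x) fun u => C.pairing x (D.endoAt v x u) (a x)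

omit [T2Space M] [ContMDiffVectorBundle ∞ F V (𝓡 d)] in
theorem pairing_grad (f : C^∞⟮𝓡 d, M; ℝ⟯) (x : M) (u : V x) :
    C.pairing x (grad C f x) u = dd f x (C.anchor x u) := by
  have : FiniteDimensional ℝ (V x) := VectorBundle.finiteDimensional ℝ F V x
  exact sharp_apply (C.pairing_nondeg x)
    ((mvfderiv (𝓡 d) f x : TangentSpace (𝓡 d) x →ₗ[ℝ] ℝ) ∘ₗ C.anchor x) u

theorem pairing_dualAt (v a : Sec d F V) (x : M) (u : V x) :
    C.pairing x (D.dualAt v a x) u = C.pairing x (D.endoAt v x u) (a x) := by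
  have : FiniteDimensional ℝ (V x) := VectorBundle.finiteDimensional ℝ F V x
  exact sharp_apply (C.pairing_nondeg x)
    (((C.pairing x).flip (a x)).comp (D.endoAt v x)) u

/-- The trace term is D b applied to the vector dual to ⟨D q, a⟩. It is grouped with R(q, a)b
because only their sum is tensorial in q. -/
theorem genRiem_eq (p b q a : Sec d F V) (x : M) : D.genRiem p b q a x =
    (1 / 2) * (C.pairing x (D.curv q a b x + D.endoAt b x (D.dualAt q a x)) (p x)
      + C.pairing x (D.curv b p q x) (a x)) := by
  have : FiniteDimensional ℝ (V x) := VectorBundle.finiteDimensional ℝ F V x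
  have h : traceE C x (fun r t => C.pairing x (D.D (ext r) q x) (a x) *
      C.pairing x (D.D (ext t) b x) (p x)) =
      C.pairing x (D.endoAt b x (D.dualAt q a x)) (p x) := by
    have h1 := trace_mul_linear (B := C.pairing x)
      (((C.pairing x).flip (a x)).comp (D.endoAt q x))
      (((C.pairing x).flip (p x)).comp (D.endoAt b x))
    refine Eq.trans (congrArg _ (funext₂ fun r t => ?_)) h1
    rw [← endoAt_apply, ← endoAt_apply, ext_self, ext_self]
    rfl
  rw [genRiem, h, naiveCurv_eq, naiveCurv_eq, map_add, LinearMap.add_apply]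
  ring

omit [T2Space M] [ContMDiffVectorBundle ∞ F V (𝓡 d)] [FiniteDimensional ℝ F] in
theorem curv_add_middle (b p p' q : Sec d F V) :
    D.curv b (p + p') q = D.curv b p q + D.curv b p' q := by
  simp only [curv, map_add, LinearMap.add_apply]
  abel

omit [T2Space M] [ContMDiffVectorBundle ∞ F V (𝓡 d)] [FiniteDimensional ℝ F] in
theorem curv_add_right (b p q q' : Sec d F V) :
    D.curv b p (q + q') = D.curv b p q + D.curv b p q' := by
  simp only [curv, map_add]
  abel

omit [T2Space M] [ContMDiffVectorBundle ∞ F V (𝓡 d)] [FiniteDimensional ℝ F] in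
theorem curv_add_left (q q' a b : Sec d F V) :
    D.curv (q + q') a b = D.curv q a b + D.curv q' a b := by
  simp only [curv, map_add, LinearMap.add_apply]
  abel

omit [T2Space M] [ContMDiffVectorBundle ∞ F V (𝓡 d)] [FiniteDimensional ℝ F] in
theorem curv_fsmul_middle (f : C^∞⟮𝓡 d, M; ℝ⟯) (b p q : Sec d F V) :
    D.curv b (fsmul f p) q = fsmul f (D.curv b p q) := by
  simp only [curv, D.smul_left, D.leibniz_sec, C.bracket_fsmul_right, map_add,
    LinearMap.add_apply]
  exact ContMDiffSection.ext fun x => by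
    simp only [sec_add_apply, sec_sub_apply, fsmul_apply]
    module

omit [FiniteDimensional ℝ F] in
theorem curv_fsmul_right (f : C^∞⟮𝓡 d, M; ℝ⟯) (b p q : Sec d F V) :
    D.curv b p (fsmul f q) = fsmul f (D.curv b p q) := by
  simp only [curv, D.leibniz_sec, map_add, C.der_bracket]
  exact ContMDiffSection.ext fun x => by
    simp only [sec_add_apply, sec_sub_apply, fsmul_apply, ContMDiffMap.coe_sub, Pi.sub_apply]
    module

/-- The gradient term comes from the symmetric part of the bracket, the differential of f⟨q, a⟩. -/
theorem bracket_fsmul_left (f : C^∞⟮𝓡 d, M; ℝ⟯) (q a : Sec d F V) (x : M) :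
    C.bracket (fsmul f q) a x = f x • C.bracket q a x - der (C.anchorSec a) f x • q x
      + C.pairing x (q x) (a x) • grad C f x := by
  refine C.pairing_ext fun u => ?_
  have h1 := C.pairing_bracket_add_swap (fsmul f q) a (ext u) x
  have h2 := C.pairing_bracket_add_swap q a (ext u) x
  rw [C.pair_comm, C.pair_fsmul_right, der_mul, C.bracket_fsmul_right, C.pair_comm a q] at h1
  have h3 : der (C.anchorSec (ext u : Sec d F V)) f x = dd f x (C.anchor x u) := by
    rw [der_apply, ExactCourantAlgebroid.anchorSec_apply, ext_self]
  simp only [ContMDiffMap.coe_add, ContMDiffMap.coe_mul, Pi.add_apply, Pi.mul_apply, h3,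
    C.pair_apply, sec_add_apply, fsmul_apply, map_add, map_smul, LinearMap.add_apply,
    LinearMap.smul_apply, smul_eq_mul, ext_self] at h1 h2
  simp only [map_add, map_sub, map_smul, LinearMap.add_apply, LinearMap.sub_apply,
    LinearMap.smul_apply, smul_eq_mul, pairing_grad]
  linear_combination h1 - f x * h2

theorem curv_fsmul_left (f : C^∞⟮𝓡 d, M; ℝ⟯) (q a b : Sec d F V) (x : M) :
    D.curv (fsmul f q) a b x = f x • D.curv q a b x
      - C.pairing x (q x) (a x) • D.endoAt b x (grad C f x) := by
  simp only [curv, D.smul_left, D.leibniz_sec, sec_sub_apply, sec_add_apply, fsmul_apply]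
  rw [← D.endoAt_apply b (C.bracket _ _), bracket_fsmul_left, map_add, map_sub, map_smul,
    map_smul, map_smul, endoAt_apply, endoAt_apply]
  module

theorem dualAt_add (q q' a : Sec d F V) (x : M) :
    D.dualAt (q + q') a x = D.dualAt q a x + D.dualAt q' a x := by
  refine C.pairing_ext fun u => ?_
  rw [← ext_self (d := d) (F := F) u]
  simp only [map_add, LinearMap.add_apply, pairing_dualAt, endoAt_apply, sec_add_apply]

/-- The gradient produced here cancels the defect -⟨q, a⟩ D_{grad f} b of `curv_fsmul_left`; this is
the role of the trace term in the generalised Riemann tensor. -/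
theorem dualAt_fsmul (f : C^∞⟮𝓡 d, M; ℝ⟯) (q a : Sec d F V) (x : M) :
    D.dualAt (fsmul f q) a x = f x • D.dualAt q a x
      + C.pairing x (q x) (a x) • grad C f x := by
  refine C.pairing_ext fun u => ?_
  rw [← ext_self (d := d) (F := F) u]
  simp only [map_add, map_smul, LinearMap.add_apply, LinearMap.smul_apply, smul_eq_mul,
    pairing_dualAt, endoAt_apply, pairing_grad, D.leibniz_sec, sec_add_apply, fsmul_apply]
  rw [der_apply, ExactCourantAlgebroid.anchorSec_apply]
  ring

/-- Tensoriality in the two contracted slots is what allows the Ricci trace to be computed in frames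
adapted to E_+ and E_-. -/
theorem exists_genRiem_bilinear (b a : Sec d F V) (x : M) :
    ∃ T : V x →ₗ[ℝ] V x →ₗ[ℝ] ℝ, ∀ p q : Sec d F V, T (p x) (q x) = D.genRiem p b q a x := by
  refine exists_bilinear_of_tensorial (Φ := fun p q => D.genRiem p b q a x) (fun q => ?_)
    (fun p => ?_)
  · constructor
    · intro p p'
      simp only [genRiem_eq, curv_add_middle, sec_add_apply, map_add, LinearMap.add_apply]
      ring
    · intro f p
      simp only [genRiem_eq, curv_fsmul_middle, fsmul_apply, map_smul, map_add,
        LinearMap.add_apply, LinearMap.smul_apply, smul_eq_mul]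
      ring
  · constructor
    · intro q q'
      simp only [genRiem_eq, curv_add_right, curv_add_left, dualAt_add, sec_add_apply, map_add,
        LinearMap.add_apply]
      ring
    · intro f q
      simp only [genRiem_eq, curv_fsmul_right, curv_fsmul_left, dualAt_fsmul, fsmul_apply,
        map_smul, map_add, map_sub, LinearMap.add_apply, LinearMap.sub_apply,
        LinearMap.smul_apply, smul_eq_mul]
      ring

end GeneralisedConnection

namespace GeneralisedMetric

variable {d : ℕ} {M : Type*} [TopologicalSpace M] [ChartedSpace (EuclideanSpace ℝ (Fin d)) M]
  [IsManifold (𝓡 d) ∞ M] {F : Type*} [NormedAddCommGroup F] [NormedSpace ℝ F]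
  [FiniteDimensional ℝ F] {V : M → Type*} [TopologicalSpace (TotalSpace F V)]
  [∀ x, TopologicalSpace (V x)] [FiberBundle F V] [∀ x, AddCommGroup (V x)]
  [∀ x, Module ℝ (V x)] [VectorBundle ℝ F V]
  {C : ExactCourantAlgebroid d F V} (G : GeneralisedMetric C)
  [T2Space M] [ContMDiffVectorBundle ∞ F V (𝓡 d)]

/-! ### Traces over the Courant algebroid -/

theorem traceE_eq_plus_minus (x : M) (T : V x →ₗ[ℝ] V x →ₗ[ℝ] ℝ) :
    GeneralisedConnection.traceE C x (fun p q => T p q) =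
      trace (G.g x) (fun u v => T (G.liftPlus x u) (G.liftPlus x v))
        - trace (G.g x) (fun u v => T (G.liftMinus x u) (G.liftMinus x v)) := by
  have : FiniteDimensional ℝ (V x) := VectorBundle.finiteDimensional ℝ F V x
  obtain ⟨e, e', he⟩ := G.exists_dual_frames x
  have hx := G.eq_sum_dual_frame he.self_of_nhds
  have h1 := trace_eq_sum (G.g_nondeg x) (G.g_symm x) hx
    (T.compl₁₂ (G.liftPlus x) (G.liftPlus x))
  have h2 := trace_eq_sum (G.g_nondeg x) (G.g_symm x) hx
    (T.compl₁₂ (G.liftMinus x) (G.liftMinus x))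
  -- The scalar product is g on E_+ and -g on E_-, so the dual of a lifted frame carries a minus
  -- sign on E_-.
  have h3 : ∀ w : V x, w = ∑ i, C.pairing x w
      (Sum.elim (fun i => G.liftPlus x (e' i x)) (fun i => - G.liftMinus x (e' i x)) i) •
      Sum.elim (fun i => G.liftPlus x (e i x)) (fun i => G.liftMinus x (e i x)) i := by
    intro w
    obtain ⟨u, v, rfl⟩ := G.eq_liftPlus_add_liftMinus w
    simp only [Fintype.sum_sum_type, Sum.elim_inl, Sum.elim_inr, map_add, map_neg,
      LinearMap.add_apply, pairing_plus_minus, pairing_minus_plus, pairing_minus_minus, ← g_apply,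
      add_zero, zero_add, neg_zero, neg_neg]
    simp only [← map_smul, ← map_sum, ← hx]
  have h4 := trace_eq_sum (C.pairing_nondeg x) (C.pairing_symm x) h3 T
  refine h4.trans ?_
  simp only [LinearMap.compl₁₂_apply] at h1 h2
  rw [h1, h2, Fintype.sum_sum_type]
  simp only [Sum.elim_inl, Sum.elim_inr, map_neg, Finset.sum_neg_distrib]
  ring

theorem traceE_eq {t : ℝ} (ht : t = 1 ∨ t = -1) (x : M) (T : V x →ₗ[ℝ] V x →ₗ[ℝ] ℝ) :
    GeneralisedConnection.traceE C x (fun p q => T p q) =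
      t * trace (G.g x) (fun u v => T (G.lift ht x u) (G.lift ht x v))
        - t * trace (G.g x)
          (fun u v => T (G.lift (neg_sign ht) x u) (G.lift (neg_sign ht) x v)) := by
  -- A free sign t' avoids the form -(-1) in the lift when t = -1.
  have key : ∀ (t' : ℝ) (ht' : t' = 1 ∨ t' = -1), t' = -t →
      GeneralisedConnection.traceE C x (fun p q => T p q) =
      t * trace (G.g x) (fun u v => T (G.lift ht x u) (G.lift ht x v))
        - t * trace (G.g x) (fun u v => T (G.lift ht' x u) (G.lift ht' x v)) := by
    intro t' ht' h
    rcases ht with rfl | rfl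
    · subst h
      rw [traceE_eq_plus_minus, one_mul, one_mul]
      rfl
    · obtain rfl : t' = 1 := by linarith
      rw [traceE_eq_plus_minus, neg_one_mul, neg_one_mul, sub_neg_eq_add, neg_add_eq_sub]
      rfl
  exact key _ _ rfl

theorem endoSec_liftSec {t : ℝ} (ht : t = 1 ∨ t = -1) (Y : VecField d M) :
    G.endoSec (G.liftSec ht Y) = t • G.liftSec ht Y :=
  ContMDiffSection.ext fun x => G.mem_eigen.1 (G.lift_mem ht x (Y x))

omit [FiniteDimensional ℝ F] [T2Space M] [ContMDiffVectorBundle ∞ F V (𝓡 d)] in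
theorem endoSec_sub (a b : Sec d F V) : G.endoSec (a - b) = G.endoSec a - G.endoSec b :=
  ContMDiffSection.ext fun x => map_sub (G.endo x) _ _

omit [T2Space M] [ContMDiffVectorBundle ∞ F V (𝓡 d)] in
theorem pairing_eq_zero_of_endoSec {t : ℝ} (ht : t = 1 ∨ t = -1) {a : Sec d F V}
    (ha : G.endoSec a = t • a) {x : M} {b : V x} (hb : b ∈ G.eigen (-t) x) :
    C.pairing x (a x) b = 0 :=
  G.pairing_eq_zero_of_mem_eigen ht
    (G.mem_eigen.2 (congrArg (fun s : Sec d F V => s x) ha)) hb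

theorem liftSec_anchorSec_of_endoSec {t : ℝ} (ht : t = 1 ∨ t = -1) {a : Sec d F V}
    (ha : G.endoSec a = t • a) : G.liftSec ht (C.anchorSec a) = a :=
  G.liftSec_anchorSec ht fun x => G.mem_eigen.2 (congrArg (fun s : Sec d F V => s x) ha)

end GeneralisedMetric

namespace GeneralisedConnection.IsLeviCivita

variable {d : ℕ} {M : Type*} [TopologicalSpace M] [ChartedSpace (EuclideanSpace ℝ (Fin d)) M]
  [IsManifold (𝓡 d) ∞ M] {F : Type*} [NormedAddCommGroup F] [NormedSpace ℝ F]
  [FiniteDimensional ℝ F] {V : M → Type*} [TopologicalSpace (TotalSpace F V)]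
  [∀ x, TopologicalSpace (V x)] [FiberBundle F V] [∀ x, AddCommGroup (V x)]
  [∀ x, Module ℝ (V x)] [VectorBundle ℝ F V]
  {C : ExactCourantAlgebroid d F V} {G : GeneralisedMetric C} {D : GeneralisedConnection C}

/-! ### Generalised Levi-Civita connections -/

omit [FiniteDimensional ℝ F] in
theorem endoSec_D (hD : D.IsLeviCivita G) {t : ℝ} (u : Sec d F V) {v : Sec d F V}
    (hv : G.endoSec v = t • v) : G.endoSec (D.D u v) = t • D.D u v := by
  rw [← hD.parallel, hv, map_smul]

variable [T2Space M] [ContMDiffVectorBundle ∞ F V (𝓡 d)]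

omit [FiniteDimensional ℝ F] [T2Space M] [ContMDiffVectorBundle ∞ F V (𝓡 d)] in
theorem endoSec_curv (hD : D.IsLeviCivita G) {t : ℝ} (v w : Sec d F V) {b : Sec d F V}
    (hb : G.endoSec b = t • b) : G.endoSec (D.curv v w b) = t • D.curv v w b := by
  simp only [curv, G.endoSec_sub, hD.endoSec_D _ (hD.endoSec_D _ hb), hD.endoSec_D _ hb, smul_sub]

/-- A generalised Levi-Civita connection is given by a Bismut connection on mixed pairs. -/
theorem D_liftSec_neg (hD : D.IsLeviCivita G) {t : ℝ} (ht : t = 1 ∨ t = -1) (Y Z : VecField d M) :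
    D.D (G.liftSec (neg_sign ht) Y) (G.liftSec ht Z) = G.liftSec ht (G.bismut ht Y Z) := by
  have e1 := hD.endoSec_D (G.liftSec (neg_sign ht) Y) (G.endoSec_liftSec ht Z)
  rw [← G.liftSec_anchorSec_of_endoSec ht e1]
  congr 1
  refine G.sec_ext_of_smul_gfun ht fun W => ?_
  rw [← G.gfun_bismut ht, ← G.pair_liftSec ht, G.liftSec_anchorSec_of_endoSec ht e1]
  refine ContMDiffMap.ext fun x => ?_
  -- Torsion is tested on (Y_{-t}, Z_t, W_t). As D preserves E_{-t}, both D_Z Y and D_W Y pair to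
  -- zero with E_t, and only D_Y Z - [Y, Z] remains.
  have h1 := hD.torsion_free (G.liftSec (neg_sign ht) Y) (G.liftSec ht Z) (G.liftSec ht W) x
  have h2 : C.pairing x (D.D (G.liftSec ht Z) (G.liftSec (neg_sign ht) Y) x)
      (G.liftSec ht W x) = 0 :=
    G.pairing_eq_zero_of_endoSec (neg_sign ht)
      (hD.endoSec_D _ (G.endoSec_liftSec (neg_sign ht) Y)) (by
        rw [neg_neg]
        exact G.lift_mem ht x _)
  have h3 : C.pairing x (D.D (G.liftSec ht W) (G.liftSec (neg_sign ht) Y) x)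
      (G.liftSec ht Z x) = 0 :=
    G.pairing_eq_zero_of_endoSec (neg_sign ht)
      (hD.endoSec_D _ (G.endoSec_liftSec (neg_sign ht) Y)) (by
        rw [neg_neg]
        exact G.lift_mem ht x _)
  rw [torsion, h3, add_zero, sec_sub_apply, sec_sub_apply, map_sub, map_sub, LinearMap.sub_apply,
    LinearMap.sub_apply, h2, sub_zero, sub_eq_zero] at h1
  exact h1

/-- The endomorphism `W ↦ π(D_W Z)`, for the lifts of `W` and `Z` to `E_±`. -/
def endo (D : GeneralisedConnection C) (G : GeneralisedMetric C) {t : ℝ} (ht : t = 1 ∨ t = -1)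
    (Z : VecField d M) : TangentEndo d M where
  toFun W := C.anchorSec (D.D (G.liftSec ht W) (G.liftSec ht Z))
  map_add W W' := by rw [G.liftSec_add, map_add, LinearMap.add_apply, GeneralisedMetric.anchorSec_add]
  map_fsmul f W := by
    rw [G.liftSec_fsmul, D.smul_left]
    exact ContMDiffSection.ext fun x => map_smul (C.anchor x) _ _

theorem liftSec_endo (hD : D.IsLeviCivita G) {t : ℝ} (ht : t = 1 ∨ t = -1) (W Z : VecField d M) :
    G.liftSec ht ((endo D G ht Z).toFun W) = D.D (G.liftSec ht W) (G.liftSec ht Z) :=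
  G.liftSec_anchorSec_of_endoSec ht (hD.endoSec_D _ (G.endoSec_liftSec ht Z))

/-- D Z_t takes values in E_t, so the E_{-t} half of the trace vanishes. The endomorphism W ↦ π(D_W
Z) itself is not fixed by the metric, but its trace is read off from the divergence. -/
theorem divergence_liftSec (hD : D.IsLeviCivita G) {t : ℝ} (ht : t = 1 ∨ t = -1)
    (Z : VecField d M) (x : M) :
    D.divergence (G.liftSec ht Z) x = G.endoTrace (endo D G ht Z) x := by
  have h0 : D.divergence (G.liftSec ht Z) x = traceE C x
      fun p q => (LinearMap.comp (C.pairing x) (D.endoAt (G.liftSec ht Z) x)) p q := by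
    rw [GeneralisedConnection.divergence]
    refine congrArg _ (funext₂ fun p q => ?_)
    rw [LinearMap.comp_apply, ← D.endoAt_apply, ext_self]
  have h1 : ∀ u v : TangentSpace (𝓡 d) x,
      (LinearMap.comp (C.pairing x) (D.endoAt (G.liftSec ht Z) x)) (G.lift ht x u)
        (G.lift ht x v) = t * G.g x ((endo D G ht Z).atPoint x u) v := by
    intro u v
    rw [← ext_self (d := d) (F := EuclideanSpace ℝ (Fin d)) u, TangentEndo.atPoint_apply,
      ← G.pairing_lift_lift ht, LinearMap.comp_apply, ← G.liftSec_apply, D.endoAt_apply,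
      ← hD.liftSec_endo ht, G.liftSec_apply]
  have h2 : ∀ u v : TangentSpace (𝓡 d) x,
      (LinearMap.comp (C.pairing x) (D.endoAt (G.liftSec ht Z) x)) (G.lift (neg_sign ht) x u)
        (G.lift (neg_sign ht) x v) = 0 := by
    intro u v
    rw [← ext_self (d := d) (F := EuclideanSpace ℝ (Fin d)) u, LinearMap.comp_apply,
      ← G.liftSec_apply, D.endoAt_apply]
    exact G.pairing_eq_zero_of_endoSec ht (hD.endoSec_D _ (G.endoSec_liftSec ht Z))
      (G.lift_mem _ x v)
  rw [h0, G.traceE_eq ht]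
  simp only [h1, h2]
  rw [trace_mul_left, ← mul_assoc, sign_mul_self ht, one_mul,
    trace_form_comp (G.g_nondeg x) (G.g_symm x), GeneralisedMetric.endoTrace_apply]
  have h3 : trace (G.g x) (fun _ _ => (0 : ℝ)) = 0 := by simp [trace]
  rw [h3, mul_zero, sub_zero]

/-- The endomorphism `W ↦ π(R(W,Y)Z)`, for the lifts of `W` and `Z` to `E_±` and of `Y` to
`E_∓`. -/
def curvAt (D : GeneralisedConnection C) (G : GeneralisedMetric C) {t : ℝ} (ht : t = 1 ∨ t = -1)
    (Y Z : VecField d M) (x : M) : TangentSpace (𝓡 d) x →ₗ[ℝ] TangentSpace (𝓡 d) x :=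
  (endo D G ht (G.bismut ht Y Z)).atPoint x
    - ((G.isMetricConnection_bismut ht).derEndo Y (endo D G ht Z)).atPoint x
    - G.bismutAt ht Z x ∘ₗ G.bismutAt (neg_sign ht) Y x

/-- Resolves D along a mixed bracket into a Bismut derivative and a pure derivative. -/
theorem bracket_liftSec {t : ℝ} (ht : t = 1 ∨ t = -1) (W Y : VecField d M) :
    C.bracket (G.liftSec ht W) (G.liftSec (neg_sign ht) Y) =
      G.liftSec (neg_sign ht) (G.bismut (neg_sign ht) W Y) - G.liftSec ht (G.bismut ht Y W) := by
  have h1 := G.projSec_add_projSec_neg t (C.bracket (G.liftSec ht W) (G.liftSec (neg_sign ht) Y))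
  have h2 : G.projSec t (C.bracket (G.liftSec ht W) (G.liftSec (neg_sign ht) Y)) =
      - G.liftSec ht (G.bismut ht Y W) := by
    rw [C.bracket_swap_of_orthogonal (G.pair_liftSec_liftSec_neg ht W Y),
      GeneralisedMetric.projSec_neg, G.lift_bismut]
  rw [h2, neg_add_eq_sub] at h1
  rw [G.lift_bismut (neg_sign ht), G.liftSec_congr (neg_neg t) _ ht, h1]

/-- In D_{[W,Y]} Z the E_{-t}-part of the bracket gives the composition of Bismut endomorphisms; the
E_t-part joins D_Y D_W Z to form the covariant derivative of W ↦ π(D_W Z). -/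
theorem curvAt_apply (hD : D.IsLeviCivita G) {t : ℝ} (ht : t = 1 ∨ t = -1)
    (Y Z W : VecField d M) (x : M) :
    G.lift ht x (curvAt D G ht Y Z x (W x)) =
      D.curv (G.liftSec ht W) (G.liftSec (neg_sign ht) Y) (G.liftSec ht Z) x := by
  rw [curv, bracket_liftSec ht, hD.D_liftSec_neg ht, ← hD.liftSec_endo ht W Z,
    hD.D_liftSec_neg ht, map_sub, LinearMap.sub_apply, hD.D_liftSec_neg ht,
    ← hD.liftSec_endo ht, ← hD.liftSec_endo ht]
  simp only [curvAt, GeneralisedMetric.IsMetricConnection.derEndo, LinearMap.sub_apply,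
    LinearMap.comp_apply, G.bismutAt_apply, TangentEndo.atPoint_apply, sec_sub_apply, map_sub,
    G.liftSec_apply]
  abel

end GeneralisedConnection.IsLeviCivita

/-! ### One-forms evaluated on vector fields -/

section OneForms

variable {d : ℕ} {M : Type*} [TopologicalSpace M] [ChartedSpace (EuclideanSpace ℝ (Fin d)) M]
  [IsManifold (𝓡 d) ∞ M]

theorem contMDiff_oneForm_apply (ξ : OneForm d M) (Z : VecField d M) :
    ContMDiff (𝓡 d) 𝓘(ℝ, ℝ) ∞ fun x => (ξ x (Z x) : ℝ) := by
  intro x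
  have h := ContMDiffAt.clm_bundle_apply (ξ.contMDiff x) (Z.contMDiff x)
  rw [contMDiffAt_totalSpace] at h
  exact h.2

/-- The smooth function `ξ(Z)`. -/
def oneFormFun (ξ : OneForm d M) (Z : VecField d M) : C^∞⟮𝓡 d, M; ℝ⟯ :=
  ⟨fun x => ξ x (Z x), contMDiff_oneForm_apply ξ Z⟩

end OneForms

/-! ### The trace of the mixed curvature and the mixed Ricci tensor -/

namespace GeneralisedConnection.IsLeviCivita

variable {d : ℕ} {M : Type*} [TopologicalSpace M] [ChartedSpace (EuclideanSpace ℝ (Fin d)) M]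
  [IsManifold (𝓡 d) ∞ M] {F : Type*} [NormedAddCommGroup F] [NormedSpace ℝ F]
  [FiniteDimensional ℝ F] {V : M → Type*} [TopologicalSpace (TotalSpace F V)]
  [∀ x, TopologicalSpace (V x)] [FiberBundle F V] [∀ x, AddCommGroup (V x)]
  [∀ x, Module ℝ (V x)] [VectorBundle ℝ F V]
  {C : ExactCourantAlgebroid d F V} {G : GeneralisedMetric C} {D : GeneralisedConnection C}
  [T2Space M] [ContMDiffVectorBundle ∞ F V (𝓡 d)]

omit [T2Space M] [ContMDiffVectorBundle ∞ F V (𝓡 d)] in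
theorem pairing_splitting_lift {t : ℝ} (ht : t = 1 ∨ t = -1) (x : M)
    (u v : TangentSpace (𝓡 d) x) :
    C.pairing x (G.splitting x u) (G.lift ht x v) = (t / 2) * G.g x u v := by
  have h : G.splitting x u = (1 / 2 : ℝ) • (G.liftPlus x u + G.liftMinus x u) := rfl
  rw [h, map_smul, LinearMap.smul_apply, map_add, LinearMap.add_apply, smul_eq_mul]
  rcases ht with rfl | rfl
  · rw [show G.lift _ x v = G.liftPlus x v from rfl, ← G.g_apply, G.pairing_minus_plus]
    ring
  · rw [show G.lift _ x v = G.liftMinus x v from rfl, G.pairing_minus_minus, G.pairing_plus_minus]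
    ring

/-- This is where the prescribed divergence enters. The factor 2 in it cancels the halves in ⟨σX,
Z_t⟩ = (t/2) g(X, Z) and in ½ ξ(Z). -/
theorem endoTrace_endo (hD : D.IsLeviCivita G) {X : VecField d M} {ξ : OneForm d M}
    (hdiv : D.divergence = G.divergence X ξ) {t : ℝ} (ht : t = 1 ∨ t = -1) (Z : VecField d M) :
    G.endoTrace (endo D G ht Z) = G.vecDiv Z - (oneFormFun ξ Z + t • G.gfun X Z) := by
  refine ContMDiffMap.ext fun x => ?_
  rw [← hD.divergence_liftSec ht, hdiv, GeneralisedMetric.divergence, G.metricDiv_eq,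
    G.anchorSec_liftSec, GeneralisedMetric.pairSum, G.liftSec_apply, pairing_splitting_lift,
    G.anchor_lift]
  change _ = G.vecDiv Z x - (ξ x (Z x) + t * G.g x (X x) (Z x))
  ring

/-- Subtracting α = ξ + t gX from the metric divergence adds Y(α(Z)) - α(∇^t_Y Z) = (∇α)(Y, Z) -
(t/2) α(T(Y, Z)) to `bismut_ricci`. -/
theorem trace_curvAt (hD : D.IsLeviCivita G) {X : VecField d M} {ξ : OneForm d M}
    (hdiv : D.divergence = G.divergence X ξ) {t : ℝ} (ht : t = 1 ∨ t = -1) (Y Z : VecField d M)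
    (x : M) : LinearMap.trace ℝ _ (curvAt D G ht Y Z x) =
      G.ricci x (Y x) (Z x) - (1 / 4) * G.Hsq x (Y x) (Z x) - (t / 2) * G.codiffH x (Y x) (Z x)
      + G.nablaForm (fun y v => ξ y v) x (Y x) (Z x)
      + t * G.nablaForm (fun y v => G.g y (X y) v) x (Y x) (Z x)
      - (t / 2) * (ξ x (G.torsionAt x (Y x) (Z x))
        + t * G.g x (X x) (G.torsionAt x (Y x) (Z x))) := by
  have h1 : LinearMap.trace ℝ _ (curvAt D G ht Y Z x) =
      G.endoTrace (endo D G ht (G.bismut ht Y Z)) x - der Y (G.endoTrace (endo D G ht Z)) x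
        - LinearMap.trace ℝ _ (G.bismutAt ht Z x ∘ₗ G.bismutAt (neg_sign ht) Y x) := by
    rw [(G.isMetricConnection_bismut ht).der_endoTrace, curvAt, map_sub, map_sub]
    rfl
  have h2 := G.bismut_ricci ht Y Z x
  have h3 := G.nablaForm_eq (fun y => (ξ y : TangentSpace (𝓡 d) y →ₗ[ℝ] ℝ))
    (fun Z => contMDiff_oneForm_apply ξ Z) Y Z x
  have h4 := G.nablaForm_eq (fun y => G.g y (X y)) (fun Z => (G.gfun X Z).contMDiff) Y Z x
  have h5 : der Y (oneFormFun ξ Z) x = G.nablaForm (fun y v => ξ y v) x (Y x) (Z x)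
      + ξ x (G.leviCivita Y Z x) := eq_add_of_sub_eq h3.symm
  have h6 : der Y (G.gfun X Z) x = G.nablaForm (fun y v => G.g y (X y) v) x (Y x) (Z x)
      + G.g x (X x) (G.leviCivita Y Z x) := eq_add_of_sub_eq h4.symm
  have h7 : ξ x (G.bismut ht Y Z x) = ξ x (G.leviCivita Y Z x)
      + (t / 2) * ξ x (G.torsionAt x (Y x) (Z x)) := by
    rw [G.bismut_apply, G.torsionAt_apply, map_add, map_smul]
    rfl
  have h8 : G.g x (X x) (G.bismut ht Y Z x) = G.g x (X x) (G.leviCivita Y Z x)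
      + (t / 2) * G.g x (X x) (G.torsionAt x (Y x) (Z x)) := by
    rw [G.bismut_apply, G.torsionAt_apply, map_add, map_smul]
    rfl
  have h9 : der Y (G.endoTrace (endo D G ht Z)) x = der Y (G.vecDiv Z) x
      - (der Y (oneFormFun ξ Z) x + t * der Y (G.gfun X Z) x) := by
    rw [hD.endoTrace_endo hdiv, der_sub, der_add, der_smul]
    rfl
  have h10 : G.endoTrace (endo D G ht (G.bismut ht Y Z)) x = G.vecDiv (G.bismut ht Y Z) x
      - (ξ x (G.bismut ht Y Z x) + t * G.g x (X x) (G.bismut ht Y Z x)) := by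
    rw [hD.endoTrace_endo hdiv]
    rfl
  rw [h1, h9, h10, h5, h6, h7, h8]
  linear_combination h2

/-- On each half of the trace only one curvature term survives, since D and its curvature operators
preserve E_+ and E_-: with b = Y_{-t} and a = Z_t it is ⟨R(b,p)q, a⟩ for p, q in E_t and ⟨R(q,a)b,
p⟩ for p, q in E_{-t}. -/
theorem genRicci_liftSec (hD : D.IsLeviCivita G) {t : ℝ} (ht : t = 1 ∨ t = -1)
    (Y Z : VecField d M) (x : M) :
    D.genRicci (G.liftSec (neg_sign ht) Y) (G.liftSec ht Z) x =
      (1 / 2) * (LinearMap.trace ℝ _ (curvAt D G ht Y Z x)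
        + LinearMap.trace ℝ _ (curvAt D G (neg_sign ht) Z Y x)) := by
  obtain ⟨T, hT⟩ := D.exists_genRiem_bilinear (G.liftSec (neg_sign ht) Y) (G.liftSec ht Z) x
  have hmem : ∀ {r : ℝ} (hr : r = 1 ∨ r = -1) (W : VecField d M),
      G.liftSec hr W x ∈ G.eigen r x := fun hr W => G.lift_mem hr x _
  have hmem' : ∀ {r : ℝ} (hr : r = 1 ∨ r = -1) (W : VecField d M),
      G.liftSec hr W x ∈ G.eigen (-(-r)) x := fun hr W => by
    rw [neg_neg]
    exact G.lift_mem hr x _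
  have h0 : D.genRicci (G.liftSec (neg_sign ht) Y) (G.liftSec ht Z) x =
      traceE C x fun p q => T p q := by
    rw [genRicci]
    refine congrArg _ (funext₂ fun p q => ?_)
    rw [← hT, ext_self, ext_self]
  have hdual : ∀ {r : ℝ} (hr : r = 1 ∨ r = -1) (q a : VecField d M),
      D.dualAt (G.liftSec hr q) (G.liftSec (neg_sign hr) a) x = 0 := by
    intro r hr q a
    refine C.pairing_ext fun u => ?_
    rw [← ext_self (d := d) (F := F) u, D.pairing_dualAt, D.endoAt_apply, map_zero,
      LinearMap.zero_apply]
    exact G.pairing_eq_zero_of_endoSec hr (hD.endoSec_D _ (G.endoSec_liftSec hr q))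
      (hmem (neg_sign hr) a)
  have h1 : ∀ u v : TangentSpace (𝓡 d) x, T (G.lift ht x u) (G.lift ht x v) =
      (t / 2) * G.g x (curvAt D G ht Y Z x u) v := by
    intro u v
    rw [← ext_self (d := d) (F := EuclideanSpace ℝ (Fin d)) u,
      ← ext_self (d := d) (F := EuclideanSpace ℝ (Fin d)) v, ← G.liftSec_apply,
      ← G.liftSec_apply, hT, D.genRiem_eq]
    have e1 : C.pairing x (D.curv (G.liftSec ht (ext v)) (G.liftSec ht Z)
        (G.liftSec (neg_sign ht) Y) x) (G.liftSec ht (ext u) x) = 0 :=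
      G.pairing_eq_zero_of_endoSec (neg_sign ht)
        (hD.endoSec_curv _ _ (G.endoSec_liftSec (neg_sign ht) Y)) (hmem' ht _)
    have e2 : C.pairing x (D.endoAt (G.liftSec (neg_sign ht) Y) x
        (D.dualAt (G.liftSec ht (ext v)) (G.liftSec ht Z) x)) (G.liftSec ht (ext u) x) = 0 := by
      rw [← ext_self (d := d) (F := F) (D.dualAt _ _ x), D.endoAt_apply]
      exact G.pairing_eq_zero_of_endoSec (neg_sign ht)
        (hD.endoSec_D _ (G.endoSec_liftSec (neg_sign ht) Y)) (hmem' ht _)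
    have e3 := congrArg (fun f => f x) (D.pair_curv_swap (G.liftSec (neg_sign ht) Y)
      (G.liftSec ht (ext u)) (G.liftSec ht (ext v)) (G.liftSec ht Z))
    have e4 : C.pairing x (D.curv (G.liftSec (neg_sign ht) Y) (G.liftSec ht (ext u))
        (G.liftSec ht (ext v)) x) (G.liftSec ht Z x) =
      - C.pairing x (D.curv (G.liftSec (neg_sign ht) Y) (G.liftSec ht (ext u))
        (G.liftSec ht Z) x) (G.liftSec ht (ext v) x) := e3
    -- Skewness in the last pair and in the orthogonal first pair turns ⟨R(b,p)q, a⟩ into ⟨R(p,b)a,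
    -- q⟩, with p in the slot of the traced endomorphism.
    rw [map_add, LinearMap.add_apply, e1, e2, e4,
      D.curv_swap (G.pair_liftSec_neg ht Y (ext u)), sec_neg_apply, map_neg,
      LinearMap.neg_apply, ← hD.curvAt_apply ht, G.liftSec_apply ht (ext v),
      G.pairing_lift_lift]
    ring
  have h2 : ∀ u v : TangentSpace (𝓡 d) x,
      T (G.lift (neg_sign ht) x u) (G.lift (neg_sign ht) x v) =
      (-t / 2) * G.g x (curvAt D G (neg_sign ht) Z Y x v) u := by
    intro u v
    rw [← ext_self (d := d) (F := EuclideanSpace ℝ (Fin d)) u,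
      ← ext_self (d := d) (F := EuclideanSpace ℝ (Fin d)) v, ← G.liftSec_apply,
      ← G.liftSec_apply, hT, D.genRiem_eq]
    have e0 : G.liftSec ht Z = G.liftSec (neg_sign (neg_sign ht)) Z :=
      G.liftSec_congr (neg_neg t).symm _ _ Z
    have e1 : C.pairing x (D.curv (G.liftSec (neg_sign ht) Y) (G.liftSec (neg_sign ht) (ext u))
        (G.liftSec (neg_sign ht) (ext v)) x) (G.liftSec ht Z x) = 0 :=
      G.pairing_eq_zero_of_endoSec (neg_sign ht)
        (hD.endoSec_curv _ _ (G.endoSec_liftSec (neg_sign ht) (ext v))) (hmem' ht _)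
    rw [e1, e0, hdual, map_zero, add_zero, add_zero, ← hD.curvAt_apply (neg_sign ht),
      G.liftSec_apply (neg_sign ht) (ext u), G.pairing_lift_lift]
    ring
  rw [h0, G.traceE_eq ht]
  simp only [h1, h2]
  rw [trace_mul_left, trace_mul_left, trace_form_comp (G.g_nondeg x) (G.g_symm x),
    -- On E_{-t} the endomorphism acts on the second traced vector, so the two slots are exchanged
    -- before taking its trace.
    trace_swap (G.g_symm x) (fun p q => G.g x (curvAt D G (neg_sign ht) Z Y x p) q),
    trace_form_comp (G.g_nondeg x) (G.g_symm x)]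
  linear_combination ((1 / 2) * (LinearMap.trace ℝ _ (curvAt D G ht Y Z x)
        + LinearMap.trace ℝ _ (curvAt D G (neg_sign ht) Z Y x))) * sign_mul_self ht

end GeneralisedConnection.IsLeviCivita

end GenGeom

end

/-! ### The formula for the mixed generalised Ricci tensor -/

theorem mainTheorem2 {d : ℕ} {M : Type*} [TopologicalSpace M] [T2Space M]
    [ChartedSpace (EuclideanSpace ℝ (Fin d)) M] [IsManifold (𝓡 d) ∞ M]
    {F : Type*} [NormedAddCommGroup F] [NormedSpace ℝ F] [FiniteDimensional ℝ F]
    {V : M → Type*} [TopologicalSpace (TotalSpace F V)] [∀ x, TopologicalSpace (V x)]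
    [FiberBundle F V] [∀ x, AddCommGroup (V x)] [∀ x, Module ℝ (V x)] [VectorBundle ℝ F V]
    [ContMDiffVectorBundle ∞ F V (𝓡 d)]
    (C : GenGeom.ExactCourantAlgebroid d F V) (G : GenGeom.GeneralisedMetric C)
    (X : GenGeom.VecField d M) (ξ : GenGeom.OneForm d M)
    (D : GenGeom.GeneralisedConnection C) (hD : D.IsLeviCivita G)
    (hdiv : D.divergence = G.divergence X ξ)
    (s : ℝ) (hs : s = 1 ∨ s = -1) (b a : GenGeom.Sec d F V)
    (hb : ∀ x, b x ∈ G.eigen (-s) x) (ha : ∀ x, a x ∈ G.eigen s x) (x : M) :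
    4 * D.genRicci b a x =
      4 * G.ricci x (C.anchor x (b x)) (C.anchor x (a x))
      - G.Hsq x (C.anchor x (b x)) (C.anchor x (a x))
      - s * 2 * G.codiffH x (C.anchor x (b x)) (C.anchor x (a x))
      + 4 * GenGeom.symPart (G.nablaForm (fun y v => ξ y v) x)
          (C.anchor x (b x)) (C.anchor x (a x))
      + s * 4 * GenGeom.antisymPart (G.nablaForm (fun y v => G.g y (X y) v) x)
          (C.anchor x (b x)) (C.anchor x (a x))
      - s * 2 * G.Hform ξ x (C.anchor x (b x)) (C.anchor x (a x)) := by
  have h := hD.genRicci_liftSec hs (C.anchorSec b) (C.anchorSec a) x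
  -- The second trace has sign -s and swapped arguments. Bringing every tensor back to the order (b,
  -- a) uses symmetry of Rc and H² and skewness of d^*H and T; the two terms g(X, T) then have
  -- opposite signs and cancel.
  rw [G.liftSec_anchorSec (GenGeom.neg_sign hs) hb, G.liftSec_anchorSec hs ha,
    hD.trace_curvAt hdiv, hD.trace_curvAt hdiv, G.ricci_symm x (C.anchorSec a x),
    G.Hsq_symm x (C.anchorSec a x), G.codiffH_swap x (C.anchorSec a x),
    G.torsionAt_swap x (C.anchorSec a x), map_neg, map_neg, ← G.Hform_eq] at h
  rw [GenGeom.symPart, GenGeom.antisymPart, h]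
  simp only [GenGeom.ExactCourantAlgebroid.anchorSec_apply]
  ring
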